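/- Let $n\ge 2$ and let $A_n$ be the free associative algebra over $\mathbb C$ on generators $x_1,\dots,x_n$. For an associative algebra $A$ put $L_1(A)=A$, $L_{i+1}(A)=[A,L_i(A)]$ (linear span of the commutators $[a,b]=ab-ba$ with $a\in A$, $b\in L_i(A)$), $M_i(A)=A\,L_i(A)\,A$, and write $M_{n,i}=M_i(A_n)$ and $y_{ij}=[x_i,x_j]$. Let $W_n=\mathrm{Der}\,\mathbb C[x_1,\dots,x_n]$ be the Lie algebra of polynomial vector fields on $\mathbb C^n$. Let $\psi$ be the algebra homomorphism from $A_n$ to the algebra of even polynomial differential forms on $\mathbb C^n$ with product $a*b=a\wedge b+da\wedge db$, determined by $\psi(x_i)=x_i$ (it identifies $A_n/M_{n,3}$ with this algebra). Say that a derivation $D$ of $A_n$ lifts $X\in W_n$ if $\psi(Da)=\mathcal L_X\psi(a)$ for all $a\in A_n$, where $\mathcal L_X$ is the Lie derivative of forms. Every $X\in W_n$ has a lift, and there is a representation of $W_n$ on $M_{n,3}/M_{n,4}$ in which each $X$ acts as the map induced by every derivation lifting $X$; this is the natural action of $W_n$. For a Young diagram $\mu$ let $\mathcal F_\mu$ be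 the $W_n$-module of polynomial covariant tensor fields on $\mathbb C^n$ of symmetry type $\mu$ (the image of the Young symmetrizer of $\mu$ on covariant tensor fields of rank $|\mu|$), with $W_n$ acting by Lie derivatives. **Proposition.** The $W_n$-modules $\mathcal F_{(2,1,0,\dots,0)}$ and $\mathcal F_{(2,2,0,\dots,0)}$ are irreducible, and as representations of $W_n$ $$M_{n,3}/M_{n,4}\;\cong\;\mathcal F_{(2,1,0,\dots,0)}\oplus\mathcal F_{(2,2,0,\dots,0)}.$$ More precisely, let $Y_n$ be the image of $L_3(A_n)$ in $M_{n,3}/M_{n,4}$ and let $Z_n$ be the $W_n$-submodule generated by the classes of the elements $y_{ij}y_{kl}+y_{ik}y_{jl}$ (which lie in $M_{n,3}$), $1\le i,j,k,l\le n$. Then $Y_n$ is a $W_n$-submodule, $M_{n,3}/M_{n,4}=Y_n\oplus Z_n$, $Y_n\cong\mathcal F_{(2,1,0,\dots,0)}$ and $Z_n\cong\mathcal F_{(2,2,0,\dots,0)}$. -/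

import Mathlib

open scoped TensorProduct

noncomputable section

namespace UnivLieNilp

/-! ### Lower central series of an associative algebra, and derivations -/

section Algebras

variable (A : Type*) [Ring A] [Algebra ℂ A]

/-- The lower central series of `A` regarded as a Lie algebra with `[a,b] = ab - ba`:
`L 1 = A` and `L (i+1) = [A, L i]` (linear span). The value at index `0` is a convention. -/
def L : ℕ → Submodule ℂ A
  | 0 => ⊤
  | 1 => ⊤
  | (k + 2) => Submodule.span ℂ {x | ∃ a : A, ∃ b ∈ L (k + 1), x = a * b - b * a}

/-- The two-sided ideal `M i = A · L i · A`, as a linear subspace of `A`. -/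
def M (i : ℕ) : Submodule ℂ A := ⊤ * L A i * ⊤

variable {A}

theorem comm_mem_L (k : ℕ) (a : A) {b : A} (hb : b ∈ L A (k + 1)) :
    a * b - b * a ∈ L A (k + 2) :=
  Submodule.subset_span ⟨a, b, hb, rfl⟩

theorem mul_mem_M {i : ℕ} (a c : A) {b : A} (hb : b ∈ L A i) : a * b * c ∈ M A i :=
  Submodule.mul_mem_mul (Submodule.mul_mem_mul Submodule.mem_top hb) Submodule.mem_top

theorem L_le_M (i : ℕ) : L A i ≤ M A i := fun b hb => by
  simpa using mul_mem_M (1 : A) 1 hb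

theorem mul_L_mem_M {i : ℕ} (a : A) {b : A} (hb : b ∈ L A i) : a * b ∈ M A i := by
  simpa using mul_mem_M a 1 hb

theorem L_mul_mem_M {i : ℕ} (c : A) {b : A} (hb : b ∈ L A i) : b * c ∈ M A i := by
  simpa using mul_mem_M 1 c hb

/-- Derivations of a (noncommutative) algebra. -/
def IsDerivation (D : A →ₗ[ℂ] A) : Prop := ∀ a b, D (a * b) = D a * b + a * D b

theorem IsDerivation.map_L {D : A →ₗ[ℂ] A} (hD : IsDerivation D) :
    ∀ i : ℕ, ∀ a ∈ L A i, D a ∈ L A i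
  | 0, _, _ => Submodule.mem_top
  | 1, _, _ => Submodule.mem_top
  | (k + 2), x, hx => by
    change x ∈ Submodule.span ℂ _ at hx
    induction hx using Submodule.span_induction with
    | mem x h =>
      obtain ⟨a, b, hb, rfl⟩ := h
      have h1 := comm_mem_L k (D a) hb
      have h2 := comm_mem_L k a (IsDerivation.map_L hD (k + 1) b hb)
      have h3 : D (a * b - b * a) = (D a * b - b * D a) + (a * D b - D b * a) := by
        rw [map_sub, hD, hD]; abel
      rw [h3]
      exact add_mem h1 h2
    | zero => simp
    | add x y _ _ h1 h2 => rw [map_add]; exact add_mem h1 h2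
    | smul c x _ h => rw [map_smul]; exact Submodule.smul_mem _ c h

theorem IsDerivation.map_M {D : A →ₗ[ℂ] A} (hD : IsDerivation D) (i : ℕ) :
    ∀ a ∈ M A i, D a ∈ M A i := by
  intro x hx
  refine Submodule.mul_induction_on hx ?_ ?_
  · intro m hm c _
    refine Submodule.mul_induction_on hm ?_ ?_
    · intro a _ b hb
      have h : D (a * b * c) = D a * b * c + a * D b * c + a * b * D c := by
        rw [hD, hD, add_mul]
      rw [h]
      exact add_mem (add_mem (mul_mem_M _ _ hb) (mul_mem_M _ _ (hD.map_L i b hb)))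
        (mul_mem_M _ _ hb)
    · intro a b h1 h2
      rw [add_mul, map_add]; exact add_mem h1 h2
  · intro a b h1 h2
    rw [map_add]; exact add_mem h1 h2

variable (A) in
/-- The quotient `M i / M (i+1)` (that is, `M i / (M i ∩ M (i+1))`; in fact
`M (i+1) ⊆ M i` for `i ≥ 1`). -/
abbrev Gr (i : ℕ) : Type _ := M A i ⧸ (M A (i + 1)).submoduleOf (M A i)

/-- The class in `M i / M (i+1)` of an element of `M i`. -/
def toGr (i : ℕ) : M A i →ₗ[ℂ] Gr A i := ((M A (i + 1)).submoduleOf (M A i)).mkQ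

/-- The endomorphism of `M i / M (i+1)` induced by a derivation of `A`. -/
def IsDerivation.onGr {D : A →ₗ[ℂ] A} (hD : IsDerivation D) (i : ℕ) : Gr A i →ₗ[ℂ] Gr A i :=
  Submodule.mapQ _ _ (D.restrict (hD.map_M i)) fun x hx => hD.map_M (i + 1) (x : A) hx

theorem IsDerivation.onGr_toGr {D : A →ₗ[ℂ] A} (hD : IsDerivation D) (i : ℕ) (x : M A i) :
    hD.onGr i (toGr i x) = toGr i ⟨D x, hD.map_M i x x.2⟩ := rfl

end Algebras

/-! ### The free algebra -/

/-- The free associative algebra over `ℂ` in `n` generators. -/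
abbrev FreeAlg (n : ℕ) : Type := FreeAlgebra ℂ (Fin n)

/-- `y i j = [x i, x j]`. -/
def y {n : ℕ} (i j : Fin n) : FreeAlg n :=
  FreeAlgebra.ι ℂ i * FreeAlgebra.ι ℂ j - FreeAlgebra.ι ℂ j * FreeAlgebra.ι ℂ i

theorem yy_mem_M {n : ℕ} (i j k l : Fin n) : y i j * y k l + y i k * y j l ∈ M (FreeAlg n) 3 := by
  have c2 : ∀ a b : FreeAlg n, a * b - b * a ∈ L (FreeAlg n) 2 := fun a b =>
    comm_mem_L 0 a Submodule.mem_top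
  have c3 : ∀ a b c : FreeAlg n, a * (b * c - c * b) - (b * c - c * b) * a ∈ L (FreeAlg n) 3 :=
    fun a b c => comm_mem_L 1 a (c2 b c)
  unfold y
  set a := FreeAlgebra.ι ℂ j
  set b := FreeAlgebra.ι ℂ i
  set c := FreeAlgebra.ι ℂ k
  set d := FreeAlgebra.ι ℂ l
  have e : (b * a - a * b) * (c * d - d * c) + (b * c - c * b) * (a * d - d * a)
      = (d * ((a * c) * b - b * (a * c)) - ((a * c) * b - b * (a * c)) * d)
        - a * (d * (c * b - b * c) - (c * b - b * c) * d)
        - (d * (a * b - b * a) - (a * b - b * a) * d) * c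
        + ((b * c - c * b) * (a * d - d * a) - (a * d - d * a) * (b * c - c * b)) := by
    noncomm_ring
  rw [e]
  exact add_mem (sub_mem (sub_mem (L_le_M 3 (c3 _ _ _)) (mul_L_mem_M _ (c3 _ _ _)))
    (L_mul_mem_M _ (c3 _ _ _))) (L_le_M 3 (c3 _ _ _))

/-! ### Polynomial vector fields and polynomial differential forms on `ℂ^n` -/

/-- The polynomial algebra `ℂ[x_1, …, x_n]`. -/
abbrev Poly (n : ℕ) : Type := MvPolynomial (Fin n) ℂ

/-- The Lie algebra `W_n` of polynomial vector fields `∑ f_i ∂_i` on `ℂ^n`. -/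
abbrev W (n : ℕ) : Type := Derivation ℂ (Poly n) (Poly n)

/-- Polynomial differential forms `ℂ[x_1, …, x_n] ⊗ Λ(dx_1, …, dx_n)`. -/
abbrev Forms (n : ℕ) : Type := Poly n ⊗[ℂ] ExteriorAlgebra ℂ (Fin n → ℂ)

/-- A polynomial as a `0`-form. -/
def fn {n : ℕ} (f : Poly n) : Forms n := f ⊗ₜ[ℂ] 1

/-- The `1`-form `dx_i`. -/
def dx {n : ℕ} (i : Fin n) : Forms n :=
  1 ⊗ₜ[ℂ] ExteriorAlgebra.ι ℂ (Pi.single i 1)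

/-- The exterior derivative `d ω = ∑ i, dx_i ∧ ∂_i ω`. -/
def extd (n : ℕ) : Forms n →ₗ[ℂ] Forms n :=
  ∑ i : Fin n, LinearMap.mulLeft ℂ (dx i) ∘ₗ
    LinearMap.rTensor _ (MvPolynomial.pderiv i : W n).toLinearMap

/-- The contraction `i_X ω = ∑ i, X_i · i_{∂_i} ω` with `X = ∑ i, X_i ∂_i`. -/
def contract {n : ℕ} (X : W n) : Forms n →ₗ[ℂ] Forms n :=
  ∑ i : Fin n, LinearMap.mulLeft ℂ (fn (X (MvPolynomial.X i))) ∘ₗ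
    LinearMap.lTensor _ (CliffordAlgebra.contractLeft (LinearMap.proj i))

/-- The Lie derivative of forms, `d i_X + i_X d`. -/
def lieForms {n : ℕ} (X : W n) : Forms n →ₗ[ℂ] Forms n :=
  extd n ∘ₗ contract X + contract X ∘ₗ extd n

/-- The product `a * b = a ∧ b + da ∧ db`, associative on even forms, as the operator
`b ↦ a * b`. -/
def starLeft {n : ℕ} (a : Forms n) : Forms n →ₗ[ℂ] Forms n :=
  LinearMap.mulLeft ℂ a + LinearMap.mulLeft ℂ (extd n a) ∘ₗ extd n

/-- The Feigin–Shoikhet map from the free algebra to the even forms with the product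
`a * b = a ∧ b + da ∧ db`: the homomorphism sending the generator `x_i` to the function `x_i`.
A word `x_{i_1} ⋯ x_{i_r}` is sent to `x_{i_1} * (x_{i_2} * (⋯ * (x_{i_r} * 1)))`.
It induces the isomorphism of `A_n / M_3` with even forms. -/
def toForms (n : ℕ) : FreeAlg n →ₗ[ℂ] Forms n :=
  LinearMap.applyₗ (1 : Forms n) ∘ₗ
    (FreeAlgebra.lift ℂ
      (fun i : Fin n => (starLeft (fn (MvPolynomial.X i)) : Module.End ℂ (Forms n)))).toLinearMap

/-- The derivation `D` of the free algebra lifts the vector field `X`: the derivation that `D`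
induces on the algebra of even forms with the product `a ∧ b + da ∧ db` (a quotient of the free
algebra) is the Lie derivative along `X`. -/
def Lifts {n : ℕ} (D : FreeAlg n →ₗ[ℂ] FreeAlg n) (X : W n) : Prop :=
  ∀ a, toForms n (D a) = lieForms X (toForms n a)

/-! ### Polynomial tensor fields -/

/-- Covariant polynomial tensor fields on `ℂ^n` with index positions labelled by `ι`, given by
their components: `t i` is the coefficient of `⨂ p, dx_{i p}`. -/
def Tensor (n : ℕ) (ι : Type) : Type := (ι → Fin n) → Poly n

instance (n : ℕ) (ι : Type) : AddCommGroup (Tensor n ι) :=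
  inferInstanceAs (AddCommGroup ((ι → Fin n) → Poly n))

instance (n : ℕ) (ι : Type) : Module ℂ (Tensor n ι) :=
  inferInstanceAs (Module ℂ ((ι → Fin n) → Poly n))

section Tensors

variable {n : ℕ} {ι : Type}

@[ext] theorem Tensor.ext {s t : Tensor n ι} (h : ∀ i, s i = t i) : s = t := funext h

@[simp] theorem Tensor.add_apply (s t : Tensor n ι) (i : ι → Fin n) : (s + t) i = s i + t i := rfl
@[simp] theorem Tensor.sub_apply (s t : Tensor n ι) (i : ι → Fin n) : (s - t) i = s i - t i := rfl
@[simp] theorem Tensor.zero_apply (i : ι → Fin n) : (0 : Tensor n ι) i = 0 := rfl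
@[simp] theorem Tensor.smul_apply (c : ℂ) (t : Tensor n ι) (i : ι → Fin n) :
    (c • t) i = c • t i := rfl

/-- Permutation of the index positions of a tensor field. -/
def permTensor (σ : Equiv.Perm ι) : Tensor n ι →ₗ[ℂ] Tensor n ι where
  toFun t := fun i => t (i ∘ σ)
  map_add' _ _ := rfl
  map_smul' _ _ := rfl

@[simp] theorem permTensor_apply (σ : Equiv.Perm ι) (t : Tensor n ι) (i : ι → Fin n) :
    permTensor σ t i = t (i ∘ σ) := rfl

variable [Fintype ι] [DecidableEq ι]

/-- The Lie derivative of covariant tensor fields,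
`(L_X t)_i = X(t_i) + ∑ p, ∑ j, ∂_{i_p}(X_j) t_{i with i_p replaced by j}`. -/
def lieTensor (X : W n) (t : Tensor n ι) : Tensor n ι := fun i =>
  X (t i) + ∑ p : ι, ∑ j : Fin n,
    MvPolynomial.pderiv (i p) (X (MvPolynomial.X j)) * t (Function.update i p j)

theorem lieTensor_apply (X : W n) (t : Tensor n ι) (i : ι → Fin n) :
    lieTensor X t i = X (t i) + ∑ p : ι, ∑ j : Fin n,
      MvPolynomial.pderiv (i p) (X (MvPolynomial.X j)) * t (Function.update i p j) := rfl

theorem vectorField_sum_apply {κ : Type} (s : Finset κ) (F : κ → W n) (f : Poly n) :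
    (∑ k ∈ s, F k) f = ∑ k ∈ s, F k f := by
  classical
  induction s using Finset.induction_on with
  | empty => simp
  | insert a s ha ih => rw [Finset.sum_insert ha, Finset.sum_insert ha, Derivation.add_apply, ih]

theorem pderiv_vectorField (X : W n) (a : Fin n) (f : Poly n) :
    MvPolynomial.pderiv a (X f) = X (MvPolynomial.pderiv a f)
      + ∑ k : Fin n, MvPolynomial.pderiv a (X (MvPolynomial.X k)) * MvPolynomial.pderiv k f := by
  have h : ⁅(MvPolynomial.pderiv a : W n), X⁆
      = ∑ k : Fin n, MvPolynomial.pderiv a (X (MvPolynomial.X k)) • MvPolynomial.pderiv k := by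
    refine MvPolynomial.derivation_ext fun j => ?_
    have h0 : X (MvPolynomial.pderiv a (MvPolynomial.X j)) = 0 := by
      classical
      rw [MvPolynomial.pderiv_X, Pi.single_apply]
      split_ifs <;> simp
    rw [Derivation.commutator_apply, h0, sub_zero, vectorField_sum_apply,
      Finset.sum_eq_single j]
    · simp
    · intro k _ hk
      simp [MvPolynomial.pderiv_X_of_ne hk.symm]
    · simp
  have h1 := DFunLike.congr_fun h f
  rw [Derivation.commutator_apply, vectorField_sum_apply] at h1
  rw [← sub_eq_iff_eq_add', h1]
  simp

theorem lieTensor_lie (X Y : W n) (t : Tensor n ι) :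
    lieTensor ⁅X, Y⁆ t = lieTensor X (lieTensor Y t) - lieTensor Y (lieTensor X t) := by
  ext1 i
  let G : W n → W n → ι → ι → Poly n := fun X Y p q => ∑ j : Fin n, ∑ l : Fin n,
    MvPolynomial.pderiv (i p) (X (MvPolynomial.X j)) *
      (MvPolynomial.pderiv (Function.update i p j q) (Y (MvPolynomial.X l)) *
        t (Function.update (Function.update i p j) q l))
  have hexp : ∀ X Y : W n, lieTensor X (lieTensor Y t) i = X (Y (t i))
      + ∑ p : ι, ∑ j : Fin n, X (MvPolynomial.pderiv (i p) (Y (MvPolynomial.X j))) *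
          t (Function.update i p j)
      + ∑ p : ι, ∑ j : Fin n, MvPolynomial.pderiv (i p) (Y (MvPolynomial.X j)) *
          X (t (Function.update i p j))
      + ∑ p : ι, ∑ j : Fin n, MvPolynomial.pderiv (i p) (X (MvPolynomial.X j)) *
          Y (t (Function.update i p j))
      + ∑ p : ι, ∑ q : ι, G X Y p q := by
    intro X Y
    have hG : ∑ p : ι, ∑ q : ι, G X Y p q = ∑ p : ι, ∑ j : Fin n,
        MvPolynomial.pderiv (i p) (X (MvPolynomial.X j)) * ∑ q : ι, ∑ l : Fin n,
          MvPolynomial.pderiv (Function.update i p j q) (Y (MvPolynomial.X l)) *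
            t (Function.update (Function.update i p j) q l) := by
      refine Finset.sum_congr rfl fun p _ => ?_
      simp only [G, Finset.mul_sum]
      rw [Finset.sum_comm]
    rw [hG]
    simp only [lieTensor_apply, map_add, map_sum, Derivation.leibniz, smul_eq_mul, mul_add,
      Finset.sum_add_distrib]
    simp only [mul_comm (t _)]
    ring
  have hoff : ∀ p q : ι, p ≠ q → G X Y p q = G Y X q p := by
    intro p q hpq
    simp only [G]
    rw [Finset.sum_comm]
    refine Finset.sum_congr rfl fun l _ => Finset.sum_congr rfl fun j _ => ?_
    rw [Function.update_of_ne hpq.symm, Function.update_of_ne hpq,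
      Function.update_comm hpq]
    ring
  have hdiag : ∀ X Y : W n, ∀ p : ι, G X Y p p = ∑ l : Fin n,
      (∑ j : Fin n, MvPolynomial.pderiv (i p) (X (MvPolynomial.X j)) *
        MvPolynomial.pderiv j (Y (MvPolynomial.X l))) * t (Function.update i p l) := by
    intro X Y p
    simp only [G, Function.update_self, Function.update_idem, Finset.sum_mul]
    rw [Finset.sum_comm]
    refine Finset.sum_congr rfl fun l _ => Finset.sum_congr rfl fun j _ => ?_
    ring
  have hQ : (∑ p : ι, ∑ q : ι, G X Y p q) - ∑ p : ι, ∑ q : ι, G Y X p q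
      = ∑ p : ι, (G X Y p p - G Y X p p) := by
    rw [Finset.sum_comm (f := fun p q => G Y X p q), ← Finset.sum_sub_distrib]
    refine Finset.sum_congr rfl fun p _ => ?_
    rw [← Finset.sum_sub_distrib, Finset.sum_eq_single p]
    · intro q _ hq
      rw [hoff p q hq.symm, sub_self]
    · simp
  have hfin : lieTensor ⁅X, Y⁆ t i = X (Y (t i)) - Y (X (t i))
      + (∑ p : ι, ∑ j : Fin n, X (MvPolynomial.pderiv (i p) (Y (MvPolynomial.X j))) *
          t (Function.update i p j)
        - ∑ p : ι, ∑ j : Fin n, Y (MvPolynomial.pderiv (i p) (X (MvPolynomial.X j))) *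
          t (Function.update i p j))
      + ∑ p : ι, (G X Y p p - G Y X p p) := by
    rw [lieTensor_apply, Derivation.commutator_apply, add_assoc]
    congr 1
    rw [← Finset.sum_sub_distrib, ← Finset.sum_add_distrib]
    refine Finset.sum_congr rfl fun p _ => ?_
    rw [hdiag, hdiag, ← Finset.sum_sub_distrib, ← Finset.sum_sub_distrib,
      ← Finset.sum_add_distrib]
    refine Finset.sum_congr rfl fun l _ => ?_
    rw [Derivation.commutator_apply, map_sub,
      pderiv_vectorField X (i p) (Y (MvPolynomial.X l)),
      pderiv_vectorField Y (i p) (X (MvPolynomial.X l))]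
    ring
  rw [Tensor.sub_apply, hexp, hexp, hfin, ← hQ]
  ring

/-- Tensor fields form a representation of `W_n` by Lie derivatives. -/
instance : LieRingModule (W n) (Tensor n ι) where
  bracket X t := lieTensor X t
  add_lie X Y t := by
    ext1 i
    simp only [Tensor.add_apply, lieTensor_apply, Derivation.add_apply, map_add, add_mul,
      Finset.sum_add_distrib]
    abel
  lie_add X s t := by
    ext1 i
    simp only [Tensor.add_apply, lieTensor_apply, map_add, mul_add, Finset.sum_add_distrib]
    abel
  leibniz_lie X Y t := by
    change lieTensor X (lieTensor Y t) = lieTensor ⁅X, Y⁆ t + lieTensor Y (lieTensor X t)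
    rw [lieTensor_lie, sub_add_cancel]

theorem lie_tensor_def (X : W n) (t : Tensor n ι) : ⁅X, t⁆ = lieTensor X t := rfl

instance : LieModule ℂ (W n) (Tensor n ι) where
  smul_lie c X t := by
    ext1 i
    have h : ∀ (a : Fin n) (f : Poly n),
        MvPolynomial.pderiv a (c • f) = c • MvPolynomial.pderiv a f :=
      fun a f => (MvPolynomial.pderiv a : W n).map_smul c f
    simp only [lie_tensor_def, Tensor.smul_apply, lieTensor_apply, Derivation.smul_apply,
      smul_add, Finset.smul_sum, h, smul_mul_assoc]
  lie_smul c X t := by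
    ext1 i
    simp only [lie_tensor_def, Tensor.smul_apply, lieTensor_apply, Derivation.map_smul, smul_add,
      Finset.smul_sum, mul_smul_comm]

theorem lie_permTensor (σ : Equiv.Perm ι) (X : W n) (t : Tensor n ι) :
    ⁅X, permTensor σ t⁆ = permTensor σ ⁅X, t⁆ := by
  ext1 i
  have h : ∀ p j, Function.update i (σ p) j ∘ σ = Function.update (i ∘ σ) p j := by
    intro p j
    rw [Function.update_comp_equiv, Equiv.symm_apply_apply]
  have h2 := Equiv.sum_comp σ (fun p : ι => ∑ j : Fin n,
    MvPolynomial.pderiv (i p) (X (MvPolynomial.X j)) * t (Function.update i p j ∘ σ))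
  simp only [h] at h2
  simp only [lie_tensor_def, permTensor_apply, lieTensor_apply]
  rw [← h2]
  simp only [Function.comp_apply]

end Tensors

/-- The Young symmetrizer of a Young diagram `μ`, acting on covariant tensor fields whose index
positions are the cells of `μ`: symmetrize along the rows of `μ`, then antisymmetrize along the
columns (without normalizing factors). -/
def youngSymmetrizer (n : ℕ) (μ : YoungDiagram) :
    Tensor n μ.cells →ₗ[ℂ] Tensor n μ.cells :=
  (∑ τ : Equiv.Perm μ.cells with ∀ c, (τ c).1.2 = c.1.2,
      (Equiv.Perm.sign τ : ℤ) • permTensor τ) ∘ₗ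
    (∑ σ : Equiv.Perm μ.cells with ∀ c, (σ c).1.1 = c.1.1, permTensor σ)

theorem lie_youngSymmetrizer {n : ℕ} (μ : YoungDiagram) (X : W n) (t : Tensor n μ.cells) :
    ⁅X, youngSymmetrizer n μ t⁆ = youngSymmetrizer n μ ⁅X, t⁆ := by
  simp only [youngSymmetrizer, LinearMap.comp_apply, LinearMap.sum_apply, LinearMap.smul_apply,
    lie_sum, lie_zsmul, lie_permTensor]

/-- The `W_n`-module of polynomial tensor fields of type `μ` on `ℂ^n`: covariant tensor fields
with values in the irreducible `GL(n)`-module obtained by the Young symmetrizer of `μ`, with `W_n`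
acting by Lie derivatives. -/
def TensorField (n : ℕ) (μ : YoungDiagram) : LieSubmodule ℂ (W n) (Tensor n μ.cells) where
  toSubmodule := LinearMap.range (youngSymmetrizer n μ)
  lie_mem := by
    rintro X _ ⟨t, rfl⟩
    exact ⟨⁅X, t⁆, (lie_youngSymmetrizer μ X t).symm⟩

/-- The Young diagram with rows of lengths `2, 1`. -/
def diagram21 : YoungDiagram := YoungDiagram.ofRowLens [2, 1] (by decide)

/-- The Young diagram with rows of lengths `2, 2`. -/
def diagram22 : YoungDiagram := YoungDiagram.ofRowLens [2, 2] (by decide)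

end UnivLieNilp

end

open UnivLieNilp

/-! Write Z for the submodule generated by the quadratic elements y_ij y_kl + y_ik y_jl, and Y for
the image of L₃. Three facts carry the argument.

The first is that M₃M₂, M₂M₃ and [A, M₃] lie in M₄ (`M_three_mul_M_two`, `M_two_mul_M_three`,
`lie_M_three`). Hence M₃/M₄ is a module over A/M₂ = ℂ[x₁, …, xₙ], and a derivation with values in M₃
induces zero on it. An element killed by ψ lies in M₃ (`mem_M_three_of_toForms_eq_zero`), so two
lifts of one vector field differ by such a derivation. This gives the action of W_n, with a Leibniz
rule over functions.

The second is that over ℂ[x] the module M₃/M₄ is generated by the quadratic elements and the triple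
commutators of generators (`eq_top_of_generators_mem`). Modulo M₃ the y_ij transform like dx_i ∧
dx_j. The quadratic elements therefore obey the tensor law exactly, and the triple commutators obey
it up to second derivatives times quadratic elements. Contraction with these generators yields
equivariant maps from F(2,2) to M₃/M₄, with image Z, and from F(2,1) onto the quotient by Z.

The third is the irreducibility of both tensor modules (`irreducible_of_highest`). A nonzero
submodule contains the constant highest weight tensor w. A combination of twofold Lie derivatives
acts on w as multiplication by an arbitrary function times a multiple of λ − λ², where λ is the
weight of w in the first coordinate (`second_difference`). Here λ = 2, so all function multiples of
w are reached, and gl_n does the rest.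

By irreducibility it is then enough that one triple commutator avoids Z and one quadratic element
avoids Y. Both are seen in the representation sending the first two generators to t E₁₂ and t E₂₁
and the others to 0. The t³ coefficient of the upper right entry kills Z but not [x₁, [x₁, x₂]]. The
t⁴ coefficient of the trace kills Y but not y₁₂². So both maps are injective, Y ∩ Z = 0, and Y fills
the quotient by Z. -/

noncomputable section

namespace UnivLieNilp

/-! ### Commutator identities in Lie nilpotent rings -/

section LieNilpotent

variable {R : Type*} [Ring R]

theorem ring_lie_add (a b c : R) : ⁅a, b + c⁆ = ⁅a, b⁆ + ⁅a, c⁆ := by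
  simp only [Ring.lie_def]; noncomm_ring

theorem ring_add_lie (a b c : R) : ⁅a + b, c⁆ = ⁅a, c⁆ + ⁅b, c⁆ := by
  simp only [Ring.lie_def]; noncomm_ring

theorem ring_lie_skew (a b : R) : ⁅a, b⁆ = -⁅b, a⁆ := by
  simp only [Ring.lie_def]; abel

theorem ring_lie_zero (a : R) : ⁅a, (0 : R)⁆ = 0 := by simp [Ring.lie_def]

theorem ring_lie_smul [Algebra ℂ R] (c : ℂ) (a b : R) : ⁅a, c • b⁆ = c • ⁅a, b⁆ := by
  simp [Ring.lie_def, smul_sub]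

/-- Expand [f, [d * e, [a, b]]] by Leibniz twice. It is a fourfold commutator, and so are the
brackets in the terms where f meets an inner bracket; only the two cross terms survive. -/
theorem lie3_mul_lie_alternating (H : ∀ a b c d : R, ⁅a, ⁅b, ⁅c, d⁆⁆⁆ = 0) (a b d e f : R) :
    ⁅d, ⁅a, b⁆⁆ * ⁅e, f⁆ = -(⁅e, ⁅a, b⁆⁆ * ⁅d, f⁆) := by
  have h : ⁅d, ⁅a, b⁆⁆ * ⁅e, f⁆ + ⁅e, ⁅a, b⁆⁆ * ⁅d, f⁆ =
      -⁅f, ⁅d * e, ⁅a, b⁆⁆⁆ + d * ⁅f, ⁅e, ⁅a, b⁆⁆⁆ + ⁅f, ⁅d, ⁅a, b⁆⁆⁆ * e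
        - ⁅⁅d, f⁆, ⁅e, ⁅a, b⁆⁆⁆ := by
    simp only [Ring.lie_def]; noncomm_ring
  rw [eq_neg_iff_add_eq_zero, h]
  simp [H]

/-- The product now sits in the innermost bracket: [e, [d, [a * c, b]]] leaves six cross terms.
Triple commutators commute with brackets, and four of the six cancel in pairs by
`lie3_mul_lie_alternating`. -/
theorem lie3_mul_lie_exchange (H : ∀ a b c d : R, ⁅a, ⁅b, ⁅c, d⁆⁆⁆ = 0) (a b c d e : R) :
    ⁅e, ⁅d, a⁆⁆ * ⁅c, b⁆ = -(⁅e, ⁅d, c⁆⁆ * ⁅a, b⁆) := by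
  have alt := lie3_mul_lie_alternating H
  have cen : ∀ p q r t u : R, ⁅p, q⁆ * ⁅r, ⁅t, u⁆⁆ = ⁅r, ⁅t, u⁆⁆ * ⁅p, q⁆ := by
    intro p q r t u
    have := H ⁅p, q⁆ r t u
    rwa [Ring.lie_def, sub_eq_zero] at this
  have h : ⁅e, ⁅d, ⁅a * c, b⁆⁆⁆ =
      a * ⁅e, ⁅d, ⁅c, b⁆⁆⁆ + ⁅e, ⁅d, ⁅a, b⁆⁆⁆ * c
      + (⁅e, a⁆ * ⁅d, ⁅c, b⁆⁆ + ⁅e, ⁅d, a⁆⁆ * ⁅c, b⁆ + ⁅d, a⁆ * ⁅e, ⁅c, b⁆⁆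
      + ⁅e, ⁅a, b⁆⁆ * ⁅d, c⁆ + ⁅a, b⁆ * ⁅e, ⁅d, c⁆⁆ + ⁅d, ⁅a, b⁆⁆ * ⁅e, c⁆) := by
    simp only [Ring.lie_def]; noncomm_ring
  rw [H, H, H, mul_zero, zero_mul, add_zero, zero_add, cen, cen, cen, alt c b d e a,
    alt a b d e c] at h
  rw [eq_neg_iff_add_eq_zero, h]
  abel

/-- In a ring in which all fourfold commutators vanish, `[d, [a, b]] [e, f] = 0`. -/
theorem lie3_mul_lie_eq_zero [Algebra ℂ R] (H : ∀ a b c d : R, ⁅a, ⁅b, ⁅c, d⁆⁆⁆ = 0)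
    (a b d e f : R) : ⁅d, ⁅a, b⁆⁆ * ⁅e, f⁆ = 0 := by
  have inner : ∀ a b d e f : R, ⁅d, ⁅a, b⁆⁆ * ⁅e, f⁆ = -(⁅d, ⁅b, a⁆⁆ * ⁅e, f⁆) := by
    intro a b d e f; simp only [Ring.lie_def]; noncomm_ring
  -- Inner skew-symmetry, exchange, alternation and exchange again compose to a rotation of (d, a,
  -- b) with sign +1. Jacobi then says that three times the product vanishes.
  have cyc : ∀ a b d e f : R, ⁅d, ⁅a, b⁆⁆ * ⁅e, f⁆ = ⁅a, ⁅b, d⁆⁆ * ⁅e, f⁆ := by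
    intro a b d e f
    rw [inner a b d e f, lie3_mul_lie_exchange H a f e b d, lie3_mul_lie_alternating H b e d a f,
      lie3_mul_lie_exchange H e f d b a]
    simp only [neg_neg]
  have jac : ⁅d, ⁅a, b⁆⁆ * ⁅e, f⁆ + ⁅a, ⁅b, d⁆⁆ * ⁅e, f⁆ + ⁅b, ⁅d, a⁆⁆ * ⁅e, f⁆ = 0 := by
    simp only [Ring.lie_def]; noncomm_ring
  rw [← cyc b d a, ← cyc a b d] at jac
  have h3 : (3 : ℂ) • (⁅d, ⁅a, b⁆⁆ * ⁅e, f⁆) = 0 := by rw [← jac]; module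
  exact (smul_eq_zero.mp h3).resolve_left (by norm_num)

end LieNilpotent

/-! ### The subspaces `M i` as two-sided ideals, and induction over their spanning elements. -/

section Ideals

variable (A : Type*) [Ring A] [Algebra ℂ A]

theorem mul_mem_M_left (i : ℕ) (r : A) {m : A} (hm : m ∈ M A i) : r * m ∈ M A i := by
  have h : (⊤ : Submodule ℂ A) * M A i ≤ M A i := by
    rw [M, ← mul_assoc, ← mul_assoc]
    gcongr
    exact le_top
  exact h (Submodule.mul_mem_mul Submodule.mem_top hm)

theorem mul_mem_M_right (i : ℕ) (r : A) {m : A} (hm : m ∈ M A i) : m * r ∈ M A i := by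
  have h : M A i * (⊤ : Submodule ℂ A) ≤ M A i := by
    rw [M, mul_assoc]
    gcongr
    exact le_top
  exact h (Submodule.mul_mem_mul hm Submodule.mem_top)

/-- `M i` as a two-sided ideal. -/
def idealM (i : ℕ) : Ideal A where
  carrier := M A i
  add_mem' := add_mem
  zero_mem' := zero_mem _
  smul_mem' r _ hm := mul_mem_M_left A i r hm

instance (i : ℕ) : (idealM A i).IsTwoSided := ⟨fun r hm => mul_mem_M_right A i r hm⟩

variable {A}

theorem mem_idealM {i : ℕ} {a : A} : a ∈ idealM A i ↔ a ∈ M A i := Iff.rfl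

theorem mk_eq_zero_iff_mem_M {i : ℕ} {a : A} :
    Ideal.Quotient.mkₐ ℂ (idealM A i) a = 0 ↔ a ∈ M A i := by
  rw [Ideal.Quotient.mkₐ_eq_mk, Ideal.Quotient.eq_zero_iff_mem, mem_idealM]

theorem M_induction {i : ℕ} {p : A → Prop} (h : ∀ a, ∀ l ∈ L A i, ∀ c, p (a * l * c))
    (hadd : ∀ x y, p x → p y → p (x + y)) {x : A} (hx : x ∈ M A i) : p x := by
  refine Submodule.mul_induction_on hx (fun m hm c _ => ?_) hadd
  refine Submodule.mul_induction_on (C := fun m => p (m * c)) hm (fun a _ b hb => h a b hb c) ?_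
  intro x y hx hy
  rw [add_mul]
  exact hadd _ _ hx hy

theorem L_succ_induction {k : ℕ} {p : A → Prop} (h : ∀ a : A, ∀ l ∈ L A (k + 1), p ⁅a, l⁆)
    (h0 : p 0) (hadd : ∀ x y, p x → p y → p (x + y)) (hsmul : ∀ (c : ℂ) x, p x → p (c • x))
    {x : A} (hx : x ∈ L A (k + 2)) : p x := by
  change x ∈ Submodule.span ℂ _ at hx
  induction hx using Submodule.span_induction with
  | mem x hx =>
    obtain ⟨a, b, hb, rfl⟩ := hx
    exact h a b hb
  | zero => exact h0
  | add x y _ _ hx hy => exact hadd x y hx hy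
  | smul c x _ hx => exact hsmul c x hx

theorem lie_mem_L (k : ℕ) (a : A) {b : A} (hb : b ∈ L A (k + 1)) : ⁅a, b⁆ ∈ L A (k + 2) :=
  comm_mem_L k a hb

theorem lie_mem_L_two (a b : A) : ⁅a, b⁆ ∈ L A 2 := lie_mem_L 0 a Submodule.mem_top

theorem lie_mem_L_three (a b c : A) : ⁅a, ⁅b, c⁆⁆ ∈ L A 3 := lie_mem_L 1 a (lie_mem_L_two b c)

theorem lie_mem_L_four (a b c d : A) : ⁅a, ⁅b, ⁅c, d⁆⁆⁆ ∈ L A 4 :=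
  lie_mem_L 2 a (lie_mem_L_three b c d)

theorem L_two_induction {p : A → Prop} (h : ∀ a b : A, p ⁅a, b⁆)
    (h0 : p 0) (hadd : ∀ x y, p x → p y → p (x + y)) (hsmul : ∀ (c : ℂ) x, p x → p (c • x))
    {x : A} (hx : x ∈ L A 2) : p x :=
  L_succ_induction (fun a l _ => h a l) h0 hadd hsmul hx

theorem L_three_induction {p : A → Prop} (h : ∀ a b c : A, p ⁅a, ⁅b, c⁆⁆)
    (h0 : p 0) (hadd : ∀ x y, p x → p y → p (x + y)) (hsmul : ∀ (c : ℂ) x, p x → p (c • x))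
    {x : A} (hx : x ∈ L A 3) : p x := by
  refine L_succ_induction (fun a l hl => ?_) h0 hadd hsmul hx
  refine L_two_induction (p := fun l => p ⁅a, l⁆) (fun b c => h a b c) ?_ ?_ ?_ hl
  · rwa [ring_lie_zero]
  · intro x y hx hy; rw [ring_lie_add]; exact hadd _ _ hx hy
  · intro c x hx
    rw [ring_lie_smul]; exact hsmul c _ hx

/-- Zero and scalars need no hypothesis: zero is the case of a vanishing factor, and a scalar is
absorbed by the left factor, which the inner induction therefore keeps general. -/
theorem M_two_induction {p : A → Prop} (h : ∀ a b c d : A, p (a * ⁅b, c⁆ * d))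
    (hadd : ∀ x y, p x → p y → p (x + y)) {x : A} (hx : x ∈ M A 2) : p x := by
  have h0 : p 0 := by simpa using h 0 0 0 0
  refine M_induction (fun a l hl c => ?_) hadd hx
  refine L_two_induction (p := fun l => ∀ a, p (a * l * c)) (fun b d a => h a b d c) ?_ ?_ ?_ hl a
  · simpa using h0
  · intro x y hx hy a
    rw [mul_add, add_mul]; exact hadd _ _ (hx a) (hy a)
  · intro r x hx a
    rw [mul_smul_comm, ← smul_mul_assoc]; exact hx _

theorem M_three_induction {p : A → Prop} (h : ∀ a b c d e : A, p (a * ⁅b, ⁅c, d⁆⁆ * e))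
    (hadd : ∀ x y, p x → p y → p (x + y)) {x : A} (hx : x ∈ M A 3) : p x := by
  have h0 : p 0 := by simpa using h 0 0 0 0 0
  refine M_induction (fun a l hl c => ?_) hadd hx
  refine L_three_induction (p := fun l => ∀ a, p (a * l * c)) (fun b d e a => h a b d e c)
    ?_ ?_ ?_ hl a
  · simpa using h0
  · intro x y hx hy a
    rw [mul_add, add_mul]; exact hadd _ _ (hx a) (hy a)
  · intro r x hx a
    rw [mul_smul_comm, ← smul_mul_assoc]; exact hx _

end Ideals

/-! ### Products and commutators modulo `M 4`. -/

section QuotientFour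

variable {A : Type*} [Ring A] [Algebra ℂ A]

theorem map_lie_ring {R : Type*} [Ring R] [Algebra ℂ R] (φ : A →ₐ[ℂ] R) (a b : A) :
    φ ⁅a, b⁆ = ⁅φ a, φ b⁆ := by simp [Ring.lie_def]

theorem lie4_quotient_eq_zero (a b c d : A ⧸ idealM A 4) : ⁅a, ⁅b, ⁅c, d⁆⁆⁆ = 0 := by
  obtain ⟨a, rfl⟩ := Ideal.Quotient.mkₐ_surjective ℂ (idealM A 4) a
  obtain ⟨b, rfl⟩ := Ideal.Quotient.mkₐ_surjective ℂ (idealM A 4) b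
  obtain ⟨c, rfl⟩ := Ideal.Quotient.mkₐ_surjective ℂ (idealM A 4) c
  obtain ⟨d, rfl⟩ := Ideal.Quotient.mkₐ_surjective ℂ (idealM A 4) d
  rw [← map_lie_ring, ← map_lie_ring, ← map_lie_ring, mk_eq_zero_iff_mem_M]
  exact L_le_M 4 (lie_mem_L_four a b c d)

/-- Modulo `M 4` whatever stands between the triple commutator and the bracket can be moved to the
left at the cost of a fourfold commutator; then `lie3_mul_lie_eq_zero` applies. -/
theorem M_three_mul_M_two {a b : A} (ha : a ∈ M A 3) (hb : b ∈ M A 2) : a * b ∈ M A 4 := by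
  rw [← mk_eq_zero_iff_mem_M]
  refine M_three_induction (p := fun a => Ideal.Quotient.mkₐ ℂ (idealM A 4) (a * b) = 0)
    (fun a₁ a₂ a₃ a₄ a₅ => ?_) (fun x y hx hy => by simp only [add_mul, map_add, hx, hy, add_zero]) ha
  refine M_two_induction
    (p := fun b => Ideal.Quotient.mkₐ ℂ (idealM A 4) (a₁ * ⁅a₂, ⁅a₃, a₄⁆⁆ * a₅ * b) = 0)
    (fun b₁ b₂ b₃ b₄ => ?_) (fun x y hx hy => by simp only [mul_add, map_add, hx, hy, add_zero]) hb
  simp only [map_mul, map_lie_ring]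
  generalize Ideal.Quotient.mkₐ ℂ (idealM A 4) = π
  have H := lie4_quotient_eq_zero (A := A)
  have e : π a₁ * ⁅π a₂, ⁅π a₃, π a₄⁆⁆ * π a₅ * (π b₁ * ⁅π b₂, π b₃⁆ * π b₄) =
      π a₁ * (π a₅ * π b₁) * (⁅π a₂, ⁅π a₃, π a₄⁆⁆ * ⁅π b₂, π b₃⁆) * π b₄
      - π a₁ * ⁅π a₅ * π b₁, ⁅π a₂, ⁅π a₃, π a₄⁆⁆⁆ * ⁅π b₂, π b₃⁆ * π b₄ := by
    simp only [Ring.lie_def]; noncomm_ring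
  rw [e, lie3_mul_lie_eq_zero H, H]
  simp

/-- By Leibniz, besides brackets with elements of `L 3`, only products of an element of `L 3` with a
commutator occur, and `M_three_mul_M_two` covers these. It follows that left and right
multiplication agree on `M 3 / M 4`. -/
theorem lie_M_three (a : A) {m : A} (hm : m ∈ M A 3) : ⁅a, m⁆ ∈ M A 4 := by
  have key : ∀ a b l : A, l ∈ L A 3 → l * ⁅a, b⁆ ∈ M A 4 := fun a b l hl =>
    M_three_mul_M_two (L_le_M 3 hl) (L_le_M 2 (lie_mem_L_two a b))
  refine M_induction (p := fun m => ⁅a, m⁆ ∈ M A 4) (fun b l hl c => ?_)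
    (fun x y hx hy => by rw [ring_lie_add]; exact add_mem hx hy) hm
  have e : ⁅a, b * l * c⁆ = b * ⁅a, l⁆ * c + b * (l * ⁅a, c⁆) + l * ⁅a, b⁆ * c
      + ⁅⁅a, b⁆, l⁆ * c := by
    simp only [Ring.lie_def]; noncomm_ring
  rw [e]
  exact add_mem (add_mem (add_mem (mul_mem_M _ _ (lie_mem_L 2 a hl))
    (mul_mem_M_left A 4 _ (key a c l hl))) (mul_mem_M_right A 4 _ (key a b l hl)))
    (L_mul_mem_M _ (lie_mem_L 2 _ hl))

theorem M_two_mul_M_three {a b : A} (ha : a ∈ M A 2) (hb : b ∈ M A 3) : a * b ∈ M A 4 := by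
  have h := add_mem (M_three_mul_M_two hb ha) (lie_M_three a hb)
  rwa [Ring.lie_def, add_sub_cancel] at h

theorem M_succ_le (i : ℕ) : M A (i + 2) ≤ M A (i + 1) := by
  intro x hx
  refine M_induction (fun a l hl c => ?_) (fun x y hx hy => add_mem hx hy) hx
  refine mul_mem_M_right A _ c (mul_mem_M_left A _ a ?_)
  refine L_succ_induction (fun a l hl => ?_) (zero_mem _) (fun x y hx hy => add_mem hx hy)
    (fun c x hx => Submodule.smul_mem _ c hx) hl
  rw [Ring.lie_def]
  exact sub_mem (mul_L_mem_M _ hl) (L_mul_mem_M _ hl)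

/-- These are the cross terms of [d, [b * c, a]]; the last commutator in `e` only reorders two
factors. Under the map to forms this is the skew-symmetry of the wedge product. -/
theorem lie_mul_lie_mem_M_three (a b c d : A) :
    ⁅a, b⁆ * ⁅c, d⁆ + ⁅a, c⁆ * ⁅b, d⁆ ∈ M A 3 := by
  have e : ⁅a, b⁆ * ⁅c, d⁆ + ⁅a, c⁆ * ⁅b, d⁆ = ⁅d, ⁅b * c, a⁆⁆ - b * ⁅d, ⁅c, a⁆⁆
      - ⁅d, ⁅b, a⁆⁆ * c + ⁅⁅a, c⁆, ⁅b, d⁆⁆ := by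
    simp only [Ring.lie_def]; noncomm_ring
  rw [e]
  exact add_mem (sub_mem (sub_mem (L_le_M 3 (lie_mem_L_three _ _ _))
    (mul_L_mem_M _ (lie_mem_L_three _ _ _))) (L_mul_mem_M _ (lie_mem_L_three _ _ _)))
    (L_le_M 3 (lie_mem_L_three _ _ _))

end QuotientFour

/-! ### Calculus of polynomial differential forms -/

section Exterior

variable {V : Type*} [AddCommGroup V] [Module ℂ V]

theorem exterior_ι_mul_comm (v : V) (ω : ExteriorAlgebra ℂ V) :
    ExteriorAlgebra.ι ℂ v * ω = CliffordAlgebra.involute ω * ExteriorAlgebra.ι ℂ v := by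
  induction ω using ExteriorAlgebra.induction with
  | algebraMap r => rw [AlgHom.commutes, Algebra.commutes]
  | ι w =>
    have h := ExteriorAlgebra.ι_add_mul_swap (R := ℂ) v w
    rw [CliffordAlgebra.involute_ι, neg_mul]
    exact eq_neg_of_add_eq_zero_left h
  | mul a b ha hb => rw [map_mul, ← mul_assoc, ha, mul_assoc, hb, mul_assoc]
  | add a b ha hb => rw [map_add, mul_add, add_mul, ha, hb]

theorem exterior_contractLeft_mul (d : Module.Dual ℂ V) (ω η : ExteriorAlgebra ℂ V) :
    CliffordAlgebra.contractLeft d (ω * η) = CliffordAlgebra.contractLeft d ω * η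
      + CliffordAlgebra.involute ω * CliffordAlgebra.contractLeft d η := by
  induction ω using CliffordAlgebra.left_induction generalizing η with
  | algebraMap r =>
    rw [CliffordAlgebra.contractLeft_algebraMap_mul, CliffordAlgebra.contractLeft_algebraMap,
      AlgHom.commutes, zero_mul, zero_add]
  | add a b ha hb => simp only [add_mul, map_add, ha, hb]; abel
  | ι_mul a v ha =>
    rw [mul_assoc, CliffordAlgebra.contractLeft_ι_mul, ha, CliffordAlgebra.contractLeft_ι_mul,
      map_mul, CliffordAlgebra.involute_ι]
    simp only [mul_add, sub_mul, neg_mul, smul_mul_assoc, mul_assoc]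
    abel

theorem contractLeft_involute (d : Module.Dual ℂ V) (ω : ExteriorAlgebra ℂ V) :
    CliffordAlgebra.contractLeft d (CliffordAlgebra.involute ω) =
      -CliffordAlgebra.involute (CliffordAlgebra.contractLeft d ω) := by
  induction ω using CliffordAlgebra.left_induction with
  | algebraMap r => simp [CliffordAlgebra.contractLeft_algebraMap]
  | add a b ha hb => simp only [map_add, ha, hb]; abel
  | ι_mul a v ha =>
    rw [map_mul, CliffordAlgebra.involute_ι, neg_mul, map_neg, CliffordAlgebra.contractLeft_ι_mul,
      ha, CliffordAlgebra.contractLeft_ι_mul, map_sub, map_mul, CliffordAlgebra.involute_ι,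
      map_smul, neg_mul, mul_neg]

end Exterior

/-! ### Leibniz rules for the exterior derivative, the contraction and the Lie derivative. -/

section Forms

variable {n : ℕ}

/-- The basis covector `dx_i`. -/
def covec (i : Fin n) : ExteriorAlgebra ℂ (Fin n → ℂ) := ExteriorAlgebra.ι ℂ (Pi.single i 1)

theorem dx_eq (i : Fin n) : dx i = (1 : Poly n) ⊗ₜ[ℂ] covec i := rfl

theorem covec_mul_covec (i j : Fin n) : covec i * covec j = -(covec j * covec i) :=
  eq_neg_of_add_eq_zero_left (ExteriorAlgebra.ι_add_mul_swap _ _)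

theorem extd_tmul (f : Poly n) (ω : ExteriorAlgebra ℂ (Fin n → ℂ)) :
    extd n (f ⊗ₜ ω) = ∑ i, MvPolynomial.pderiv i f ⊗ₜ[ℂ] (covec i * ω) := by
  simp [extd, dx_eq]

theorem contract_tmul (X : W n) (f : Poly n) (ω : ExteriorAlgebra ℂ (Fin n → ℂ)) :
    contract X (f ⊗ₜ ω) = ∑ i, (X (MvPolynomial.X i) * f) ⊗ₜ[ℂ]
      CliffordAlgebra.contractLeft (LinearMap.proj i) ω := by
  simp [contract, fn]

variable (n) in
/-- The grading involution of forms. -/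
def invol : Forms n →ₐ[ℂ] Forms n :=
  Algebra.TensorProduct.map (AlgHom.id ℂ _) CliffordAlgebra.involute

theorem invol_tmul (f : Poly n) (ω : ExteriorAlgebra ℂ (Fin n → ℂ)) :
    invol n (f ⊗ₜ ω) = f ⊗ₜ CliffordAlgebra.involute ω := rfl

theorem invol_invol (a : Forms n) : invol n (invol n a) = a := by
  induction a using TensorProduct.induction_on with
  | zero => simp
  | tmul f ω => rw [invol_tmul, invol_tmul, CliffordAlgebra.involute_involute]
  | add a b ha hb => rw [map_add, map_add, ha, hb]

theorem extd_mul (a b : Forms n) : extd n (a * b) = extd n a * b + invol n a * extd n b := by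
  induction a using TensorProduct.induction_on with
  | zero => simp
  | add a₁ a₂ h₁ h₂ => simp only [add_mul, map_add, h₁, h₂]; abel
  | tmul f ω =>
    induction b using TensorProduct.induction_on with
    | zero => rw [mul_zero, map_zero, mul_zero, mul_zero, add_zero]
    | add b₁ b₂ h₁ h₂ => simp only [mul_add, map_add, h₁, h₂]; abel
    | tmul g η =>
      simp only [Algebra.TensorProduct.tmul_mul_tmul, extd_tmul, invol_tmul, Finset.sum_mul,
        Finset.mul_sum, ← Finset.sum_add_distrib]
      refine Finset.sum_congr rfl fun i _ => ?_
      rw [Derivation.leibniz, smul_eq_mul, smul_eq_mul, TensorProduct.add_tmul, add_comm,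
        ← mul_assoc, ← mul_assoc, covec, exterior_ι_mul_comm, mul_comm g]

theorem pderiv_comm (i j : Fin n) (f : Poly n) :
    MvPolynomial.pderiv i (MvPolynomial.pderiv j f) =
      MvPolynomial.pderiv j (MvPolynomial.pderiv i f) := by
  have h : ⁅(MvPolynomial.pderiv i : W n), (MvPolynomial.pderiv j : W n)⁆ = 0 := by
    refine MvPolynomial.derivation_ext fun k => ?_
    classical
    rw [Derivation.commutator_apply, MvPolynomial.pderiv_X, MvPolynomial.pderiv_X]
    simp only [Pi.single_apply]
    split_ifs <;> simp
  have h1 := DFunLike.congr_fun h f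
  rwa [Derivation.commutator_apply, Derivation.zero_apply, sub_eq_zero] at h1

theorem forms_neg_mul (a b : Forms n) : -a * b = -(a * b) := neg_mul a b

theorem extd_extd (a : Forms n) : extd n (extd n a) = 0 := by
  induction a using TensorProduct.induction_on with
  | zero => simp
  | add a₁ a₂ h₁ h₂ => simp only [map_add, h₁, h₂, add_zero]
  | tmul f ω =>
    simp only [extd_tmul, map_sum]
    set S := ∑ i, ∑ j, MvPolynomial.pderiv j (MvPolynomial.pderiv i f) ⊗ₜ[ℂ] (covec j * (covec i * ω))
      with hS
    have h : S + S = 0 := by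
      nth_rewrite 2 [hS]
      rw [Finset.sum_comm, hS, ← Finset.sum_add_distrib]
      refine Finset.sum_eq_zero fun i _ => ?_
      rw [← Finset.sum_add_distrib]
      refine Finset.sum_eq_zero fun j _ => ?_
      rw [← mul_assoc, ← mul_assoc, covec_mul_covec i j, pderiv_comm i j,
        ← TensorProduct.tmul_add, neg_mul, add_neg_cancel, TensorProduct.tmul_zero]
    have h2 : (2 : ℂ) • S = 0 := by rw [two_smul, h]
    exact (smul_eq_zero.mp h2).resolve_left two_ne_zero

theorem extd_invol (a : Forms n) : extd n (invol n a) = -invol n (extd n a) := by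
  induction a using TensorProduct.induction_on with
  | zero => simp
  | add a₁ a₂ h₁ h₂ => simp only [map_add, h₁, h₂]; abel
  | tmul f ω =>
    rw [invol_tmul, extd_tmul, extd_tmul, map_sum, ← Finset.sum_neg_distrib]
    refine Finset.sum_congr rfl fun i _ => ?_
    rw [invol_tmul, map_mul, covec, CliffordAlgebra.involute_ι, neg_mul, TensorProduct.tmul_neg,
      neg_neg]

theorem contract_mul (X : W n) (a b : Forms n) :
    contract X (a * b) = contract X a * b + invol n a * contract X b := by
  induction a using TensorProduct.induction_on with
  | zero => simp
  | add a₁ a₂ h₁ h₂ => simp only [add_mul, map_add, h₁, h₂]; abel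
  | tmul f ω =>
    induction b using TensorProduct.induction_on with
    | zero => rw [mul_zero, map_zero, mul_zero, mul_zero, add_zero]
    | add b₁ b₂ h₁ h₂ => simp only [mul_add, map_add, h₁, h₂]; abel
    | tmul g η =>
      simp only [Algebra.TensorProduct.tmul_mul_tmul, contract_tmul, invol_tmul, Finset.sum_mul,
        Finset.mul_sum, ← Finset.sum_add_distrib]
      refine Finset.sum_congr rfl fun i _ => ?_
      rw [exterior_contractLeft_mul, TensorProduct.tmul_add, mul_assoc, mul_left_comm f]

theorem contract_invol (X : W n) (a : Forms n) :
    contract X (invol n a) = -invol n (contract X a) := by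
  induction a using TensorProduct.induction_on with
  | zero => simp
  | add a₁ a₂ h₁ h₂ => simp only [map_add, h₁, h₂]; abel
  | tmul f ω =>
    rw [invol_tmul, contract_tmul, contract_tmul, map_sum, ← Finset.sum_neg_distrib]
    refine Finset.sum_congr rfl fun i _ => ?_
    rw [invol_tmul, contractLeft_involute, TensorProduct.tmul_neg]

theorem lieForms_apply (X : W n) (a : Forms n) :
    lieForms X a = extd n (contract X a) + contract X (extd n a) := rfl

/-- The anticommutator of two odd derivations is an ordinary derivation: the mixed terms cancel
because both operators anticommute with the grading involution. -/
theorem lieForms_mul (X : W n) (a b : Forms n) :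
    lieForms X (a * b) = lieForms X a * b + a * lieForms X b := by
  simp only [lieForms_apply, contract_mul, extd_mul, map_add, extd_invol, contract_invol,
    invol_invol, add_mul, mul_add, forms_neg_mul]
  abel

theorem lieForms_extd (X : W n) (a : Forms n) :
    lieForms X (extd n a) = extd n (lieForms X a) := by
  simp [lieForms_apply, extd_extd]

theorem extd_fn (f : Poly n) : extd n (fn f) = ∑ i, MvPolynomial.pderiv i f ⊗ₜ[ℂ] covec i := by
  simp [fn, extd_tmul]

theorem vectorField_eq_sum_pderiv (X : W n) (f : Poly n) :
    X f = ∑ i, X (MvPolynomial.X i) * MvPolynomial.pderiv i f := by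
  have h : X = ∑ i, X (MvPolynomial.X i) • (MvPolynomial.pderiv i : W n) := by
    refine MvPolynomial.derivation_ext fun j => ?_
    rw [vectorField_sum_apply, Finset.sum_eq_single j]
    · simp
    · intro k _ hk
      simp [MvPolynomial.pderiv_X_of_ne hk.symm]
    · simp
  conv_lhs => rw [h]
  rw [vectorField_sum_apply]
  simp

theorem lieForms_fn (X : W n) (f : Poly n) : lieForms X (fn f) = fn (X f) := by
  have h0 : contract X (fn f) = 0 := by
    simp [fn, contract_tmul, CliffordAlgebra.contractLeft_one]
  rw [lieForms_apply, h0, map_zero, zero_add, extd_fn, map_sum, vectorField_eq_sum_pderiv X f]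
  simp only [contract_tmul, covec, ExteriorAlgebra.ι, CliffordAlgebra.contractLeft_ι, fn,
    TensorProduct.sum_tmul]
  refine Finset.sum_congr rfl fun i _ => ?_
  rw [Finset.sum_eq_single i]
  · simp
  · intro j _ hj
    simp [hj]
  · simp

theorem fn_mul (f g : Poly n) : fn (f * g) = fn f * fn g := by simp [fn]

theorem fn_add (f g : Poly n) : fn (f + g) = fn f + fn g := by simp [fn, TensorProduct.add_tmul]

theorem extd_fn_mul_extd_fn (f g : Poly n) :
    extd n (fn f) * extd n (fn g) = -(extd n (fn g) * extd n (fn f)) := by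
  simp only [extd_fn, Finset.sum_mul, Finset.mul_sum, Algebra.TensorProduct.tmul_mul_tmul,
    ← Finset.sum_neg_distrib]
  rw [Finset.sum_comm]
  refine Finset.sum_congr rfl fun i _ => Finset.sum_congr rfl fun j _ => ?_
  rw [covec_mul_covec, TensorProduct.tmul_neg, mul_comm]

end Forms

/-! ### The quantized product on even forms -/

section Star

variable {n : ℕ}

theorem starLeft_apply (a b : Forms n) : starLeft a b = a * b + extd n a * extd n b := rfl

theorem lieForms_starLeft (X : W n) (a b : Forms n) :
    lieForms X (starLeft a b) = starLeft (lieForms X a) b + starLeft a (lieForms X b) := by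
  simp only [starLeft_apply, map_add, lieForms_mul, lieForms_extd]
  abel

theorem invol_starLeft {a b : Forms n} (ha : invol n a = a) (hb : invol n b = b) :
    invol n (starLeft a b) = starLeft a b := by
  have h : ∀ c : Forms n, invol n c = c → invol n (extd n c) = -extd n c := by
    intro c hc
    rw [eq_neg_iff_add_eq_zero, ← neg_eq_iff_add_eq_zero, ← extd_invol, hc]
  rw [starLeft_apply, map_add, map_mul, map_mul, ha, hb, h a ha, h b hb]
  congr 1
  exact neg_mul_neg (extd n a) (extd n b)

/-- Only `a` and `b` have to be even, since signs arise only when d passes one of them. -/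
theorem starLeft_assoc {a b : Forms n} (ha : invol n a = a) (hb : invol n b = b) (c : Forms n) :
    starLeft (starLeft a b) c = starLeft a (starLeft b c) := by
  simp only [starLeft_apply, map_add, extd_mul, extd_extd, ha, hb, zero_mul, mul_zero, add_zero,
    add_mul, mul_add, mul_assoc]
  abel

variable (n) in
/-- The action of the free algebra on forms through the quantized product. -/
def starAction : FreeAlg n →ₐ[ℂ] Module.End ℂ (Forms n) :=
  FreeAlgebra.lift ℂ (fun i : Fin n => starLeft (fn (MvPolynomial.X i)))

theorem toForms_apply (a : FreeAlg n) : toForms n a = starAction n a 1 := rfl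

theorem invol_fn (f : Poly n) : invol n (fn f) = fn f := by simp [fn, invol_tmul]

theorem extd_one : extd n (1 : Forms n) = 0 := by
  rw [Algebra.TensorProduct.one_def, extd_tmul]; simp

theorem starLeft_one (a : Forms n) : starLeft a 1 = a := by
  simp [starLeft_apply, extd_one]

/-- Evenness and the comparison with `starLeft` go through one induction because associativity of
the quantized product uses evenness. The gain is that `toForms`, defined by acting on 1, is
multiplicative. -/
theorem starAction_eq (a : FreeAlg n) : invol n (toForms n a) = toForms n a ∧
    ∀ b, invol n b = b → starAction n a b = starLeft (toForms n a) b := by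
  induction a using FreeAlgebra.induction with
  | grade0 r =>
    simp only [toForms_apply, AlgHom.commutes, Module.algebraMap_end_apply]
    refine ⟨by simp, fun b _ => ?_⟩
    simp [starLeft_apply, extd_one]
  | grade1 i =>
    have h : starAction n (FreeAlgebra.ι ℂ i) = starLeft (fn (MvPolynomial.X i)) := by
      simp [starAction]
    rw [toForms_apply, h, starLeft_one]
    exact ⟨invol_fn _, fun _ _ => rfl⟩
  | mul a b ha hb =>
    have h : toForms n (a * b) = starLeft (toForms n a) (toForms n b) := by
      rw [toForms_apply, map_mul, Module.End.mul_apply, ← toForms_apply, ha.2 _ hb.1]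
    rw [h]
    refine ⟨invol_starLeft ha.1 hb.1, fun c hc => ?_⟩
    rw [starLeft_assoc ha.1 hb.1, map_mul, Module.End.mul_apply, hb.2 c hc,
      ha.2 _ (invol_starLeft hb.1 hc)]
  | add a b ha hb =>
    refine ⟨by rw [map_add, map_add, ha.1, hb.1], fun c hc => ?_⟩
    rw [map_add, LinearMap.add_apply, ha.2 c hc, hb.2 c hc, map_add]
    simp only [starLeft_apply, map_add, add_mul]
    abel

theorem toForms_mul (a b : FreeAlg n) :
    toForms n (a * b) = starLeft (toForms n a) (toForms n b) := by
  rw [toForms_apply, map_mul, Module.End.mul_apply, ← toForms_apply,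
    (starAction_eq a).2 _ (starAction_eq b).1]

theorem toForms_ι (i : Fin n) : toForms n (FreeAlgebra.ι ℂ i) = fn (MvPolynomial.X i) := by
  have h : starAction n (FreeAlgebra.ι ℂ i) = starLeft (fn (MvPolynomial.X i)) := by
    simp [starAction]
  rw [toForms_apply, h, starLeft_one]

theorem toForms_algebraMap (r : ℂ) :
    toForms n (algebraMap ℂ _ r) = algebraMap ℂ (Forms n) r := by
  rw [toForms_apply, AlgHom.commutes, Module.algebraMap_end_apply, Algebra.algebraMap_eq_smul_one]

theorem toForms_lie {a b : FreeAlg n} {f g : Poly n} (ha : toForms n a = fn f)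
    (hb : toForms n b = fn g) :
    toForms n ⁅a, b⁆ = (2 : ℂ) • (extd n (fn f) * extd n (fn g)) := by
  rw [Ring.lie_def, map_sub, toForms_mul, toForms_mul, ha, hb, starLeft_apply, starLeft_apply,
    extd_fn_mul_extd_fn g f, ← fn_mul, ← fn_mul, mul_comm g f, two_smul]
  abel

theorem fn_mem_range_toForms (f : Poly n) : ∃ a, toForms n a = fn f := by
  induction f using MvPolynomial.induction_on with
  | C r => exact ⟨algebraMap ℂ _ r, by rw [toForms_algebraMap]; rfl⟩
  | add f g hf hg =>
    obtain ⟨a, ha⟩ := hf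
    obtain ⟨b, hb⟩ := hg
    exact ⟨a + b, by rw [map_add, ha, hb, fn_add]⟩
  | mul_X f i hf =>
    obtain ⟨a, ha⟩ := hf
    -- The symmetrized quantized product of two functions is their ordinary product, because df ∧ dg
    -- + dg ∧ df = 0.
    refine ⟨(1 / 2 : ℂ) • (a * FreeAlgebra.ι ℂ i + FreeAlgebra.ι ℂ i * a), ?_⟩
    rw [map_smul, map_add, toForms_mul, toForms_mul, ha, toForms_ι, starLeft_apply,
      starLeft_apply, extd_fn_mul_extd_fn f, ← fn_mul, ← fn_mul, mul_comm (MvPolynomial.X i) f]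
    module

/-- Functions as a linear subspace of forms. -/
def fnLinear : Poly n →ₗ[ℂ] Forms n := (Algebra.TensorProduct.includeLeft).toLinearMap

theorem fnLinear_apply (f : Poly n) : fnLinear f = fn f := rfl

theorem exists_section : ∃ s : Poly n →ₗ[ℂ] FreeAlg n, ∀ f, toForms n (s f) = fn f := by
  choose a ha using fn_mem_range_toForms (n := n)
  let B := MvPolynomial.basisMonomials (Fin n) ℂ
  refine ⟨B.constr ℂ fun m => a (B m), fun f => ?_⟩
  have h : toForms n ∘ₗ B.constr ℂ (fun m => a (B m)) = fnLinear :=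
    B.ext fun m => by rw [LinearMap.comp_apply, Module.Basis.constr_basis, ha, fnLinear_apply]
  exact LinearMap.congr_fun h f

variable (n) in
/-- A linear choice of elements of the free algebra that represent given functions. -/
def liftFn : Poly n →ₗ[ℂ] FreeAlg n := exists_section.choose

theorem toForms_liftFn (f : Poly n) : toForms n (liftFn n f) = fn f := exists_section.choose_spec f

/-! ### Lifting vector fields to derivations -/

/-- The derivation of the free algebra with given values on the generators. -/
theorem exists_isDerivation (u : Fin n → FreeAlg n) :
    ∃ D : FreeAlg n →ₗ[ℂ] FreeAlg n, IsDerivation D ∧ ∀ i, D (FreeAlgebra.ι ℂ i) = u i := by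
  -- Over the dual numbers a homomorphism a ↦ a + ε D a is the same thing as a derivation D, and
  -- free generators may be sent anywhere.
  let φ : FreeAlg n →ₐ[ℂ] TrivSqZeroExt (FreeAlg n) (FreeAlg n) :=
    FreeAlgebra.lift ℂ fun i => TrivSqZeroExt.inl (FreeAlgebra.ι ℂ i) + TrivSqZeroExt.inr (u i)
  have h1 : ∀ a, (φ a).fst = a := by
    intro a
    have : (TrivSqZeroExt.fstHom ℂ (FreeAlg n) (FreeAlg n)).comp φ = AlgHom.id ℂ _ := by
      ext i; simp [φ]
    exact DFunLike.congr_fun this a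
  refine ⟨TrivSqZeroExt.sndHom (FreeAlg n) (FreeAlg n) |>.restrictScalars ℂ |>.comp φ.toLinearMap,
    fun a b => ?_, fun i => ?_⟩
  · simp [h1, add_comm]
  · simp [φ]

/-- Both sides are derivations along `toForms`, by `lieForms_starLeft`, so they agree once they
agree on generators. -/
theorem lifts_of_generators {D : FreeAlg n →ₗ[ℂ] FreeAlg n} (hD : IsDerivation D) {X : W n}
    (h : ∀ i, toForms n (D (FreeAlgebra.ι ℂ i)) = fn (X (MvPolynomial.X i))) : Lifts D X := by
  have hone : D 1 = 0 := by simpa using hD 1 1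
  intro a
  induction a using FreeAlgebra.induction with
  | grade0 r =>
    rw [Algebra.algebraMap_eq_smul_one, map_smul, map_smul, hone, map_smul,
      ← map_one (algebraMap ℂ (FreeAlg n)), toForms_algebraMap, map_one, map_zero,
      smul_zero, map_smul]
    have : lieForms X (1 : Forms n) = 0 := by simpa using lieForms_mul X 1 1
    rw [this, smul_zero]
  | grade1 i => rw [h, toForms_ι, lieForms_fn]
  | mul a b ha hb =>
    rw [hD, map_add, toForms_mul, toForms_mul, ha, hb, toForms_mul, lieForms_starLeft]
  | add a b ha hb => rw [map_add, map_add, map_add, map_add, ha, hb]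

theorem exists_lift (X : W n) :
    ∃ D : FreeAlg n →ₗ[ℂ] FreeAlg n, IsDerivation D ∧ Lifts D X := by
  obtain ⟨D, hD, h⟩ := exists_isDerivation fun i => liftFn n (X (MvPolynomial.X i))
  exact ⟨D, hD, lifts_of_generators hD fun i => by rw [h, toForms_liftFn]⟩

theorem Lifts.apply_ι {D : FreeAlg n →ₗ[ℂ] FreeAlg n} {X : W n} (h : Lifts D X) (i : Fin n) :
    toForms n (D (FreeAlgebra.ι ℂ i)) = fn (X (MvPolynomial.X i)) := by
  rw [h, toForms_ι, lieForms_fn]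

end Star

/-! ### The quotient by `M 3` and even forms -/

section Jordan

variable (A : Type*) [Ring A] [Algebra ℂ A]

theorem lie3_quotient_eq_zero (a b c : A ⧸ idealM A 3) : ⁅a, ⁅b, c⁆⁆ = 0 := by
  obtain ⟨a, rfl⟩ := Ideal.Quotient.mkₐ_surjective ℂ (idealM A 3) a
  obtain ⟨b, rfl⟩ := Ideal.Quotient.mkₐ_surjective ℂ (idealM A 3) b
  obtain ⟨c, rfl⟩ := Ideal.Quotient.mkₐ_surjective ℂ (idealM A 3) c
  rw [← map_lie_ring, ← map_lie_ring, mk_eq_zero_iff_mem_M]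
  exact L_le_M 3 (lie_mem_L_three a b c)

theorem lie_commute_quotient (a b c : A ⧸ idealM A 3) : a * ⁅b, c⁆ = ⁅b, c⁆ * a := by
  have := lie3_quotient_eq_zero A a b c
  rwa [Ring.lie_def, sub_eq_zero] at this

/-- The quotient `A / M 3` with the product `(a b + b a) / 2`, which is associative and
commutative. -/
def Jordan : Type _ := A ⧸ idealM A 3

instance : AddCommGroup (Jordan A) := inferInstanceAs (AddCommGroup (A ⧸ idealM A 3))
instance : Module ℂ (Jordan A) := inferInstanceAs (Module ℂ (A ⧸ idealM A 3))

variable {A} in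
/-- The identity map from `Jordan A` to `A / M 3`. -/
def Jordan.val : Jordan A →ₗ[ℂ] A ⧸ idealM A 3 := LinearMap.id

variable {A} in
/-- The identity map from `A / M 3` to `Jordan A`. -/
def Jordan.of (a : A ⧸ idealM A 3) : Jordan A := a

variable {A} in
theorem Jordan.ext {a b : Jordan A} (h : Jordan.val a = Jordan.val b) : a = b := h

theorem Jordan.val_of (a : A ⧸ idealM A 3) : Jordan.val (Jordan.of a) = a := rfl

instance : Mul (Jordan A) :=
  ⟨fun a b => Jordan.of ((1 / 2 : ℂ) • (Jordan.val a * Jordan.val b + Jordan.val b * Jordan.val a))⟩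

variable {A} in
theorem Jordan.val_mul (a b : Jordan A) :
    Jordan.val (a * b) = (1 / 2 : ℂ) • (Jordan.val a * Jordan.val b + Jordan.val b * Jordan.val a) := rfl

instance : One (Jordan A) := ⟨Jordan.of 1⟩

theorem Jordan.val_one : Jordan.val (1 : Jordan A) = 1 := rfl

theorem Jordan.mul_comm' (a b : Jordan A) : a * b = b * a :=
  Jordan.ext (by rw [Jordan.val_mul, Jordan.val_mul, add_comm])

theorem Jordan.one_mul' (a : Jordan A) : 1 * a = a :=
  Jordan.ext (by rw [Jordan.val_mul, Jordan.val_one, one_mul, mul_one]; module)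

theorem Jordan.add_mul' (a b c : Jordan A) : (a + b) * c = a * c + b * c :=
  Jordan.ext (by simp only [Jordan.val_mul, map_add, add_mul, mul_add]; module)

theorem Jordan.smul_mul' (r : ℂ) (a b : Jordan A) : (r • a) * b = r • (a * b) :=
  Jordan.ext (by
    simp only [Jordan.val_mul, map_smul, smul_mul_assoc, mul_smul_comm]; module)

/-- The associator of the symmetrized product is a multiple of [b, [a, c]], which is zero in A / M
3. The resulting commutative algebra is what polynomials can be evaluated in. -/
theorem Jordan.mul_assoc' (a b c : Jordan A) : a * b * c = a * (b * c) :=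
  Jordan.ext (by
    simp only [Jordan.val_mul]
    generalize Jordan.val a = a, Jordan.val b = b, Jordan.val c = c
    have h := lie3_quotient_eq_zero A b a c
    have h' : (a * b + b * a) * c + c * (a * b + b * a) =
        a * (b * c + c * b) + (b * c + c * b) * a := by
      rw [← sub_eq_zero, ← h]
      simp only [Ring.lie_def]; noncomm_ring
    simp only [smul_mul_assoc, mul_smul_comm, ← smul_add]
    rw [h'])

instance : CommRing (Jordan A) where
  __ := (inferInstance : AddCommGroup (Jordan A))
  mul_comm := Jordan.mul_comm' A
  one_mul := Jordan.one_mul' A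
  mul_one a := by rw [Jordan.mul_comm', Jordan.one_mul']
  mul_assoc := Jordan.mul_assoc' A
  left_distrib a b c := by
    rw [Jordan.mul_comm', Jordan.add_mul', Jordan.mul_comm' A b, Jordan.mul_comm' A c]
  right_distrib := Jordan.add_mul' A
  zero_mul a := by simpa using Jordan.add_mul' A 0 0 a
  mul_zero a := by rw [Jordan.mul_comm']; simpa using Jordan.add_mul' A 0 0 a

instance : Algebra ℂ (Jordan A) :=
  Algebra.ofModule (Jordan.smul_mul' A) fun r a b => by
    rw [Jordan.mul_comm', Jordan.smul_mul', Jordan.mul_comm']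

end Jordan

/-! ### The kernel of the map to forms lies in `M 3`. -/

section Kernel

variable {n : ℕ}

variable (n) in
/-- The quotient map to `A_n / M 3`. -/
abbrev mk3 : FreeAlg n →ₐ[ℂ] FreeAlg n ⧸ idealM (FreeAlg n) 3 :=
  Ideal.Quotient.mkₐ ℂ (idealM (FreeAlg n) 3)

variable (n) in
/-- Symmetrization of polynomials, with values in `A_n / M 3`. -/
def symm3 : Poly n →ₗ[ℂ] FreeAlg n ⧸ idealM (FreeAlg n) 3 :=
  Jordan.val ∘ₗ
    (MvPolynomial.aeval fun i => Jordan.of (mk3 n (FreeAlgebra.ι ℂ i))).toLinearMap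

theorem symm3_mul_X (f : Poly n) (i : Fin n) : symm3 n (f * MvPolynomial.X i) =
    (1 / 2 : ℂ) • (symm3 n f * mk3 n (FreeAlgebra.ι ℂ i) +
      mk3 n (FreeAlgebra.ι ℂ i) * symm3 n f) := by
  simp only [symm3, LinearMap.comp_apply, AlgHom.toLinearMap_apply, map_mul, MvPolynomial.aeval_X,
    Jordan.val_mul, Jordan.val_of]

theorem symm3_one : symm3 n 1 = 1 := by
  simp only [symm3, LinearMap.comp_apply, AlgHom.toLinearMap_apply, map_one, Jordan.val_one]

/-- A chain rule: ad a is a derivation of the symmetrized product, and commutators are central in A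
/ M 3, so the order of the factors does not matter. -/
theorem lie_symm3 (a : FreeAlg n ⧸ idealM (FreeAlg n) 3) (f : Poly n) :
    ⁅a, symm3 n f⁆ = ∑ j, ⁅a, mk3 n (FreeAlgebra.ι ℂ j)⁆ * symm3 n (MvPolynomial.pderiv j f) := by
  induction f using MvPolynomial.induction_on with
  | C r =>
    have : symm3 n (MvPolynomial.C r) = r • 1 := by
      rw [← symm3_one, ← map_smul, MvPolynomial.smul_eq_C_mul, mul_one]
    simp [this, Ring.lie_def]
  | add f g hf hg =>
    simp only [map_add, ring_lie_add, hf, hg, mul_add, Finset.sum_add_distrib]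
  | mul_X f i hf =>
    have cen := lie_commute_quotient (FreeAlg n)
    have e : ∀ x b : FreeAlg n ⧸ idealM (FreeAlg n) 3,
        ⁅a, (1 / 2 : ℂ) • (b * x + x * b)⁆ =
          (1 / 2 : ℂ) • (⁅a, b⁆ * x + x * ⁅a, b⁆) + (1 / 2 : ℂ) • (b * ⁅a, x⁆ + ⁅a, x⁆ * b) := by
      intro x b
      rw [ring_lie_smul, ← smul_add]
      congr 1
      simp only [Ring.lie_def]; noncomm_ring
    rw [symm3_mul_X, e, hf, Finset.sum_mul, Finset.mul_sum, ← Finset.sum_add_distrib,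
      Finset.smul_sum]
    simp only [Derivation.leibniz, smul_eq_mul, map_add, mul_add, Finset.sum_add_distrib]
    rw [add_comm]
    congr 1
    · rw [Finset.sum_eq_single i]
      · rw [cen, ← two_smul ℂ, smul_smul]
        simp
      · intro j _ hj; simp [MvPolynomial.pderiv_X_of_ne hj.symm]
      · simp
    · refine Finset.sum_congr rfl fun j _ => ?_
      rw [mul_comm (MvPolynomial.X i), symm3_mul_X, ← mul_assoc (mk3 n _), cen,
        mul_smul_comm, mul_add, mul_assoc, mul_assoc]

/-- The linear span of the generators in `A_n / M 3`. -/
def gen3 : (Fin n → ℂ) →ₗ[ℂ] FreeAlg n ⧸ idealM (FreeAlg n) 3 :=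
  Fintype.linearCombination ℂ fun i => mk3 n (FreeAlgebra.ι ℂ i)

theorem gen3_single (i : Fin n) : gen3 (Pi.single i 1) = mk3 n (FreeAlgebra.ι ℂ i) := by
  simp [gen3, Fintype.linearCombination_apply_single]

/-- A repeated entry in `lie_mul_lie_mem_M_three` gives twice this product. It is the contraction
relation required by the universal property of the even Clifford algebra of the zero form. -/
theorem lie_mul_lie_quotient (a b c : FreeAlg n ⧸ idealM (FreeAlg n) 3) :
    ⁅a, b⁆ * ⁅b, c⁆ = 0 := by
  obtain ⟨a, rfl⟩ := Ideal.Quotient.mkₐ_surjective ℂ (idealM (FreeAlg n) 3) a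
  obtain ⟨b, rfl⟩ := Ideal.Quotient.mkₐ_surjective ℂ (idealM (FreeAlg n) 3) b
  obtain ⟨c, rfl⟩ := Ideal.Quotient.mkₐ_surjective ℂ (idealM (FreeAlg n) 3) c
  have h := mk_eq_zero_iff_mem_M.2 (lie_mul_lie_mem_M_three a b b c)
  rw [← two_smul ℂ, map_smul, map_mul, map_lie_ring, map_lie_ring] at h
  exact (smul_eq_zero.mp h).resolve_left two_ne_zero

variable (n) in
/-- The homomorphism from even constant forms sending `u ∧ v` to `[u, v] / 2`. -/
def evenHom3 : CliffordAlgebra.EvenHom (0 : QuadraticForm ℂ (Fin n → ℂ))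
    (FreeAlg n ⧸ idealM (FreeAlg n) 3) where
  bilin := (1 / 2 : ℂ) • ((LinearMap.mul ℂ _).compl₁₂ gen3 gen3 -
    ((LinearMap.mul ℂ _).compl₁₂ gen3 gen3).flip)
  contract v := by simp
  contract_mid u v w := by
    have h := lie_mul_lie_quotient (gen3 u) (gen3 v) (gen3 w)
    simp only [Ring.lie_def] at h
    simp [h]

theorem evenHom3_bilin (u v : Fin n → ℂ) :
    (evenHom3 n).bilin u v = (1 / 2 : ℂ) • ⁅gen3 u, gen3 v⁆ := rfl

/-- The universal property defines the map on even constant forms only. The linear extension to odd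
ones is arbitrary and merely avoids working on a subalgebra. -/
theorem exists_evenMap : ∃ ζ : ExteriorAlgebra ℂ (Fin n → ℂ) →ₗ[ℂ] FreeAlg n ⧸ idealM (FreeAlg n) 3,
    ζ 1 = 1 ∧ ∀ i j, ∀ ω ∈ CliffordAlgebra.even (0 : QuadraticForm ℂ (Fin n → ℂ)),
      ζ (covec i * (covec j * ω)) =
        (1 / 2 : ℂ) • (⁅mk3 n (FreeAlgebra.ι ℂ i), mk3 n (FreeAlgebra.ι ℂ j)⁆ * ζ ω) := by
  let φ := CliffordAlgebra.even.lift _ (evenHom3 n)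
  obtain ⟨ζ, hζ⟩ := LinearMap.exists_extend
    (p := Subalgebra.toSubmodule (CliffordAlgebra.even (0 : QuadraticForm ℂ (Fin n → ℂ))))
    φ.toLinearMap
  have h : ∀ ω : CliffordAlgebra.even (0 : QuadraticForm ℂ (Fin n → ℂ)), ζ ω = φ ω := fun ω =>
    LinearMap.congr_fun hζ ω
  refine ⟨ζ, ?_, fun i j ω hω => ?_⟩
  · have := h 1
    rwa [map_one] at this
  · have h1 := h ((CliffordAlgebra.even.ι _).bilin (Pi.single i 1) (Pi.single j 1) * ⟨ω, hω⟩)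
    rw [map_mul, CliffordAlgebra.even.lift_ι, evenHom3_bilin, ← h, gen3_single, gen3_single,
      smul_mul_assoc] at h1
    rw [← h1, ← mul_assoc]
    rfl

/-- There is a left inverse. The map θ(f ⊗ ω) = symm3(f) ζ(ω) turns the quantized action of `a` on
even forms into left multiplication by `a` in A / M 3. Evaluated at 1, it recovers the class of `a`
from `toForms n a`. -/
theorem mem_M_three_of_toForms_eq_zero {a : FreeAlg n} (ha : toForms n a = 0) :
    a ∈ M (FreeAlg n) 3 := by
  obtain ⟨ζ, h1, hζ⟩ := exists_evenMap (n := n)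
  let θ : Forms n →ₗ[ℂ] FreeAlg n ⧸ idealM (FreeAlg n) 3 :=
    TensorProduct.lift ((LinearMap.mul ℂ _).compl₁₂ (symm3 n) ζ)
  have hθ : ∀ f ω, θ (f ⊗ₜ ω) = symm3 n f * ζ ω := fun f ω => rfl
  let S : Submodule ℂ (Forms n) := Submodule.span ℂ {w | ∃ (f : Poly n), ∃ ω ∈
    CliffordAlgebra.even (0 : QuadraticForm ℂ (Fin n → ℂ)), w = f ⊗ₜ[ℂ] ω}
  have key : ∀ a, (∀ w ∈ S, starAction n a w ∈ S) ∧
      ∀ w ∈ S, θ (starAction n a w) = mk3 n a * θ w := by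
    intro a
    induction a using FreeAlgebra.induction with
    | grade0 r =>
      simp only [AlgHom.commutes, Module.algebraMap_end_apply, map_smul]
      exact ⟨fun w hw => S.smul_mem r hw, fun w _ => by rw [← Algebra.smul_def]⟩
    | mul a b ha hb =>
      simp only [map_mul, Module.End.mul_apply]
      exact ⟨fun w hw => ha.1 _ (hb.1 w hw), fun w hw => by
        rw [ha.2 _ (hb.1 w hw), hb.2 w hw, mul_assoc]⟩
    | add a b ha hb =>
      simp only [map_add, LinearMap.add_apply]
      exact ⟨fun w hw => add_mem (ha.1 w hw) (hb.1 w hw), fun w hw => by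
        rw [ha.2 w hw, hb.2 w hw, add_mul]⟩
    | grade1 i =>
      have hs : starAction n (FreeAlgebra.ι ℂ i) = starLeft (fn (MvPolynomial.X i)) := by
        simp [starAction]
      have hd : extd n (fn (MvPolynomial.X i)) = (1 : Poly n) ⊗ₜ[ℂ] covec i := by
        rw [extd_fn, Finset.sum_eq_single i]
        · simp
        · intro j _ hj; simp [MvPolynomial.pderiv_X_of_ne hj.symm]
        · simp
      have he : ∀ f ω, starLeft (fn (MvPolynomial.X i)) (f ⊗ₜ[ℂ] ω) =
          (f * MvPolynomial.X i) ⊗ₜ[ℂ] ω +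
            ∑ j, MvPolynomial.pderiv j f ⊗ₜ[ℂ] (covec i * (covec j * ω)) := by
        intro f ω
        rw [starLeft_apply, hd, extd_tmul, Finset.mul_sum, fn]
        simp [mul_comm]
      have hev : ∀ j, ∀ ω ∈ CliffordAlgebra.even (0 : QuadraticForm ℂ (Fin n → ℂ)),
          covec i * (covec j * ω) ∈ CliffordAlgebra.even (0 : QuadraticForm ℂ (Fin n → ℂ)) := by
        intro j ω hω
        rw [← mul_assoc]
        exact Subalgebra.mul_mem _ (CliffordAlgebra.ι_mul_ι_mem_evenOdd_zero _ _ _) hω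
      rw [hs]
      constructor
      · intro w hw
        induction hw using Submodule.span_induction with
        | zero => rw [map_zero]; exact zero_mem _
        | add x y _ _ hx hy => rw [map_add]; exact add_mem hx hy
        | smul c x _ hx => rw [map_smul]; exact S.smul_mem c hx
        | mem w hw =>
          obtain ⟨f, ω, hω, rfl⟩ := hw
          rw [he]
          exact add_mem (Submodule.subset_span ⟨_, _, hω, rfl⟩)
            (sum_mem fun j _ => Submodule.subset_span ⟨_, _, hev j ω hω, rfl⟩)
      · intro w hw
        induction hw using Submodule.span_induction with
        | zero => rw [map_zero, map_zero, mul_zero]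
        | add x y _ _ hx hy => rw [map_add, map_add, map_add, hx, hy, mul_add]
        | smul c x _ hx => rw [map_smul, map_smul, map_smul, hx, mul_smul_comm]
        | mem w hw =>
          obtain ⟨f, ω, hω, rfl⟩ := hw
          rw [he, map_add, map_sum, hθ, hθ, symm3_mul_X]
          -- The product of x_i with f ω carries the correction dx_i ∧ df ∧ ω. Its image under θ is
          -- half of [x_i, f], exactly what turns the symmetrized product of f and x_i into x_i f.
          have hsum : ∑ j, θ (MvPolynomial.pderiv j f ⊗ₜ[ℂ] (covec i * (covec j * ω))) =
              (1 / 2 : ℂ) • (⁅mk3 n (FreeAlgebra.ι ℂ i), symm3 n f⁆ * ζ ω) := by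
            rw [lie_symm3, Finset.sum_mul, Finset.smul_sum]
            refine Finset.sum_congr rfl fun j _ => ?_
            rw [hθ, hζ i j ω hω, mul_smul_comm, ← mul_assoc, lie_commute_quotient]
          rw [hsum, Ring.lie_def, smul_mul_assoc, ← smul_add, ← add_mul, ← mul_assoc,
            ← smul_mul_assoc]
          congr 1
          module
  have hone : (1 : Forms n) ∈ S :=
    Submodule.subset_span ⟨1, 1, Subalgebra.one_mem _, Algebra.TensorProduct.one_def⟩
  have h := (key a).2 1 hone
  rw [← toForms_apply, ha, map_zero, Algebra.TensorProduct.one_def, hθ, symm3_one, h1, one_mul,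
    mul_one] at h
  exact mk_eq_zero_iff_mem_M.1 h.symm

end Kernel

/-! ### The action of vector fields on `M 3 / M 4` -/

section Embedding

variable {A : Type*} [Ring A] [Algebra ℂ A]

variable (A) in
/-- The quotient map to `A / M 4`. -/
abbrev mk4 : A →ₐ[ℂ] A ⧸ idealM A 4 := Ideal.Quotient.mkₐ ℂ (idealM A 4)

variable (A) in
/-- The inclusion of `M 3 / M 4` in `A / M 4`. -/
def emb : Gr A 3 →ₗ[ℂ] A ⧸ idealM A 4 :=
  Submodule.liftQ _ ((mk4 A).toLinearMap ∘ₗ (M A 3).subtype) fun x hx => by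
    rw [LinearMap.mem_ker]
    exact mk_eq_zero_iff_mem_M.2 hx

theorem emb_toGr (x : M A 3) : emb A (toGr 3 x) = mk4 A x := rfl

theorem exists_toGr (v : Gr A 3) : ∃ x : M A 3, toGr 3 x = v := Submodule.mkQ_surjective _ v

theorem emb_injective : Function.Injective (emb A) := by
  rw [injective_iff_map_eq_zero]
  intro v hv
  obtain ⟨x, rfl⟩ := exists_toGr v
  rw [emb_toGr, mk_eq_zero_iff_mem_M] at hv
  exact (Submodule.Quotient.mk_eq_zero _).2 hv

/-- Left multiplication by an element of `A` on `M 3 / M 4`. -/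
def mulGr (a : A) : Gr A 3 →ₗ[ℂ] Gr A 3 :=
  Submodule.mapQ _ _ ((LinearMap.mulLeft ℂ a).restrict fun _ h => mul_mem_M_left A 3 a h)
    fun _ hx => mul_mem_M_left A 4 a hx

theorem emb_mulGr (a : A) (v : Gr A 3) : emb A (mulGr a v) = mk4 A a * emb A v := by
  obtain ⟨x, rfl⟩ := exists_toGr v
  exact map_mul (mk4 A) a x

theorem mk4_mul_M_three {a b : A} (hab : a - b ∈ M A 2) {m : A} (hm : m ∈ M A 3) :
    mk4 A a * mk4 A m = mk4 A b * mk4 A m := by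
  rw [← sub_eq_zero, ← sub_mul, ← map_sub, ← map_mul, mk_eq_zero_iff_mem_M]
  exact M_two_mul_M_three hab hm

theorem mk4_M_three_comm (a : A) {m : A} (hm : m ∈ M A 3) :
    mk4 A m * mk4 A a = mk4 A a * mk4 A m := by
  rw [eq_comm, ← sub_eq_zero, ← Ring.lie_def, ← map_lie_ring, mk_eq_zero_iff_mem_M]
  exact lie_M_three a hm

theorem mk4_M_three_mul_M_two {m w : A} (hm : m ∈ M A 3) (hw : w ∈ M A 2) :
    mk4 A m * mk4 A w = 0 := by
  rw [← map_mul, mk_eq_zero_iff_mem_M]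
  exact M_three_mul_M_two hm hw

theorem mk4_M_two_mul_M_three {m w : A} (hw : w ∈ M A 2) (hm : m ∈ M A 3) :
    mk4 A w * mk4 A m = 0 := by
  rw [← map_mul, mk_eq_zero_iff_mem_M]
  exact M_two_mul_M_three hw hm

theorem IsDerivation.map_lie {D : A →ₗ[ℂ] A} (hD : IsDerivation D) (a b : A) :
    D ⁅a, b⁆ = ⁅D a, b⁆ + ⁅a, D b⁆ := by
  simp only [Ring.lie_def, map_sub, hD a b, hD b a]; abel

/-- By Leibniz, each term contains an entry of `M 3` that is either multiplied by an element of `M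
2` or lies inside a bracket, and both operations lead into `M 4`. -/
theorem IsDerivation.map_M_three_of_range {D : A →ₗ[ℂ] A} (hD : IsDerivation D)
    (h : ∀ a, D a ∈ M A 3) {m : A} (hm : m ∈ M A 3) : D m ∈ M A 4 := by
  have hle : M A 3 ≤ M A 2 := M_succ_le 1
  refine M_three_induction (p := fun m => D m ∈ M A 4) (fun a b c d e => ?_)
    (fun x y hx hy => by rw [map_add]; exact add_mem hx hy) hm
  have hl : ⁅b, ⁅c, d⁆⁆ ∈ M A 3 := L_le_M 3 (lie_mem_L_three b c d)
  rw [hD, hD, hD.map_lie, hD.map_lie, ring_lie_add]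
  refine add_mem (mul_mem_M_right A 4 _ (add_mem ?_ (mul_mem_M_left A 4 _ ?_))) ?_
  · exact M_two_mul_M_three (hle (h a)) hl
  · refine add_mem ?_ (add_mem ?_ ?_)
    · rw [ring_lie_skew]; exact neg_mem (lie_M_three _ (h b))
    · rw [ring_lie_skew (D c)]
      exact lie_M_three _ (neg_mem (M_succ_le 2 (lie_M_three d (h c))))
    · exact lie_M_three _ (M_succ_le 2 (lie_M_three c (h d)))
  · exact M_three_mul_M_two (mul_mem_M_left A 3 a hl) (hle (h e))

end Embedding

/-! ### The representation of vector fields on `M 3 / M 4`. -/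

section Action

variable {n : ℕ}

theorem IsDerivation.mem_of_generators {D : FreeAlg n →ₗ[ℂ] FreeAlg n} (hD : IsDerivation D)
    (h : ∀ i, D (FreeAlgebra.ι ℂ i) ∈ M (FreeAlg n) 3) (a : FreeAlg n) : D a ∈ M (FreeAlg n) 3 := by
  have hone : D 1 = 0 := by simpa using hD 1 1
  induction a using FreeAlgebra.induction with
  | grade0 r => rw [Algebra.algebraMap_eq_smul_one, map_smul, hone, smul_zero]; exact zero_mem _
  | grade1 i => exact h i
  | mul a b ha hb => rw [hD]; exact add_mem (mul_mem_M_right _ 3 b ha) (mul_mem_M_left _ 3 a hb)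
  | add a b ha hb => rw [map_add]; exact add_mem ha hb

theorem IsDerivation.add {D D' : FreeAlg n →ₗ[ℂ] FreeAlg n} (hD : IsDerivation D)
    (hD' : IsDerivation D') : IsDerivation (D + D') := by
  intro a b
  simp only [LinearMap.add_apply, hD a b, hD' a b, add_mul, mul_add]; abel

theorem IsDerivation.smul {D : FreeAlg n →ₗ[ℂ] FreeAlg n} (hD : IsDerivation D) (c : ℂ) :
    IsDerivation (c • D) := by
  intro a b
  simp only [LinearMap.smul_apply, hD a b, smul_add, smul_mul_assoc, mul_smul_comm]

theorem IsDerivation.commutator {D D' : FreeAlg n →ₗ[ℂ] FreeAlg n} (hD : IsDerivation D)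
    (hD' : IsDerivation D') : IsDerivation (D ∘ₗ D' - D' ∘ₗ D) := by
  intro a b
  simp only [LinearMap.sub_apply, LinearMap.comp_apply, hD a b, hD' a b, map_add, hD _ _, hD' _ _,
    sub_mul, mul_sub]
  abel

/-- The difference of two lifts sends the generators into the kernel of `toForms`, hence into `M 3`,
and so induces zero. -/
theorem onGr_congr {X : W n} {D D' : FreeAlg n →ₗ[ℂ] FreeAlg n} (hD : IsDerivation D)
    (hD' : IsDerivation D') (hX : Lifts D X) (hX' : Lifts D' X) : hD.onGr 3 = hD'.onGr 3 := by
  have h0 : IsDerivation (D - D') := by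
    intro a b
    simp only [LinearMap.sub_apply, hD a b, hD' a b, sub_mul, mul_sub]; abel
  have h := fun m => h0.map_M_three_of_range (m := m) (h0.mem_of_generators fun i =>
    mem_M_three_of_toForms_eq_zero (by
      rw [LinearMap.sub_apply, map_sub, hX.apply_ι, hX'.apply_ι, sub_self]))
  ext v
  refine emb_injective ?_
  simp only [LinearMap.comp_apply]
  change mk4 _ (D v) = mk4 _ (D' v)
  rw [← sub_eq_zero, ← map_sub]
  exact mk_eq_zero_iff_mem_M.2 (h v v.2)

/-- A derivation of the free algebra lifting a given vector field. -/
def liftD (X : W n) : FreeAlg n →ₗ[ℂ] FreeAlg n := (exists_lift X).choose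

theorem isDerivation_liftD (X : W n) : IsDerivation (liftD X) := (exists_lift X).choose_spec.1

theorem lifts_liftD (X : W n) : Lifts (liftD X) X := (exists_lift X).choose_spec.2

/-- The choice `liftD` need not respect sums or brackets. Each axiom holds because both sides come
from lifts of the same vector field, where `onGr_congr` applies. -/
instance : LieRingModule (W n) (Gr (FreeAlg n) 3) where
  bracket X v := (isDerivation_liftD X).onGr 3 v
  add_lie X Y v := by
    have hD := (isDerivation_liftD X).add (isDerivation_liftD Y)
    have hL : Lifts (liftD X + liftD Y) (X + Y) := lifts_of_generators hD fun i => by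
      rw [LinearMap.add_apply, map_add, (lifts_liftD X).apply_ι, (lifts_liftD Y).apply_ι, ← fn_add]
      rfl
    change (isDerivation_liftD (X + Y)).onGr 3 v = _
    rw [onGr_congr (isDerivation_liftD (X + Y)) hD (lifts_liftD _) hL]
    obtain ⟨x, rfl⟩ := exists_toGr v
    rfl
  lie_add X v w := map_add _ v w
  leibniz_lie X Y v := by
    have hD := (isDerivation_liftD X).commutator (isDerivation_liftD Y)
    have hL : Lifts (liftD X ∘ₗ liftD Y - liftD Y ∘ₗ liftD X) ⁅X, Y⁆ :=
      lifts_of_generators hD fun i => by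
        rw [LinearMap.sub_apply, map_sub, LinearMap.comp_apply, LinearMap.comp_apply,
          lifts_liftD X, lifts_liftD Y, lifts_liftD Y, lifts_liftD X, toForms_ι, lieForms_fn,
          lieForms_fn, lieForms_fn, lieForms_fn, Derivation.commutator_apply]
        exact (map_sub fnLinear _ _).symm
    change _ = (isDerivation_liftD ⁅X, Y⁆).onGr 3 v + _
    rw [onGr_congr (isDerivation_liftD ⁅X, Y⁆) hD (lifts_liftD _) hL, ← sub_eq_iff_eq_add]
    obtain ⟨x, rfl⟩ := exists_toGr v
    rfl

theorem lie_gr_eq {X : W n} {D : FreeAlg n →ₗ[ℂ] FreeAlg n} (hD : IsDerivation D)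
    (hX : Lifts D X) (v : Gr (FreeAlg n) 3) : ⁅X, v⁆ = hD.onGr 3 v := by
  rw [← onGr_congr (isDerivation_liftD X) hD (lifts_liftD X) hX]
  rfl

instance : LieModule ℂ (W n) (Gr (FreeAlg n) 3) where
  smul_lie c X v := by
    have hD := (isDerivation_liftD X).smul c
    have hL : Lifts (c • liftD X) (c • X) := lifts_of_generators hD fun i => by
      rw [LinearMap.smul_apply, map_smul, (lifts_liftD X).apply_ι]
      exact (map_smul fnLinear c _).symm
    rw [lie_gr_eq hD hL]
    obtain ⟨x, rfl⟩ := exists_toGr v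
    rfl
  lie_smul c X v := map_smul _ c v

theorem emb_lie (X : W n) (x : M (FreeAlg n) 3) :
    emb _ ⁅X, toGr 3 x⁆ = mk4 _ (liftD X x) := rfl

end Action

/-! ### Multiplication by functions on `M 3 / M 4` -/

section Functions

variable {n : ℕ}

variable (n) in
/-- The abelianization of the free algebra. -/
def abl : FreeAlg n →ₐ[ℂ] Poly n := FreeAlgebra.lift ℂ MvPolynomial.X

theorem abl_ι (i : Fin n) : abl n (FreeAlgebra.ι ℂ i) = MvPolynomial.X i := by simp [abl]

variable (n) in
/-- The degree zero component of a form. -/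
def constPart : Forms n →ₐ[ℂ] Poly n :=
  Algebra.TensorProduct.lift (AlgHom.id ℂ _)
    ((Algebra.ofId ℂ (Poly n)).comp ExteriorAlgebra.algebraMapInv) fun _ _ => Commute.all _ _

theorem constPart_fn (f : Poly n) : constPart n (fn f) = f := by simp [constPart, fn]

theorem constPart_extd (a : Forms n) : constPart n (extd n a) = 0 := by
  induction a using TensorProduct.induction_on with
  | zero => simp
  | add a b ha hb => rw [map_add, map_add, ha, hb, add_zero]
  | tmul f ω =>
    rw [extd_tmul, map_sum]
    refine Finset.sum_eq_zero fun i _ => ?_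
    have : ExteriorAlgebra.algebraMapInv (covec i) = (0 : ℂ) := by
      simp [covec, ExteriorAlgebra.algebraMapInv]
    simp [constPart, this]

/-- The correction da ∧ db has no component of degree zero, so the degree zero part of `toForms` is
a homomorphism, determined by the generators. -/
theorem constPart_toForms (a : FreeAlg n) : constPart n (toForms n a) = abl n a := by
  induction a using FreeAlgebra.induction with
  | grade0 r => rw [toForms_algebraMap, AlgHom.commutes, AlgHom.commutes]
  | grade1 i => rw [toForms_ι, constPart_fn, abl_ι]
  | mul a b ha hb =>
    rw [toForms_mul, starLeft_apply, map_add, map_mul, map_mul, constPart_extd, zero_mul, add_zero,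
      ha, hb, map_mul]
  | add a b ha hb => rw [map_add, map_add, map_add, ha, hb]

theorem abl_liftFn (f : Poly n) : abl n (liftFn n f) = f := by
  rw [← constPart_toForms, toForms_liftFn, constPart_fn]

theorem mem_M_two_of_abl_eq_zero {a : FreeAlg n} (ha : abl n a = 0) : a ∈ M (FreeAlg n) 2 := by
  have hc : ∀ b c : FreeAlg n ⧸ idealM (FreeAlg n) 2, b * c = c * b := by
    intro b c
    obtain ⟨b, rfl⟩ := Ideal.Quotient.mkₐ_surjective ℂ (idealM (FreeAlg n) 2) b
    obtain ⟨c, rfl⟩ := Ideal.Quotient.mkₐ_surjective ℂ (idealM (FreeAlg n) 2) c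
    rw [← sub_eq_zero, ← Ring.lie_def, ← map_lie_ring, mk_eq_zero_iff_mem_M]
    exact L_le_M 2 (lie_mem_L_two b c)
  let _ : CommRing (FreeAlg n ⧸ idealM (FreeAlg n) 2) :=
    { (inferInstance : Ring (FreeAlg n ⧸ idealM (FreeAlg n) 2)) with mul_comm := hc }
  let φ : Poly n →ₐ[ℂ] FreeAlg n ⧸ idealM (FreeAlg n) 2 :=
    MvPolynomial.aeval fun i => Ideal.Quotient.mkₐ ℂ _ (FreeAlgebra.ι ℂ i)
  have h : φ.comp (abl n) = Ideal.Quotient.mkₐ ℂ (idealM (FreeAlg n) 2) := by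
    ext i
    simp [φ, abl_ι]
  have h1 := DFunLike.congr_fun h a
  rw [AlgHom.comp_apply, ha, map_zero] at h1
  exact mk_eq_zero_iff_mem_M.1 h1.symm

theorem sub_liftFn_abl_mem (a : FreeAlg n) : a - liftFn n (abl n a) ∈ M (FreeAlg n) 2 :=
  mem_M_two_of_abl_eq_zero (by rw [map_sub, abl_liftFn, sub_self])

theorem abl_of_lifts {D : FreeAlg n →ₗ[ℂ] FreeAlg n} {X : W n} (h : Lifts D X) (f : Poly n) :
    abl n (D (liftFn n f)) = X f := by
  rw [← constPart_toForms, h, toForms_liftFn, lieForms_fn, constPart_fn]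

variable (n) in
/-- The class in `A / M 4` of the chosen representative of a function. -/
def fn4 : Poly n →ₗ[ℂ] FreeAlg n ⧸ idealM (FreeAlg n) 4 := (mk4 (FreeAlg n)).toLinearMap ∘ₗ liftFn n

theorem fn4_apply (f : Poly n) : fn4 n f = mk4 _ (liftFn n f) := rfl

theorem mk4_mul_eq_fn4_mul (a : FreeAlg n) {m : FreeAlg n} (hm : m ∈ M (FreeAlg n) 3) :
    mk4 _ a * mk4 _ m = fn4 n (abl n a) * mk4 _ m :=
  mk4_mul_M_three (sub_liftFn_abl_mem a) hm

theorem fn4_mul_mul (f g : Poly n) {m : FreeAlg n} (hm : m ∈ M (FreeAlg n) 3) :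
    fn4 n (f * g) * mk4 _ m = fn4 n f * (fn4 n g * mk4 _ m) := by
  have h := mk4_mul_eq_fn4_mul (liftFn n f * liftFn n g) hm
  rw [map_mul, map_mul, abl_liftFn, abl_liftFn] at h
  rw [← h, mul_assoc]
  rfl

variable (n) in
/-- Multiplication by functions on `M 3 / M 4`. -/
def gmul : Poly n →ₗ[ℂ] Gr (FreeAlg n) 3 →ₗ[ℂ] Gr (FreeAlg n) 3 :=
  LinearMap.mk₂ ℂ (fun f v => mulGr (liftFn n f) v)
    (fun f g v => emb_injective (by simp only [map_add, emb_mulGr, add_mul]))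
    (fun c f v => emb_injective (by simp only [map_smul, emb_mulGr, smul_mul_assoc]))
    (fun f v w => map_add _ v w) (fun c f v => map_smul _ c v)

theorem emb_gmul (f : Poly n) (v : Gr (FreeAlg n) 3) :
    emb _ (gmul n f v) = fn4 n f * emb _ v := emb_mulGr _ _

theorem mulGr_eq_gmul (a : FreeAlg n) (v : Gr (FreeAlg n) 3) :
    mulGr a v = gmul n (abl n a) v := by
  obtain ⟨x, rfl⟩ := exists_toGr v
  refine emb_injective ?_
  rw [emb_mulGr, emb_gmul, emb_toGr, mk4_mul_eq_fn4_mul a x.2]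

theorem gmul_mul (f g : Poly n) (v : Gr (FreeAlg n) 3) :
    gmul n (f * g) v = gmul n f (gmul n g v) := by
  obtain ⟨x, rfl⟩ := exists_toGr v
  refine emb_injective ?_
  rw [emb_gmul, emb_gmul, emb_gmul, emb_toGr, fn4_mul_mul f g x.2]

/-- A lift of X sends a representative of f to an element that abelianizes to X f, and only the
abelianization matters for multiplication on `M 3 / M 4`. -/
theorem lie_gmul (X : W n) (f : Poly n) (v : Gr (FreeAlg n) 3) :
    ⁅X, gmul n f v⁆ = gmul n (X f) v + gmul n f ⁅X, v⁆ := by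
  obtain ⟨x, rfl⟩ := exists_toGr v
  refine emb_injective ?_
  rw [map_add, emb_gmul, emb_gmul, emb_lie, emb_toGr]
  have h := mk4_mul_eq_fn4_mul (liftD X (liftFn n f)) x.2
  rw [abl_of_lifts (lifts_liftD X)] at h
  rw [← h]
  change mk4 _ (liftD X (liftFn n f * x)) = _
  rw [isDerivation_liftD, map_add, map_mul, map_mul]
  rfl

/-! ### Generators of `M 3 / M 4` -/

/-- The class of `y i j * y k l + y i k * y j l`. -/
def quadGen (i j k l : Fin n) : Gr (FreeAlg n) 3 :=
  toGr 3 ⟨y i j * y k l + y i k * y j l, yy_mem_M i j k l⟩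

/-- The class of `[x_i, [x_j, x_k]]`. -/
def tripleGen (i j k : Fin n) : Gr (FreeAlg n) 3 :=
  toGr 3 ⟨⁅FreeAlgebra.ι ℂ i, y j k⁆, L_le_M 3 (lie_mem_L_three _ _ _)⟩

/-- The class of `y i j` in `A / M 4`. -/
def y4 (i j : Fin n) : FreeAlg n ⧸ idealM (FreeAlg n) 4 := mk4 _ (y i j)

theorem emb_quadGen (i j k l : Fin n) :
    emb _ (quadGen i j k l) = y4 i j * y4 k l + y4 i k * y4 j l := by
  simp only [quadGen, emb_toGr, map_add, map_mul, y4]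

theorem emb_tripleGen (i j k : Fin n) :
    emb _ (tripleGen i j k) = ⁅mk4 _ (FreeAlgebra.ι ℂ i), y4 j k⁆ := by
  rw [tripleGen, emb_toGr, map_lie_ring, y4]

theorem y_eq_lie (i j : Fin n) : y i j = ⁅FreeAlgebra.ι ℂ i, FreeAlgebra.ι ℂ j⁆ := rfl

theorem y_mem (i j : Fin n) : y i j ∈ M (FreeAlg n) 2 := L_le_M 2 (lie_mem_L_two _ _)

theorem y4_skew (i j : Fin n) : y4 i j = -y4 j i := by
  rw [y4, y_eq_lie, ring_lie_skew, map_neg]; rfl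

/-- By Jacobi ad [x_i, x_j] is the commutator of ad x_i and ad x_j, so [y_ij, y_kl] is a difference
of fourfold commutators. -/
theorem y4_comm (i j k l : Fin n) : y4 i j * y4 k l = y4 k l * y4 i j := by
  have e : ⁅y i j, y k l⁆ = ⁅FreeAlgebra.ι ℂ i, ⁅FreeAlgebra.ι ℂ j, y k l⁆⁆
      - ⁅FreeAlgebra.ι ℂ j, ⁅FreeAlgebra.ι ℂ i, y k l⁆⁆ := by
    simp only [Ring.lie_def, y]; noncomm_ring
  have h : mk4 _ ⁅y i j, y k l⁆ = 0 := by
    rw [e, mk_eq_zero_iff_mem_M]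
    exact sub_mem (L_le_M 4 (lie_mem_L_four _ _ _ _)) (L_le_M 4 (lie_mem_L_four _ _ _ _))
  rwa [Ring.lie_def, map_sub, map_mul, map_mul, sub_eq_zero] at h

theorem toForms_y (i j : Fin n) : toForms n (y i j) =
    (2 : ℂ) • (extd n (fn (MvPolynomial.X i)) * extd n (fn (MvPolynomial.X j))) :=
  toForms_lie (toForms_ι i) (toForms_ι j)

theorem extd_fn_X (i : Fin n) : extd n (fn (MvPolynomial.X i)) = dx i := by
  rw [extd_fn, Finset.sum_eq_single i]
  · simp [dx_eq]
  · intro j _ hj; simp [MvPolynomial.pderiv_X_of_ne hj.symm]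
  · simp

theorem toForms_liftFn_mul_y (f : Poly n) (i j : Fin n) :
    toForms n (liftFn n f * y i j) = (2 : ℂ) • (fn f * dx i * dx j) := by
  have h : extd n (toForms n (y i j)) = 0 := by
    rw [toForms_y, map_smul, extd_mul, extd_extd, extd_extd, zero_mul, mul_zero, add_zero,
      smul_zero]
  rw [toForms_mul, starLeft_apply, h, mul_zero, add_zero, toForms_liftFn, toForms_y, extd_fn_X,
    extd_fn_X, mul_smul_comm, mul_assoc]

theorem extd_fn_eq (f : Poly n) : extd n (fn f) = ∑ k, fn (MvPolynomial.pderiv k f) * dx k := by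
  rw [extd_fn]
  simp [fn, dx_eq]

/-- `[a, x_j] ≡ ∑ k, (∂_k f) [x_k, x_j]` modulo `M 3` if `a` represents the function `f`. -/
theorem lie_ι_sub_mem {a : FreeAlg n} {f : Poly n} (ha : toForms n a = fn f) (j : Fin n) :
    ⁅a, FreeAlgebra.ι ℂ j⁆ - ∑ k, liftFn n (MvPolynomial.pderiv k f) * y k j
      ∈ M (FreeAlg n) 3 := by
  refine mem_M_three_of_toForms_eq_zero ?_
  simp only [map_sub, map_sum, toForms_liftFn_mul_y]
  rw [toForms_lie ha (toForms_ι j), extd_fn_eq f, extd_fn_X, Finset.sum_mul, Finset.smul_sum,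
    sub_self]

/-- Modulo `M 3` the element y_ij is the form 2 dx_i ∧ dx_j, and this is its Lie derivative. The
error in `M 3` is harmless: it disappears on multiplication by another y and on bracketing with a
generator. -/
theorem liftD_y_sub_mem (X : W n) (i j : Fin n) :
    liftD X (y i j) - (∑ k, liftFn n (MvPolynomial.pderiv k (X (MvPolynomial.X i))) * y k j
      + ∑ k, liftFn n (MvPolynomial.pderiv k (X (MvPolynomial.X j))) * y i k)
      ∈ M (FreeAlg n) 3 := by
  have h1 := lie_ι_sub_mem ((lifts_liftD X).apply_ι i) j
  have h2 := lie_ι_sub_mem ((lifts_liftD X).apply_ι j) i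
  have hs : ∀ k, y i k = -y k i := fun k => ring_lie_skew _ _
  have e : liftD X (y i j) = ⁅liftD X (FreeAlgebra.ι ℂ i), FreeAlgebra.ι ℂ j⁆
      - ⁅liftD X (FreeAlgebra.ι ℂ j), FreeAlgebra.ι ℂ i⁆ := by
    rw [y_eq_lie, (isDerivation_liftD X).map_lie, ring_lie_skew (FreeAlgebra.ι ℂ i), sub_eq_add_neg]
  have h := sub_mem h1 h2
  rw [e]
  simp only [hs _, mul_neg, Finset.sum_neg_distrib]
  rwa [sub_sub_sub_comm, sub_eq_add_neg (∑ k, _ : FreeAlg n)] at h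

theorem y4_mul_fn4_mul (i j k l : Fin n) (f : Poly n) :
    y4 i j * (fn4 n f * y4 k l) = fn4 n f * (y4 i j * y4 k l) := by
  have h := mk4_M_three_mul_M_two (L_le_M 3 (lie_mem_L_three (liftFn n f) (FreeAlgebra.ι ℂ i)
    (FreeAlgebra.ι ℂ j))) (y_mem k l)
  rw [map_lie_ring, Ring.lie_def, sub_mul, sub_eq_zero, mul_assoc, mul_assoc] at h
  exact h.symm

theorem mk4_liftD_y (X : W n) (i j : Fin n) : ∃ m ∈ M (FreeAlg n) 3, mk4 _ (liftD X (y i j)) =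
    (∑ k, fn4 n (MvPolynomial.pderiv k (X (MvPolynomial.X i))) * y4 k j
      + ∑ k, fn4 n (MvPolynomial.pderiv k (X (MvPolynomial.X j))) * y4 i k) + mk4 _ m := by
  refine ⟨_, liftD_y_sub_mem X i j, ?_⟩
  simp only [map_sub, map_add, map_sum, map_mul, fn4_apply, y4]
  abel

theorem mk4_liftD_y_mul (X : W n) (i j k l : Fin n) : mk4 _ (liftD X (y i j)) * y4 k l =
    ∑ m, fn4 n (MvPolynomial.pderiv m (X (MvPolynomial.X i))) * (y4 m j * y4 k l)
      + ∑ m, fn4 n (MvPolynomial.pderiv m (X (MvPolynomial.X j))) * (y4 i m * y4 k l) := by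
  obtain ⟨m, hm, h⟩ := mk4_liftD_y X i j
  have h0 : mk4 _ m * y4 k l = 0 := mk4_M_three_mul_M_two hm (y_mem k l)
  rw [h, add_mul, h0, add_zero, add_mul, Finset.sum_mul, Finset.sum_mul]
  simp only [mul_assoc]

theorem mul_mk4_liftD_y (X : W n) (i j k l : Fin n) : y4 i j * mk4 _ (liftD X (y k l)) =
    ∑ m, fn4 n (MvPolynomial.pderiv m (X (MvPolynomial.X k))) * (y4 i j * y4 m l)
      + ∑ m, fn4 n (MvPolynomial.pderiv m (X (MvPolynomial.X l))) * (y4 i j * y4 k m) := by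
  obtain ⟨m, hm, h⟩ := mk4_liftD_y X k l
  have h0 : y4 i j * mk4 _ m = 0 := mk4_M_two_mul_M_three (y_mem i j) hm
  rw [h, mul_add, h0, add_zero, mul_add, Finset.mul_sum, Finset.mul_sum]
  simp only [y4_mul_fn4_mul]

/-- The tensor law is exact here, because the errors in the derivatives of the y's lie in `M 3` and
get multiplied by an element of `M 2`. -/
theorem lie_quadGen (X : W n) (i j k l : Fin n) : ⁅X, quadGen i j k l⁆ =
    ∑ m, gmul n (MvPolynomial.pderiv m (X (MvPolynomial.X i))) (quadGen m j k l)
    + ∑ m, gmul n (MvPolynomial.pderiv m (X (MvPolynomial.X j))) (quadGen i m k l)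
    + ∑ m, gmul n (MvPolynomial.pderiv m (X (MvPolynomial.X k))) (quadGen i j m l)
    + ∑ m, gmul n (MvPolynomial.pderiv m (X (MvPolynomial.X l))) (quadGen i j k m) := by
  refine emb_injective ?_
  rw [quadGen, emb_lie]
  have e : mk4 _ (liftD X (y i j * y k l + y i k * y j l)) =
      mk4 _ (liftD X (y i j)) * y4 k l + y4 i j * mk4 _ (liftD X (y k l))
      + (mk4 _ (liftD X (y i k)) * y4 j l + y4 i k * mk4 _ (liftD X (y j l))) := by
    rw [map_add, isDerivation_liftD, isDerivation_liftD]
    simp only [map_add, map_mul, y4]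
  refine Eq.trans e ?_
  rw [mk4_liftD_y_mul, mk4_liftD_y_mul, mul_mk4_liftD_y, mul_mk4_liftD_y]
  simp only [map_add, map_sum, emb_gmul, emb_quadGen, mul_add, Finset.sum_add_distrib]
  abel

/-- For fixed u, v the map a ↦ [a, [u, v]] is a derivation into `M 3 / M 4`, where left and right
multiplication agree and factor through polynomials. It therefore obeys the chain rule. -/
theorem mk4_lie_lie (a u v : FreeAlg n) : mk4 _ ⁅a, ⁅u, v⁆⁆ =
    ∑ k, fn4 n (MvPolynomial.pderiv k (abl n a)) * mk4 _ ⁅FreeAlgebra.ι ℂ k, ⁅u, v⁆⁆ := by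
  have hM : ∀ a : FreeAlg n, ⁅a, ⁅u, v⁆⁆ ∈ M (FreeAlg n) 3 := fun a =>
    L_le_M 3 (lie_mem_L_three a u v)
  induction a using FreeAlgebra.induction with
  | grade0 r =>
    rw [Ring.lie_def, Algebra.commutes, sub_self, map_zero, AlgHom.commutes]
    simp [MvPolynomial.algebraMap_eq]
  | grade1 i =>
    rw [Finset.sum_eq_single i]
    · rw [abl_ι, MvPolynomial.pderiv_X_self]
      -- The chosen representative of the function 1 need not be the unit, but it acts as the unit
      -- on `M 3 / M 4`.
      have := mk4_mul_eq_fn4_mul 1 (hM (FreeAlgebra.ι ℂ i))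
      rw [map_one, map_one, one_mul] at this
      exact this
    · intro j _ hj
      rw [abl_ι, MvPolynomial.pderiv_X_of_ne hj.symm, map_zero, zero_mul]
    · simp
  | mul a b ha hb =>
    have e : ⁅a * b, ⁅u, v⁆⁆ = a * ⁅b, ⁅u, v⁆⁆ + ⁅a, ⁅u, v⁆⁆ * b := by
      simp only [Ring.lie_def]; noncomm_ring
    rw [e, map_add, map_mul, map_mul, mk4_M_three_comm b (hM a), mk4_mul_eq_fn4_mul a (hM b),
      mk4_mul_eq_fn4_mul b (hM a), ha, hb, Finset.mul_sum, Finset.mul_sum, ← Finset.sum_add_distrib]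
    refine Finset.sum_congr rfl fun k _ => ?_
    rw [← fn4_mul_mul _ _ (hM _), ← fn4_mul_mul _ _ (hM _), ← add_mul, ← map_add, map_mul,
      Derivation.leibniz, smul_eq_mul, smul_eq_mul]
  | add a b ha hb =>
    rw [ring_add_lie, map_add, ha, hb, ← Finset.sum_add_distrib]
    refine Finset.sum_congr rfl fun k _ => ?_
    rw [map_add, map_add, map_add, add_mul]

theorem lie_ι_fn4_mul (i k l : Fin n) (f : Poly n) : ⁅mk4 _ (FreeAlgebra.ι ℂ i), fn4 n f⁆ * y4 k l =
    ∑ m, fn4 n (MvPolynomial.pderiv m f) * (y4 i m * y4 k l) := by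
  have h := mk4_M_three_mul_M_two (lie_ι_sub_mem (toForms_liftFn f) i) (y_mem k l)
  have hs : ∀ m : Fin n, y4 i m = -y4 m i := fun m => y4_skew i m
  rw [map_sub, sub_mul, sub_eq_zero, map_lie_ring, ring_lie_skew, neg_mul, neg_eq_iff_eq_neg] at h
  simp only [hs _, neg_mul, mul_neg, Finset.sum_neg_distrib]
  refine h.trans ?_
  simp only [map_sum, map_mul, Finset.sum_mul, mul_assoc]
  rfl

/-- A second order contribution symmetrizes to a combination of the quadratic generators. -/
theorem sum_lie_ι_fn4_mul (i j : Fin n) (f : Poly n) :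
    ∑ k, ⁅mk4 _ (FreeAlgebra.ι ℂ i), fn4 n (MvPolynomial.pderiv k f)⁆ * y4 k j =
    emb _ ((1 / 2 : ℂ) • ∑ k, ∑ m, gmul n (MvPolynomial.pderiv m (MvPolynomial.pderiv k f))
      (quadGen i m k j)) := by
  simp only [lie_ι_fn4_mul, map_smul, map_sum, emb_gmul, emb_quadGen, mul_add,
    Finset.sum_add_distrib]
  -- Second derivatives are symmetric, so k and m may be exchanged; averaging the two forms of the
  -- sum produces the quadratic generators and the factor 1/2.
  have h : ∑ k, ∑ m, fn4 n (MvPolynomial.pderiv m (MvPolynomial.pderiv k f)) * (y4 i k * y4 m j) =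
      ∑ k, ∑ m, fn4 n (MvPolynomial.pderiv m (MvPolynomial.pderiv k f)) * (y4 i m * y4 k j) := by
    rw [Finset.sum_comm]
    refine Finset.sum_congr rfl fun k _ => Finset.sum_congr rfl fun m _ => ?_
    rw [pderiv_comm]
  rw [h]
  module

/-- Bracketing x_i with the coefficients in the derivative of y_jk differentiates them once more.
These second-order terms, collected in `Q`, are the only deviation from the tensor law. -/
theorem lie_tripleGen_sub_mem (X : W n) (i j k : Fin n) (N : Submodule ℂ (Gr (FreeAlg n) 3))
    (hN : ∀ f, ∀ i j k l : Fin n, gmul n f (quadGen i j k l) ∈ N) : ⁅X, tripleGen i j k⁆ -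
    (∑ m, gmul n (MvPolynomial.pderiv m (X (MvPolynomial.X i))) (tripleGen m j k)
    + ∑ m, gmul n (MvPolynomial.pderiv m (X (MvPolynomial.X j))) (tripleGen i m k)
    + ∑ m, gmul n (MvPolynomial.pderiv m (X (MvPolynomial.X k))) (tripleGen i j m)) ∈ N := by
  let Q : Fin n → Fin n → Poly n → Gr (FreeAlg n) 3 := fun i j f =>
    (1 / 2 : ℂ) • ∑ k, ∑ m, gmul n (MvPolynomial.pderiv m (MvPolynomial.pderiv k f))
      (quadGen i m k j)
  have hQ : ∀ i j f, Q i j f ∈ N := fun i j f =>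
    N.smul_mem _ (sum_mem fun k _ => sum_mem fun m _ => hN _ _ _ _ _)
  have key : ⁅X, tripleGen i j k⁆ -
      (∑ m, gmul n (MvPolynomial.pderiv m (X (MvPolynomial.X i))) (tripleGen m j k)
      + ∑ m, gmul n (MvPolynomial.pderiv m (X (MvPolynomial.X j))) (tripleGen i m k)
      + ∑ m, gmul n (MvPolynomial.pderiv m (X (MvPolynomial.X k))) (tripleGen i j m)) =
      Q i k (X (MvPolynomial.X j)) - Q i j (X (MvPolynomial.X k)) := by
    rw [sub_eq_iff_eq_add]
    refine emb_injective ?_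
    rw [tripleGen, emb_lie, (isDerivation_liftD X).map_lie, map_add]
    have h1 := mk4_lie_lie (liftD X (FreeAlgebra.ι ℂ i)) (FreeAlgebra.ι ℂ j) (FreeAlgebra.ι ℂ k)
    have habl : abl n (liftD X (FreeAlgebra.ι ℂ i)) = X (MvPolynomial.X i) := by
      rw [← constPart_toForms, (lifts_liftD X).apply_ι, constPart_fn]
    rw [habl] at h1
    have h2 : mk4 _ ⁅FreeAlgebra.ι ℂ i, liftD X (y j k)⁆ =
        ∑ m, fn4 n (MvPolynomial.pderiv m (X (MvPolynomial.X j))) *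
            ⁅mk4 _ (FreeAlgebra.ι ℂ i), y4 m k⁆
        + ∑ m, fn4 n (MvPolynomial.pderiv m (X (MvPolynomial.X k))) *
            ⁅mk4 _ (FreeAlgebra.ι ℂ i), y4 j m⁆
        + (∑ m, ⁅mk4 _ (FreeAlgebra.ι ℂ i), fn4 n (MvPolynomial.pderiv m (X (MvPolynomial.X j)))⁆
            * y4 m k
          - ∑ m, ⁅mk4 _ (FreeAlgebra.ι ℂ i), fn4 n (MvPolynomial.pderiv m (X (MvPolynomial.X k)))⁆
            * y4 m j) := by
      obtain ⟨m, hm, h⟩ := mk4_liftD_y X j k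
      have h0 : ⁅mk4 _ (FreeAlgebra.ι ℂ i), mk4 _ m⁆ = 0 := by
        rw [← map_lie_ring, mk_eq_zero_iff_mem_M]
        exact lie_M_three _ hm
      have hl : ∀ a b c : FreeAlg n ⧸ idealM (FreeAlg n) 4, ⁅a, b * c⁆ = b * ⁅a, c⁆ + ⁅a, b⁆ * c := by
        intro a b c; simp only [Ring.lie_def]; noncomm_ring
      have hsum : ∀ (a : FreeAlg n ⧸ idealM (FreeAlg n) 4) (F : Fin n → FreeAlg n ⧸ idealM (FreeAlg n) 4), ⁅a, ∑ m, F m⁆ =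
          ∑ m, ⁅a, F m⁆ := by
        intro a F; simp only [Ring.lie_def, Finset.mul_sum, Finset.sum_mul, Finset.sum_sub_distrib]
      have hs : ∀ (a : FreeAlg n ⧸ idealM (FreeAlg n) 4) (m : Fin n), a * y4 j m = -(a * y4 m j) := by
        intro a m; rw [y4_skew, mul_neg]
      rw [map_lie_ring, h, ring_lie_add, h0, add_zero, ring_lie_add, hsum, hsum]
      simp only [hl, Finset.sum_add_distrib]
      simp only [hs ⁅_, _⁆, Finset.sum_neg_distrib]
      abel
    rw [sum_lie_ι_fn4_mul, sum_lie_ι_fn4_mul] at h2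
    have h1' : mk4 _ ⁅liftD X (FreeAlgebra.ι ℂ i), y j k⁆ =
        ∑ m, fn4 n (MvPolynomial.pderiv m (X (MvPolynomial.X i))) *
          ⁅mk4 _ (FreeAlgebra.ι ℂ m), y4 j k⁆ := by
      rw [y_eq_lie, h1]
      simp only [map_lie_ring, y4, y_eq_lie]
    refine (congrArg₂ (· + ·) h1' h2).trans ?_
    simp only [map_add, map_sub, map_sum, emb_gmul, emb_tripleGen, Q]
    abel
  rw [key]
  exact sub_mem (hQ _ _ _) (hQ _ _ _)

end Functions

/-! ### The generators span `M 3 / M 4` over functions -/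

section Spanning

variable {n : ℕ}

/-- In effect, `M 3` is generated as an ideal by the two families. The y's become central, so [x_k,
d] = ∑ y_kl h_l with h playing the role of the gradient of d. In a double commutator of a product,
the cross terms then pair up into quadratic relations. -/
theorem lie_lie_eq_zero_of_generators {R : Type*} [Ring R] [Algebra ℂ R] (φ : FreeAlg n →ₐ[ℂ] R)
    (hφ : Function.Surjective φ)
    (hT : ∀ i j k : Fin n, ⁅φ (FreeAlgebra.ι ℂ i), φ (y j k)⁆ = 0)
    (hQ : ∀ i j k l : Fin n, φ (y i j) * φ (y k l) + φ (y i k) * φ (y j l) = 0) (b c d : R) :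
    ⁅b, ⁅c, d⁆⁆ = 0 := by
  have cen : ∀ z : R, (∀ i, ⁅φ (FreeAlgebra.ι ℂ i), z⁆ = 0) → ∀ r, r * z = z * r := by
    intro z hz r
    obtain ⟨a, rfl⟩ := hφ r
    induction a using FreeAlgebra.induction with
    | grade0 r => rw [AlgHom.commutes, Algebra.commutes]
    | grade1 i =>
      have := hz i
      rwa [Ring.lie_def, sub_eq_zero] at this
    | mul a b ha hb => rw [map_mul, mul_assoc, hb, ← mul_assoc, ha, mul_assoc]
    | add a b ha hb => rw [map_add, add_mul, mul_add, ha, hb]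
  have ycen : ∀ j k r, r * φ (y j k) = φ (y j k) * r := fun j k => cen _ fun i => hT i j k
  have yskew : ∀ i j, φ (y i j) = -φ (y j i) := by
    intro i j; rw [← map_neg, y_eq_lie, ring_lie_skew]; rfl
  have hlc : ∀ k a b, ⁅φ (FreeAlgebra.ι ℂ k), φ (a * b)⁆ = φ a * ⁅φ (FreeAlgebra.ι ℂ k), φ b⁆
      + ⁅φ (FreeAlgebra.ι ℂ k), φ a⁆ * φ b := by
    intro k a b; rw [map_mul]; simp only [Ring.lie_def]; noncomm_ring
  have grad : ∀ d : FreeAlg n, ∃ h : Fin n → R, ∀ k,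
      ⁅φ (FreeAlgebra.ι ℂ k), φ d⁆ = ∑ l, φ (y k l) * h l := by
    intro d
    induction d using FreeAlgebra.induction with
    | grade0 r => exact ⟨0, fun k => by simp [Ring.lie_def, Algebra.commutes]⟩
    | grade1 i =>
      classical
      refine ⟨Pi.single i 1, fun k => ?_⟩
      rw [Finset.sum_eq_single i]
      · simp [y_eq_lie, map_lie_ring]
      · intro j _ hj; simp [hj]
      · simp
    | mul a b ha hb =>
      obtain ⟨g, hg⟩ := ha
      obtain ⟨h, hh⟩ := hb
      refine ⟨fun l => φ a * h l + g l * φ b, fun k => ?_⟩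
      rw [hlc, hg, hh, Finset.mul_sum, Finset.sum_mul, ← Finset.sum_add_distrib]
      refine Finset.sum_congr rfl fun l _ => ?_
      rw [← mul_assoc, ycen]
      noncomm_ring
    | add a b ha hb =>
      obtain ⟨g, hg⟩ := ha
      obtain ⟨h, hh⟩ := hb
      refine ⟨fun l => g l + h l, fun k => ?_⟩
      rw [map_add, ring_lie_add, hg, hh, ← Finset.sum_add_distrib]
      simp only [mul_add]
  have step : ∀ (d : FreeAlg n) (i k), ⁅φ (FreeAlgebra.ι ℂ k), ⁅φ (FreeAlgebra.ι ℂ i), φ d⁆⁆ = 0 := by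
    intro d
    induction d using FreeAlgebra.induction with
    | grade0 r => intro i k; simp [Ring.lie_def, Algebra.commutes]
    | grade1 j => intro i k; rw [← map_lie_ring, ← y_eq_lie, hT]
    | add a b ha hb => intro i k; rw [map_add, ring_lie_add, ring_lie_add, ha, hb, add_zero]
    | mul a b ha hb =>
      intro i k
      obtain ⟨g, hg⟩ := grad a
      obtain ⟨h, hh⟩ := grad b
      have e : ⁅φ (FreeAlgebra.ι ℂ k), ⁅φ (FreeAlgebra.ι ℂ i), φ (a * b)⁆⁆ =
          φ a * ⁅φ (FreeAlgebra.ι ℂ k), ⁅φ (FreeAlgebra.ι ℂ i), φ b⁆⁆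
          + ⁅φ (FreeAlgebra.ι ℂ k), ⁅φ (FreeAlgebra.ι ℂ i), φ a⁆⁆ * φ b
          + (⁅φ (FreeAlgebra.ι ℂ i), φ a⁆ * ⁅φ (FreeAlgebra.ι ℂ k), φ b⁆
          + ⁅φ (FreeAlgebra.ι ℂ k), φ a⁆ * ⁅φ (FreeAlgebra.ι ℂ i), φ b⁆) := by
        rw [map_mul]; simp only [Ring.lie_def]; noncomm_ring
      rw [e, ha, hb, mul_zero, zero_mul, zero_add, zero_add, hg, hg, hh, hh, Finset.sum_mul_sum,
        Finset.sum_mul_sum, ← Finset.sum_add_distrib]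
      refine Finset.sum_eq_zero fun l _ => ?_
      rw [← Finset.sum_add_distrib]
      refine Finset.sum_eq_zero fun m _ => ?_
      have q := hQ l i k m
      rw [yskew l i, yskew l k, neg_mul, neg_mul, ← neg_add, neg_eq_zero] at q
      have e2 : ∀ i k, φ (y i l) * g l * (φ (y k m) * h m) =
          φ (y i l) * φ (y k m) * (g l * h m) := by
        intro i k
        rw [mul_assoc, ← mul_assoc (g l), ycen]
        noncomm_ring
      rw [e2, e2, ← add_mul, q, zero_mul]
  have zcen : ∀ (d : FreeAlg n) (i r), r * ⁅φ (FreeAlgebra.ι ℂ i), φ d⁆ =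
      ⁅φ (FreeAlgebra.ι ℂ i), φ d⁆ * r := fun d i => cen _ fun k => step d i k
  -- The same coefficients g have to serve both expansions: in `step2` the terms [x_k, a] [b, d] and
  -- [a, d] [x_k, b] are matched coefficient by coefficient.
  have grad2 : ∀ d c : FreeAlg n, ∃ g : Fin n → R,
      (∀ k, ⁅φ (FreeAlgebra.ι ℂ k), φ c⁆ = ∑ l, φ (y k l) * g l) ∧
      ⁅φ c, φ d⁆ = ∑ l, ⁅φ (FreeAlgebra.ι ℂ l), φ d⁆ * g l := by
    intro d c
    induction c using FreeAlgebra.induction with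
    | grade0 r =>
      refine ⟨0, fun k => ?_, ?_⟩
      · simp [Ring.lie_def, Algebra.commutes]
      · simp [Ring.lie_def, Algebra.commutes]
    | grade1 i =>
      classical
      refine ⟨Pi.single i 1, fun k => ?_, ?_⟩
      · rw [Finset.sum_eq_single i]
        · simp [y_eq_lie, map_lie_ring]
        · intro j _ hj; simp [hj]
        · simp
      · rw [Finset.sum_eq_single i]
        · simp
        · intro j _ hj; simp [hj]
        · simp
    | mul a b ha hb =>
      obtain ⟨g, hg, hg'⟩ := ha
      obtain ⟨h, hh, hh'⟩ := hb
      refine ⟨fun l => φ a * h l + g l * φ b, fun k => ?_, ?_⟩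
      · rw [hlc, hg, hh, Finset.mul_sum, Finset.sum_mul, ← Finset.sum_add_distrib]
        refine Finset.sum_congr rfl fun l _ => ?_
        rw [← mul_assoc, ycen]
        noncomm_ring
      · have e : ⁅φ (a * b), φ d⁆ = φ a * ⁅φ b, φ d⁆ + ⁅φ a, φ d⁆ * φ b := by
          rw [map_mul]; simp only [Ring.lie_def]; noncomm_ring
        rw [e, hg', hh', Finset.mul_sum, Finset.sum_mul, ← Finset.sum_add_distrib]
        refine Finset.sum_congr rfl fun l _ => ?_
        rw [← mul_assoc, zcen]
        noncomm_ring
    | add a b ha hb =>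
      obtain ⟨g, hg, hg'⟩ := ha
      obtain ⟨h, hh, hh'⟩ := hb
      refine ⟨fun l => g l + h l, fun k => ?_, ?_⟩
      · rw [map_add, ring_lie_add, hg, hh, ← Finset.sum_add_distrib]
        simp only [mul_add]
      · rw [map_add, ring_add_lie, hg', hh', ← Finset.sum_add_distrib]
        simp only [mul_add]
  have step2 : ∀ d c : FreeAlg n, ∀ k, ⁅φ (FreeAlgebra.ι ℂ k), ⁅φ c, φ d⁆⁆ = 0 := by
    intro d c
    induction c using FreeAlgebra.induction with
    | grade0 r => intro k; simp [Ring.lie_def, Algebra.commutes]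
    | grade1 j => intro k; exact step d j k
    | add a b ha hb => intro k; rw [map_add, ring_add_lie, ring_lie_add, ha, hb, add_zero]
    | mul a b ha hb =>
      intro k
      obtain ⟨g, hg, hg'⟩ := grad2 d a
      obtain ⟨h, hh, hh'⟩ := grad2 d b
      obtain ⟨f, hf⟩ := grad d
      have e : ⁅φ (FreeAlgebra.ι ℂ k), ⁅φ (a * b), φ d⁆⁆ =
          φ a * ⁅φ (FreeAlgebra.ι ℂ k), ⁅φ b, φ d⁆⁆
          + ⁅φ (FreeAlgebra.ι ℂ k), ⁅φ a, φ d⁆⁆ * φ b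
          + (⁅φ (FreeAlgebra.ι ℂ k), φ a⁆ * ⁅φ b, φ d⁆
          + ⁅φ a, φ d⁆ * ⁅φ (FreeAlgebra.ι ℂ k), φ b⁆) := by
        rw [map_mul]; simp only [Ring.lie_def]; noncomm_ring
      rw [e, ha, hb, mul_zero, zero_mul, zero_add, zero_add, hg, hg', hh, hh', Finset.sum_mul_sum,
        Finset.sum_mul_sum, ← Finset.sum_add_distrib]
      refine Finset.sum_eq_zero fun p _ => ?_
      rw [← Finset.sum_add_distrib]
      refine Finset.sum_eq_zero fun q _ => ?_
      have hz : φ (y k p) * ⁅φ (FreeAlgebra.ι ℂ q), φ d⁆ +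
          ⁅φ (FreeAlgebra.ι ℂ p), φ d⁆ * φ (y k q) = 0 := by
        rw [ycen, hf, hf, Finset.mul_sum, Finset.mul_sum, ← Finset.sum_add_distrib]
        refine Finset.sum_eq_zero fun m _ => ?_
        rw [← mul_assoc, ← mul_assoc, ← add_mul, hQ, zero_mul]
      have e1 : φ (y k p) * g p * (⁅φ (FreeAlgebra.ι ℂ q), φ d⁆ * h q) =
          φ (y k p) * ⁅φ (FreeAlgebra.ι ℂ q), φ d⁆ * (g p * h q) := by
        rw [mul_assoc, ← mul_assoc (g p), zcen]
        noncomm_ring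
      have e2 : ⁅φ (FreeAlgebra.ι ℂ p), φ d⁆ * g p * (φ (y k q) * h q) =
          ⁅φ (FreeAlgebra.ι ℂ p), φ d⁆ * φ (y k q) * (g p * h q) := by
        rw [mul_assoc, ← mul_assoc (g p), ycen]
        noncomm_ring
      rw [e1, e2, ← add_mul, hz, zero_mul]
  obtain ⟨c, rfl⟩ := hφ c
  obtain ⟨d, rfl⟩ := hφ d
  rw [Ring.lie_def, cen _ (step2 d c) b, sub_self]

/-- Two-sided ideal of the elements of `M 3` whose class lies in a given submodule. -/
def idealOfStable (N : Submodule ℂ (Gr (FreeAlg n) 3)) (hN : ∀ f, ∀ v ∈ N, gmul n f v ∈ N) :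
    Ideal (FreeAlg n) where
  carrier := {a | ∃ h : a ∈ M (FreeAlg n) 3, toGr 3 ⟨a, h⟩ ∈ N}
  add_mem' := by
    rintro a b ⟨ha, ha'⟩ ⟨hb, hb'⟩
    exact ⟨add_mem ha hb, add_mem ha' hb'⟩
  zero_mem' := ⟨zero_mem _, N.zero_mem⟩
  smul_mem' := by
    rintro r a ⟨ha, ha'⟩
    refine ⟨mul_mem_M_left _ 3 r ha, ?_⟩
    have := hN (abl n r) _ ha'
    rwa [← mulGr_eq_gmul] at this

theorem isTwoSided_idealOfStable (N : Submodule ℂ (Gr (FreeAlg n) 3))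
    (hN : ∀ f, ∀ v ∈ N, gmul n f v ∈ N) : (idealOfStable N hN).IsTwoSided := by
  refine ⟨fun {a} r ha => ?_⟩
  obtain ⟨h, h'⟩ := (idealOfStable N hN).mul_mem_left r ha
  obtain ⟨ha, _⟩ := ha
  refine ⟨mul_mem_M_right _ 3 r ha, ?_⟩
  have e : toGr 3 ⟨a * r, mul_mem_M_right _ 3 r ha⟩ = toGr 3 ⟨r * a, h⟩ := by
    refine emb_injective ?_
    rw [emb_toGr, emb_toGr, map_mul, map_mul, mk4_M_three_comm r ha]
  rwa [e]

/-- Divide the free algebra by the ideal attached to N. The generators vanish there, hence so do all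
triple commutators, and the ideal contains `M 3`. -/
theorem eq_top_of_generators_mem (N : Submodule ℂ (Gr (FreeAlg n) 3))
    (hN : ∀ f, ∀ v ∈ N, gmul n f v ∈ N) (hq : ∀ i j k l, quadGen i j k l ∈ N)
    (ht : ∀ i j k, tripleGen i j k ∈ N) : N = ⊤ := by
  have := isTwoSided_idealOfStable N hN
  let φ : FreeAlg n →ₐ[ℂ] FreeAlg n ⧸ idealOfStable N hN := Ideal.Quotient.mkₐ ℂ _
  have hφ : ∀ a, φ a = 0 ↔ a ∈ idealOfStable N hN := fun a => Ideal.Quotient.eq_zero_iff_mem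
  have key := lie_lie_eq_zero_of_generators φ (Ideal.Quotient.mkₐ_surjective ℂ _)
    (fun i j k => by
      rw [← map_lie_ring, hφ]
      exact ⟨_, ht i j k⟩)
    (fun i j k l => by
      rw [← map_mul, ← map_mul, ← map_add, hφ]
      exact ⟨_, hq i j k l⟩)
  rw [eq_top_iff]
  rintro v -
  obtain ⟨⟨x, hx⟩, rfl⟩ := exists_toGr v
  have hmem : x ∈ idealOfStable N hN := by
    refine M_three_induction (fun a b c d e => ?_) (fun _ _ h1 h2 => add_mem h1 h2) hx
    rw [← hφ, map_mul, map_mul, map_lie_ring, map_lie_ring, key, mul_zero, zero_mul]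
  exact hmem.2

end Spanning

/-! ### Tensor fields: an irreducibility criterion -/

section TensorOperators

variable {n : ℕ} {ι : Type}

/-- Multiplication of a tensor field by a function. -/
def tmul (g : Poly n) : Tensor n ι →ₗ[ℂ] Tensor n ι where
  toFun t := fun m => g * t m
  map_add' s t := funext fun m => mul_add g (s m) (t m)
  map_smul' c t := funext fun m => mul_smul_comm c g (t m)

@[simp] theorem tmul_apply (g : Poly n) (t : Tensor n ι) (m : ι → Fin n) :
    tmul g t m = g * t m := rfl

/-- The componentwise partial derivative of a tensor field. -/
def dpart (a : Fin n) : Tensor n ι →ₗ[ℂ] Tensor n ι where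
  toFun t := fun m => MvPolynomial.pderiv a (t m)
  map_add' s t := funext fun m => map_add _ (s m) (t m)
  map_smul' c t := funext fun m => (MvPolynomial.pderiv a : W n).map_smul c (t m)

@[simp] theorem dpart_apply (a : Fin n) (t : Tensor n ι) (m : ι → Fin n) :
    dpart a t m = MvPolynomial.pderiv a (t m) := rfl

theorem dpart_tmul (a : Fin n) (g : Poly n) (t : Tensor n ι) :
    dpart a (tmul g t) = tmul (MvPolynomial.pderiv a g) t + tmul g (dpart a t) := by
  ext1 m
  simp [Derivation.leibniz]
  ring

variable [Fintype ι] [DecidableEq ι]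

/-- The action of the elementary matrix `E_{k a}` on the values of a tensor field, which replaces
`dx_a` by `dx_k`. -/
def fib (k a : Fin n) : Tensor n ι →ₗ[ℂ] Tensor n ι where
  toFun t := fun m => ∑ p : ι, if m p = k then t (Function.update m p a) else 0
  map_add' s t := funext fun m => by
    change _ = (∑ p : ι, if m p = k then s (Function.update m p a) else 0)
      + ∑ p : ι, if m p = k then t (Function.update m p a) else 0
    rw [← Finset.sum_add_distrib]
    refine Finset.sum_congr rfl fun p _ => ?_
    split_ifs <;> simp
  map_smul' c t := funext fun m => by
    change _ = c • ∑ p : ι, if m p = k then t (Function.update m p a) else 0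
    rw [Finset.smul_sum]
    refine Finset.sum_congr rfl fun p _ => ?_
    split_ifs <;> simp

theorem fib_apply (k a : Fin n) (t : Tensor n ι) (m : ι → Fin n) :
    fib k a t m = ∑ p : ι, if m p = k then t (Function.update m p a) else 0 := rfl

theorem fib_tmul (k a : Fin n) (g : Poly n) (t : Tensor n ι) :
    fib k a (tmul g t) = tmul g (fib k a t) := by
  ext1 m
  simp only [fib_apply, tmul_apply, Finset.mul_sum, mul_ite, mul_zero]

theorem dpart_fib (a k b : Fin n) (t : Tensor n ι) : dpart a (fib k b t) = fib k b (dpart a t) := by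
  ext1 m
  simp only [dpart_apply, fib_apply, map_sum]
  refine Finset.sum_congr rfl fun p _ => ?_
  split_ifs <;> simp

/-- The vector field `f ∂_a`. -/
def vf (f : Poly n) (a : Fin n) : W n := f • MvPolynomial.pderiv a

theorem lie_vf (f : Poly n) (a : Fin n) (t : Tensor n ι) :
    ⁅vf f a, t⁆ = tmul f (dpart a t) + ∑ k, tmul (MvPolynomial.pderiv k f) (fib k a t) := by
  classical
  have hsum : ∀ (s : Finset (Fin n)) (F : Fin n → Tensor n ι) (m), (∑ k ∈ s, F k) m = ∑ k ∈ s, F k m := by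
    intro s F m
    induction s using Finset.induction_on with
    | empty => simp
    | insert a s ha ih => rw [Finset.sum_insert ha, Finset.sum_insert ha, Tensor.add_apply, ih]
  ext1 m
  rw [lie_tensor_def, lieTensor_apply, Tensor.add_apply, hsum]
  simp only [tmul_apply, dpart_apply, vf, Derivation.smul_apply, smul_eq_mul, fib_apply,
    Finset.mul_sum, mul_ite, mul_zero]
  congr 1
  rw [Finset.sum_comm]
  conv_rhs => rw [Finset.sum_comm]
  rw [Finset.sum_comm]
  refine Finset.sum_congr rfl fun p _ => ?_
  rw [Finset.sum_ite_eq, if_pos (Finset.mem_univ _), Finset.sum_eq_single a]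
  · simp
  · intro j _ hj; simp [MvPolynomial.pderiv_X_of_ne hj]
  · simp

theorem lie_vf_one (a : Fin n) (t : Tensor n ι) : ⁅vf 1 a, t⁆ = dpart a t := by
  rw [lie_vf, Finset.sum_eq_zero]
  · ext1 m; simp
  · intro k _; ext1 m; simp

theorem lie_vf_X (k a : Fin n) (t : Tensor n ι) :
    ⁅vf (MvPolynomial.X k) a, t⁆ = tmul (MvPolynomial.X k) (dpart a t) + fib k a t := by
  rw [lie_vf, Finset.sum_eq_single k]
  · congr 1; ext1 m; simp
  · intro j _ hj; ext1 m; simp [MvPolynomial.pderiv_X_of_ne hj.symm]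
  · simp

theorem lie_vf_const (f : Poly n) (a : Fin n) {t : Tensor n ι} (ht : ∀ b, dpart b t = 0) :
    ⁅vf f a, t⁆ = ∑ k, tmul (MvPolynomial.pderiv k f) (fib k a t) := by
  rw [lie_vf, ht, map_zero, zero_add]

theorem lie_vf_lie_vf_const (f g : Poly n) (a : Fin n) {t : Tensor n ι} (ht : ∀ b, dpart b t = 0) :
    ⁅vf f a, ⁅vf g a, t⁆⁆ =
      ∑ k, tmul (f * MvPolynomial.pderiv a (MvPolynomial.pderiv k g)) (fib k a t)
      + ∑ k, ∑ l, tmul (MvPolynomial.pderiv l f * MvPolynomial.pderiv k g)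
          (fib l a (fib k a t)) := by
  rw [lie_vf_const g a ht, lie_vf]
  have htm : ∀ (p q : Poly n) (s : Tensor n ι), tmul p (tmul q s) = tmul (p * q) s := by
    intro p q s; ext1 m; simp [mul_assoc]
  congr 1
  · rw [map_sum, map_sum]
    refine Finset.sum_congr rfl fun k _ => ?_
    rw [dpart_tmul, dpart_fib, ht, map_zero, map_zero, add_zero, htm]
  · rw [Finset.sum_comm]
    refine Finset.sum_congr rfl fun l _ => ?_
    rw [map_sum, map_sum]
    refine Finset.sum_congr rfl fun k _ => ?_
    rw [fib_tmul, htm]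

theorem pderiv_X_mul (a k : Fin n) (g : Poly n) :
    MvPolynomial.pderiv k (MvPolynomial.X a * g) =
      (if k = a then g else 0) + MvPolynomial.X a * MvPolynomial.pderiv k g := by
  classical
  rw [MvPolynomial.pderiv_mul, MvPolynomial.pderiv_X, Pi.single_apply]
  simp only [eq_comm]
  split_ifs <;> simp

theorem second_difference_coeff (a k : Fin n) (g : Poly n) :
    MvPolynomial.X a * (MvPolynomial.X a * MvPolynomial.pderiv a (MvPolynomial.pderiv k g))
      - 2 * (MvPolynomial.X a * MvPolynomial.pderiv a
          (MvPolynomial.pderiv k (MvPolynomial.X a * g)))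
      + MvPolynomial.pderiv a (MvPolynomial.pderiv k (MvPolynomial.X a * (MvPolynomial.X a * g)))
      = if k = a then 2 * g else 0 := by
  simp only [pderiv_X_mul, map_add, if_true]
  split_ifs
  · simp only [pderiv_X_mul, if_true]; ring
  · simp only [map_zero]; ring

theorem first_difference_coeff (a k l : Fin n) (g : Poly n) :
    MvPolynomial.pderiv l (MvPolynomial.X a * MvPolynomial.X a) * MvPolynomial.pderiv k g
      - 2 * (MvPolynomial.pderiv l (MvPolynomial.X a) *
          MvPolynomial.pderiv k (MvPolynomial.X a * g))
      = if l = a then (if k = a then -(2 * g) else 0) else 0 := by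
  classical
  have hX : MvPolynomial.pderiv l (MvPolynomial.X a : Poly n) = if l = a then 1 else 0 := by
    rw [MvPolynomial.pderiv_X, Pi.single_apply]
    simp only [eq_comm]
  rw [pderiv_X_mul, pderiv_X_mul, hX]
  split_ifs <;> ring

/-- The combination is chosen so that all derivatives of g cancel and g itself remains. On a tensor
of E_aa-weight λ the factor is 2(λ − λ²), nonzero unless λ is 0 or 1. Constant basis differential
forms have only the weights 0 and 1, so for them the method gives nothing. -/
theorem second_difference (g : Poly n) (a : Fin n) {t : Tensor n ι} (ht : ∀ b, dpart b t = 0) :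
    ⁅vf (MvPolynomial.X a * MvPolynomial.X a) a, ⁅vf g a, t⁆⁆
      - (2 : ℂ) • ⁅vf (MvPolynomial.X a) a, ⁅vf (MvPolynomial.X a * g) a, t⁆⁆
      + ⁅vf 1 a, ⁅vf (MvPolynomial.X a * (MvPolynomial.X a * g)) a, t⁆⁆
    = (2 : ℂ) • tmul g (fib a a t - fib a a (fib a a t)) := by
  have h2 : ∀ f : Poly n, (2 : ℂ) • f = 2 * f := fun f => by rw [two_smul, two_mul]
  have hn2 : ∀ f : Poly n, (-2 : ℂ) • f = -(2 * f) := fun f => by rw [neg_smul, h2]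
  -- The terms with second derivatives (`e1`) give 2 g E_aa, the products of first derivatives
  -- (`e2`) give −2 g E_aa², and `e3` vanishes because 1 has zero derivatives.
  have e1 : ∀ s : Fin n → Tensor n ι,
      ∑ k, tmul (MvPolynomial.X a * MvPolynomial.X a *
        MvPolynomial.pderiv a (MvPolynomial.pderiv k g)) (s k)
      - (2 : ℂ) • ∑ k, tmul (MvPolynomial.X a * MvPolynomial.pderiv a
          (MvPolynomial.pderiv k (MvPolynomial.X a * g))) (s k)
      + ∑ k, tmul (1 * MvPolynomial.pderiv a
          (MvPolynomial.pderiv k (MvPolynomial.X a * (MvPolynomial.X a * g)))) (s k)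
      = (2 : ℂ) • tmul g (s a) := by
    intro s
    rw [Finset.smul_sum, ← Finset.sum_sub_distrib, ← Finset.sum_add_distrib]
    have h : ∀ k, tmul (MvPolynomial.X a * MvPolynomial.X a *
          MvPolynomial.pderiv a (MvPolynomial.pderiv k g)) (s k)
        - (2 : ℂ) • tmul (MvPolynomial.X a * MvPolynomial.pderiv a
          (MvPolynomial.pderiv k (MvPolynomial.X a * g))) (s k)
        + tmul (1 * MvPolynomial.pderiv a
          (MvPolynomial.pderiv k (MvPolynomial.X a * (MvPolynomial.X a * g)))) (s k)
        = if k = a then (2 : ℂ) • tmul g (s k) else 0 := by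
      intro k
      ext1 m
      have := congrArg (· * s k m) (second_difference_coeff a k g)
      simp only [Tensor.add_apply, Tensor.sub_apply, Tensor.smul_apply, tmul_apply, h2]
      split_ifs with hk <;> simp only [hk, if_true, if_false] at this
      · simp only [Tensor.smul_apply, tmul_apply, h2, hk]
        linear_combination this
      · simp only [Tensor.zero_apply]
        linear_combination this
    simp only [h, Finset.sum_ite_eq', Finset.mem_univ, if_true]
  have e2 : ∀ s : Fin n → Fin n → Tensor n ι,
      ∑ k, ∑ l, tmul (MvPolynomial.pderiv l (MvPolynomial.X a * MvPolynomial.X a) *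
        MvPolynomial.pderiv k g) (s k l)
      - (2 : ℂ) • ∑ k, ∑ l, tmul (MvPolynomial.pderiv l (MvPolynomial.X a) *
          MvPolynomial.pderiv k (MvPolynomial.X a * g)) (s k l)
      = -((2 : ℂ) • tmul g (s a a)) := by
    intro s
    simp only [Finset.smul_sum, ← Finset.sum_sub_distrib]
    have h : ∀ k l, tmul (MvPolynomial.pderiv l (MvPolynomial.X a * MvPolynomial.X a) *
          MvPolynomial.pderiv k g) (s k l)
        - (2 : ℂ) • tmul (MvPolynomial.pderiv l (MvPolynomial.X a) *
          MvPolynomial.pderiv k (MvPolynomial.X a * g)) (s k l)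
        = if l = a then (if k = a then (-2 : ℂ) • tmul g (s k l) else 0) else 0 := by
      intro k l
      ext1 m
      have := congrArg (· * s k l m) (first_difference_coeff a k l g)
      simp only [Tensor.sub_apply, Tensor.smul_apply, tmul_apply, h2]
      by_cases hl : l = a
      · by_cases hk : k = a
        · simp only [hl, hk, if_true, Tensor.smul_apply, tmul_apply, hn2] at this ⊢
          linear_combination this
        · simp only [hl, hk, if_true, if_false, Tensor.zero_apply] at this ⊢
          linear_combination this
      · simp only [hl, if_false, Tensor.zero_apply] at this ⊢
        linear_combination this
    simp only [h, Finset.sum_ite_eq', Finset.mem_univ, if_true, neg_smul]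
  have e3 : ∀ s : Fin n → Fin n → Tensor n ι,
      ∑ k, ∑ l, tmul (MvPolynomial.pderiv l (1 : Poly n) *
        MvPolynomial.pderiv k (MvPolynomial.X a * (MvPolynomial.X a * g))) (s k l) = 0 := by
    intro s
    refine Finset.sum_eq_zero fun k _ => Finset.sum_eq_zero fun l _ => ?_
    ext1 m
    simp
  rw [lie_vf_lie_vf_const _ _ _ ht, lie_vf_lie_vf_const _ _ _ ht, lie_vf_lie_vf_const _ _ _ ht,
    e3, add_zero, map_sub, smul_sub, ← e1 fun k => fib k a t,
    sub_eq_add_neg _ ((2 : ℂ) • tmul g _), ← e2 fun k l => fib l a (fib k a t), smul_add]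
  abel

/-- A tensor field in a submodule can be differentiated to a constant one, and raised to one
which is annihilated by the raising operators. -/
theorem exists_const_raised (N : LieSubmodule ℂ (W n) (Tensor n ι)) (hN : N ≠ ⊥) :
    ∃ t ∈ N, t ≠ 0 ∧ (∀ a, dpart a t = 0) ∧ ∀ i j : Fin n, i < j → fib i j t = 0 := by
  classical
  obtain ⟨t₀, ht₀, hne₀⟩ : ∃ t ∈ N, t ≠ 0 := by
    by_contra! h
    exact hN ((LieSubmodule.eq_bot_iff N).2 h)
  have hd : ∃ d : ℕ, ∃ t ∈ N, t ≠ 0 ∧ ∀ m (s : Fin n →₀ ℕ), d ≤ s.degree → (t m).coeff s = 0 := by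
    refine ⟨(Finset.univ : Finset (ι → Fin n)).sup (fun m => (t₀ m).totalDegree) + 1, t₀, ht₀, hne₀,
      fun m s hs => ?_⟩
    refine MvPolynomial.coeff_eq_zero_of_totalDegree_lt (lt_of_lt_of_le ?_ hs)
    exact Nat.lt_succ_of_le (Finset.le_sup (f := fun m => (t₀ m).totalDegree) (Finset.mem_univ m))
  have hconst : ∃ t ∈ N, t ≠ 0 ∧ ∀ a, dpart a t = 0 := by
    obtain ⟨t, htN, hne, hb⟩ := Nat.find_spec hd
    refine ⟨t, htN, hne, fun a => ?_⟩
    by_contra hc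
    have hpos : Nat.find hd ≠ 0 := by
      intro h0
      refine hne (Tensor.ext fun m => MvPolynomial.ext _ _ fun s => ?_)
      rw [hb m s (by omega)]; simp
    refine Nat.find_min hd (Nat.sub_one_lt hpos) ⟨dpart a t, ?_, hc, fun m s hs => ?_⟩
    · rw [← lie_vf_one]; exact N.lie_mem htN
    · rw [dpart_apply, MvPolynomial.coeff_pderiv, hb, zero_mul]
      rw [map_add, Finsupp.degree_single]; omega
  -- The sum of the indices. Replacing dx_j by dx_i with i < j lowers it, so a constant tensor with
  -- the least bound is annihilated by every raising operator.
  let ht : (ι → Fin n) → ℕ := fun m => ∑ p, (m p : ℕ)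
  have hh : ∃ h : ℕ, ∃ t ∈ N, t ≠ 0 ∧ (∀ a, dpart a t = 0) ∧ ∀ m, h ≤ ht m → t m = 0 := by
    obtain ⟨t, htN, hne, hc⟩ := hconst
    refine ⟨(Finset.univ : Finset (ι → Fin n)).sup ht + 1, t, htN, hne, hc, fun m hm => ?_⟩
    have := Finset.le_sup (f := ht) (Finset.mem_univ m)
    omega
  obtain ⟨t, htN, hne, hc, hb⟩ := Nat.find_spec hh
  refine ⟨t, htN, hne, hc, fun i j hij => ?_⟩
  by_contra hf
  have hpos : Nat.find hh ≠ 0 := by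
    intro h0
    exact hne (Tensor.ext fun m => by rw [hb m (by omega)]; rfl)
  refine Nat.find_min hh (Nat.sub_one_lt hpos) ⟨fib i j t, ?_, hf, fun a => ?_, fun m hm => ?_⟩
  · have := N.lie_mem (x := vf (MvPolynomial.X i) j) htN
    rwa [lie_vf_X, hc, map_zero, zero_add] at this
  · rw [dpart_fib, hc, map_zero]
  · rw [fib_apply]
    refine Finset.sum_eq_zero fun p _ => ?_
    split_ifs with hp
    · refine hb _ ?_
      have h1 : ht (Function.update m p j) + i = ht m + j := by
        simp only [ht]
        rw [← Finset.add_sum_erase _ _ (Finset.mem_univ p),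
          ← Finset.add_sum_erase Finset.univ (fun p => (m p : ℕ)) (Finset.mem_univ p),
          Function.update_self, hp]
        rw [Finset.sum_congr rfl (g := fun q => (m q : ℕ)) fun q hq => by
          rw [Function.update_of_ne (Finset.ne_of_mem_erase hq)]]
        omega
      have : (i : ℕ) < j := hij
      omega
    · rfl

/-- The constant tensor field with a single nonzero component. -/
def basisTensor (m : ι → Fin n) : Tensor n ι := fun m' => if m' = m then 1 else 0

/-- A nonzero submodule N contains w by `exists_const_raised` and the uniqueness `hhigh`. It
contains all function multiples of w by `second_difference`, and then those of every tensor reached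
from w by gl_n. By `hspan` these include the images under `c` of all basis tensors, which span F
over functions. -/
theorem irreducible_of_highest (F : LieSubmodule ℂ (W n) (Tensor n ι))
    (c : Tensor n ι →ₗ[ℂ] Tensor n ι) (hF : F.toSubmodule = LinearMap.range c)
    (hct : ∀ g t, c (tmul g t) = tmul g (c t)) (w : Tensor n ι) (hw0 : w ≠ 0)
    (z : Fin n) (hwF : w ∈ F)
    (hw2 : fib z z w = (2 : ℂ) • w)
    (hhigh : ∀ t ∈ F, (∀ a, dpart a t = 0) → (∀ i j : Fin n, i < j → fib i j t = 0) →
      ∃ r : ℂ, t = r • w)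
    (hspan : ∀ K : Submodule ℂ (Tensor n ι), (∀ k a, ∀ t ∈ K, fib k a t ∈ K) → w ∈ K →
      ∀ m, c (basisTensor m) ∈ K) :
    LieModule.IsIrreducible ℂ (W n) F := by
  have main : ∀ N : LieSubmodule ℂ (W n) (Tensor n ι), N ≤ F → N ≠ ⊥ → F ≤ N := by
    intro N hNF hN
    obtain ⟨t, htN, hne, hc, hr⟩ := exists_const_raised N hN
    obtain ⟨r, hr'⟩ := hhigh t (hNF htN) hc hr
    have hr0 : r ≠ 0 := by
      rintro rfl
      exact hne (by rw [hr', zero_smul])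
    have hwt : w = r⁻¹ • t := by rw [hr', smul_smul, inv_mul_cancel₀ hr0, one_smul]
    have hwN : w ∈ N := by rw [hwt]; exact N.smul_mem _ htN
    have hwc : ∀ b, dpart b w = 0 := fun b => by rw [hwt, map_smul, hc, smul_zero]
    have hgw : ∀ g, tmul g w ∈ N := by
      intro g
      have h : (2 : ℂ) • tmul g (fib z z w - fib z z (fib z z w)) ∈ N := by
        rw [← second_difference g z hwc]
        exact add_mem (sub_mem (N.lie_mem (N.lie_mem hwN))
          (N.smul_mem _ (N.lie_mem (N.lie_mem hwN)))) (N.lie_mem (N.lie_mem hwN))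
      rw [hw2, map_smul, hw2] at h
      -- The weight of w is 2, so the factor is 2 · (2 − 4) = −4.
      have e : tmul g w = (-1 / 4 : ℂ) • ((2 : ℂ) • tmul g ((2 : ℂ) • w - (2 : ℂ) • (2 : ℂ) • w)) := by
        rw [map_sub, map_smul, map_smul, map_smul]; module
      rw [e]
      exact N.smul_mem _ h
    -- The tensors all of whose function multiples lie in N. Such an s need not be constant: in the
    -- action of x_k ∂_a on g s, the terms with a derivative already lie in N, and g E_ka s is what
    -- remains.
    let K : Submodule ℂ (Tensor n ι) :=
      { carrier := {s | ∀ g, tmul g s ∈ N}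
        add_mem' := fun {a b} ha hb g => by rw [map_add]; exact add_mem (ha g) (hb g)
        zero_mem' := fun g => by rw [map_zero]; exact N.zero_mem
        smul_mem' := fun c s hs g => by rw [map_smul]; exact N.smul_mem c (hs g) }
    have hK : ∀ k a, ∀ s ∈ K, fib k a s ∈ K := by
      intro k a s hs g
      have h1 : ∀ f g, tmul f (tmul g (dpart a s)) ∈ N := by
        intro f g
        have h := N.lie_mem (x := vf 1 a) (hs (f * g))
        rw [lie_vf_one, dpart_tmul] at h
        have e : tmul f (tmul g (dpart a s)) = tmul (f * g) (dpart a s) := by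
          ext1 m; simp [mul_assoc]
        rw [e]
        exact (add_mem_cancel_left (hs _)).1 h
      have h2 := N.lie_mem (x := vf (MvPolynomial.X k) a) (hs g)
      rw [lie_vf_X, dpart_tmul, map_add, fib_tmul] at h2
      have e : tmul (MvPolynomial.X k) (tmul (MvPolynomial.pderiv a g) s) =
          tmul (MvPolynomial.X k * MvPolynomial.pderiv a g) s := by
        ext1 m; simp [mul_assoc]
      rw [e] at h2
      exact (add_mem_cancel_left (add_mem (hs _) (h1 _ _))).1 h2
    intro s hs
    have hs' : s ∈ LinearMap.range c := by rw [← hF]; exact hs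
    obtain ⟨u, rfl⟩ := hs'
    have hu : u = ∑ m, tmul (u m) (basisTensor m) := by
      classical
      have hsum : ∀ (s : Finset (ι → Fin n)) (F : (ι → Fin n) → Tensor n ι) (m),
          (∑ k ∈ s, F k) m = ∑ k ∈ s, F k m := by
        intro s F m
        induction s using Finset.induction_on with
        | empty => simp
        | insert a s ha ih => rw [Finset.sum_insert ha, Finset.sum_insert ha, Tensor.add_apply, ih]
      ext1 m
      rw [hsum, Finset.sum_eq_single m]
      · simp [basisTensor]
      · intro m' _ hm'; simp [basisTensor, hm'.symm]
      · simp
    rw [hu, map_sum]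
    refine sum_mem fun m _ => ?_
    rw [hct]
    exact hspan K hK hgw m _
  have : Nontrivial F := ⟨⟨⟨w, hwF⟩, 0, fun h => hw0 (congrArg Subtype.val h)⟩⟩
  refine LieModule.IsIrreducible.mk fun N hN => ?_
  have hmap := main (N.map F.incl) (LieSubmodule.map_incl_le) (by
    intro h
    refine hN ((LieSubmodule.eq_bot_iff N).2 fun x hx => Subtype.ext ?_)
    exact (LieSubmodule.eq_bot_iff _).1 h _ (LieSubmodule.mem_map_of_mem hx))
  rw [eq_top_iff]
  rintro ⟨x, hx⟩ -
  obtain ⟨y, hy, hxy⟩ := (LieSubmodule.mem_map x).1 (hmap hx)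
  have : y = ⟨x, hx⟩ := Subtype.ext hxy
  rwa [← this]

end TensorOperators

/-! ### Compatibility of the Young symmetrizer with gl_n and with functions. -/

section YoungGeneral

variable {n : ℕ}

theorem fib_permTensor {ι : Type} [Fintype ι] [DecidableEq ι] (σ : Equiv.Perm ι) (k a : Fin n)
    (t : Tensor n ι) : fib k a (permTensor σ t) = permTensor σ (fib k a t) := by
  ext1 m
  have h : ∀ p j, Function.update m (σ p) j ∘ σ = Function.update (m ∘ σ) p j := by
    intro p j
    rw [Function.update_comp_equiv, Equiv.symm_apply_apply]
  simp only [fib_apply, permTensor_apply]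
  rw [← Equiv.sum_comp σ]
  simp only [h, Function.comp_apply]

theorem fib_youngSymmetrizer (μ : YoungDiagram) (k a : Fin n) (t : Tensor n μ.cells) :
    fib k a (youngSymmetrizer n μ t) = youngSymmetrizer n μ (fib k a t) := by
  simp only [youngSymmetrizer, LinearMap.comp_apply, LinearMap.sum_apply, LinearMap.smul_apply,
    map_sum, map_zsmul, fib_permTensor]

theorem tmul_youngSymmetrizer (μ : YoungDiagram) (g : Poly n) (t : Tensor n μ.cells) :
    youngSymmetrizer n μ (tmul g t) = tmul g (youngSymmetrizer n μ t) := by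
  have h : ∀ σ : Equiv.Perm μ.cells, ∀ t : Tensor n μ.cells,
      tmul g (permTensor σ t) = permTensor σ (tmul g t) := fun σ t => rfl
  simp only [youngSymmetrizer, LinearMap.comp_apply, LinearMap.sum_apply, LinearMap.smul_apply,
    map_sum, map_zsmul, h]

theorem fib_basisTensor {ι : Type} [Fintype ι] [DecidableEq ι] (k a : Fin n) (m : ι → Fin n) :
    fib k a (basisTensor m) =
      ∑ p, if m p = a then basisTensor (Function.update m p k) else (0 : Tensor n ι) := by
  classical
  have hsum : ∀ (s : Finset ι) (F : ι → Tensor n ι) (m), (∑ k ∈ s, F k) m = ∑ k ∈ s, F k m := by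
    intro s F m
    induction s using Finset.induction_on with
    | empty => simp
    | insert a s ha ih => rw [Finset.sum_insert ha, Finset.sum_insert ha, Tensor.add_apply, ih]
  ext1 m'
  rw [fib_apply, hsum]
  refine Finset.sum_congr rfl fun p _ => ?_
  have hiff : (m' p = k ∧ Function.update m' p a = m) ↔
      (m p = a ∧ m' = Function.update m p k) := by
    constructor
    · rintro ⟨rfl, rfl⟩; simp
    · rintro ⟨rfl, rfl⟩; simp
  have e1 : (if m' p = k then basisTensor m (Function.update m' p a) else 0 : Poly n) =
      if m' p = k ∧ Function.update m' p a = m then 1 else 0 := by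
    rw [ite_and]; rfl
  have e2 : (if m p = a then basisTensor (Function.update m p k) else (0 : Tensor n ι)) m' =
      if m p = a ∧ m' = Function.update m p k then 1 else 0 := by
    rw [ite_and]; split_ifs <;> simp_all [basisTensor]
  rw [e1, e2]
  simp only [hiff]

theorem eq_C_of_pderiv_eq_zero {f : Poly n} (h : ∀ a, MvPolynomial.pderiv a f = 0) :
    f = MvPolynomial.C (f.coeff 0) := by
  ext s
  rw [MvPolynomial.coeff_C]
  split_ifs with hs
  · rw [← hs]
  · obtain ⟨i, hi⟩ : ∃ i, s i ≠ 0 := by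
      by_contra! hc
      exact hs (Finsupp.ext fun i => by simp [hc i])
    have h1 := congrArg (MvPolynomial.coeff (s - Finsupp.single i 1)) (h i)
    have h2 : s - Finsupp.single i 1 + Finsupp.single i 1 = s :=
      tsub_add_cancel_of_le (Finsupp.single_le_iff.2 (Nat.one_le_iff_ne_zero.2 hi))
    rw [MvPolynomial.coeff_pderiv, h2, MvPolynomial.coeff_zero] at h1
    exact (mul_eq_zero.1 h1).resolve_right (Nat.cast_add_one_ne_zero _)

theorem eq_zero_of_three_mul {f : Poly n} (h : 3 * f = 0) : f = 0 := by
  have h' : (3 : ℂ) • f = 0 := by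
    rw [MvPolynomial.smul_eq_C_mul, map_ofNat]; exact h
  exact (smul_eq_zero.1 h').resolve_left three_ne_zero

theorem eq_zero_of_two_mul {f : Poly n} (h : 2 * f = 0) : f = 0 := by
  have h' : (2 : ℂ) • f = 0 := by
    rw [MvPolynomial.smul_eq_C_mul, map_ofNat]; exact h
  exact (smul_eq_zero.1 h').resolve_left two_ne_zero

end YoungGeneral

/-! ### Tensor fields of type `(2, 1)` -/

namespace TwoOne

variable {n : ℕ}

def p00 : diagram21.cells := ⟨(0, 0), by decide⟩
def p01 : diagram21.cells := ⟨(0, 1), by decide⟩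
def p10 : diagram21.cells := ⟨(1, 0), by decide⟩

theorem cells_cases : ∀ p : diagram21.cells, p = p00 ∨ p = p01 ∨ p = p10 := by decide

theorem univ_eq : (Finset.univ : Finset diagram21.cells) = {p00, p01, p10} := by decide

/-- The index function with the given values at the cells. -/
def idx (a b c : Fin n) : diagram21.cells → Fin n := fun p =>
  if p = p00 then a else if p = p01 then b else c

@[simp] theorem idx_p00 (a b c : Fin n) : idx a b c p00 = a := rfl
@[simp] theorem idx_p01 (a b c : Fin n) : idx a b c p01 = b := rfl
@[simp] theorem idx_p10 (a b c : Fin n) : idx a b c p10 = c := rfl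

theorem funext_cells {m m' : diagram21.cells → Fin n} (h0 : m p00 = m' p00) (h1 : m p01 = m' p01)
    (h2 : m p10 = m' p10) : m = m' := by
  funext p
  rcases cells_cases p with rfl | rfl | rfl <;> assumption

theorem eq_idx (m : diagram21.cells → Fin n) : m = idx (m p00) (m p01) (m p10) :=
  funext_cells rfl rfl rfl

theorem sum_cells {β : Type*} [AddCommMonoid β] (F : diagram21.cells → β) :
    ∑ p, F p = F p00 + F p01 + F p10 := by
  rw [univ_eq, Finset.sum_insert (by decide), Finset.sum_insert (by decide), Finset.sum_singleton,
    add_assoc]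

@[simp] theorem update_p00 (a b c j : Fin n) :
    Function.update (idx a b c) p00 j = idx j b c := funext_cells rfl rfl rfl
@[simp] theorem update_p01 (a b c j : Fin n) :
    Function.update (idx a b c) p01 j = idx a j c := funext_cells rfl rfl rfl
@[simp] theorem update_p10 (a b c j : Fin n) :
    Function.update (idx a b c) p10 j = idx a b j := funext_cells rfl rfl rfl

theorem tensor_ext {s t : Tensor n diagram21.cells} (h : ∀ a b c, s (idx a b c) = t (idx a b c)) :
    s = t :=
  Tensor.ext fun m => by rw [eq_idx m]; exact h _ _ _

theorem idx_swap_row (a b c : Fin n) : idx a b c ∘ Equiv.swap p00 p01 = idx b a c :=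
  funext_cells rfl rfl rfl

theorem idx_swap_col (a b c : Fin n) : idx a b c ∘ Equiv.swap p00 p10 = idx c b a :=
  funext_cells rfl rfl rfl

theorem rows_eq : (Finset.univ.filter fun σ : Equiv.Perm diagram21.cells =>
    ∀ c, (σ c).1.1 = c.1.1) = {1, Equiv.swap p00 p01} := by decide

theorem cols_eq : (Finset.univ.filter fun σ : Equiv.Perm diagram21.cells =>
    ∀ c, (σ c).1.2 = c.1.2) = {1, Equiv.swap p00 p10} := by decide

theorem youngSymmetrizer_apply (t : Tensor n diagram21.cells) (a b c : Fin n) :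
    youngSymmetrizer n diagram21 t (idx a b c) =
      t (idx a b c) + t (idx b a c) - (t (idx c b a) + t (idx b c a)) := by
  have hs : Equiv.Perm.sign (Equiv.swap p00 p10) = -1 := Equiv.Perm.sign_swap (by decide)
  rw [youngSymmetrizer, rows_eq, cols_eq, Finset.sum_insert (by decide), Finset.sum_singleton,
    Finset.sum_insert (by decide), Finset.sum_singleton, hs]
  simp only [LinearMap.comp_apply, LinearMap.add_apply, LinearMap.sub_apply, Equiv.Perm.sign_one,
    Units.val_one, Units.val_neg, neg_smul, one_smul, ← sub_eq_add_neg, Tensor.sub_apply,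
    Tensor.add_apply, permTensor_apply, idx_swap_row, idx_swap_col, Equiv.Perm.coe_one,
    Function.comp_id]

theorem fib_idx (k x : Fin n) (t : Tensor n diagram21.cells) (a b c : Fin n) :
    fib k x t (idx a b c) = (if a = k then t (idx x b c) else 0)
      + (if b = k then t (idx a x c) else 0) + (if c = k then t (idx a b x) else 0) := by
  rw [fib_apply, sum_cells]
  simp

/-- The Young symmetrizer applied to a basis tensor. -/
def sym (a b c : Fin n) : Tensor n diagram21.cells :=
  youngSymmetrizer n diagram21 (basisTensor (idx a b c))

theorem idx_inj (a b c a' b' c' : Fin n) :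
    idx a b c = idx a' b' c' ↔ a = a' ∧ b = b' ∧ c = c' := by
  constructor
  · intro h
    exact ⟨congrFun h p00, congrFun h p01, congrFun h p10⟩
  · rintro ⟨rfl, rfl, rfl⟩; rfl

theorem basisTensor_idx (a b c a' b' c' : Fin n) : basisTensor (idx a b c) (idx a' b' c') =
    if a' = a ∧ b' = b ∧ c' = c then 1 else 0 := by
  simp only [basisTensor, idx_inj]

theorem sym_swap (a b c : Fin n) : sym b a c = sym a b c := by
  refine tensor_ext fun a' b' c' => ?_
  have h : ∀ p q r, basisTensor (idx b a c) (idx p q r) = basisTensor (idx a b c) (idx q p r) := by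
    intro p q r
    simp only [basisTensor_idx, and_left_comm]
  simp only [sym, youngSymmetrizer_apply, h]
  ring

theorem fib_sym (k x a b c : Fin n) : fib k x (sym a b c) = (if a = x then sym k b c else 0)
      + (if b = x then sym a k c else 0) + (if c = x then sym a b k else 0) := by
  rw [sym, fib_youngSymmetrizer, fib_basisTensor, sum_cells]
  simp only [map_add, idx_p00, idx_p01, idx_p10, update_p00, update_p01, update_p10,
    apply_ite (youngSymmetrizer n diagram21), map_zero]
  rfl

/-- Elementary matrices replace first o and then the two z's by arbitrary indices. Replacing one of
two z's in the row acts on both positions and yields a factor 2 by row symmetry. Extra terms, when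
another index equals z, are already known to lie in K. -/
theorem basis_mem (z o : Fin n) (hzo : z ≠ o) (K : Submodule ℂ (Tensor n diagram21.cells))
    (hK : ∀ k a, ∀ t ∈ K, fib k a t ∈ K) (hw : sym z z o ∈ K) (a b c : Fin n) : sym a b c ∈ K := by
  have hite : ∀ (P : Prop) [Decidable P] (s : Tensor n diagram21.cells), s ∈ K →
      (if P then s else 0) ∈ K := by
    intro P _ s hs; split_ifs
    · exact hs
    · exact K.zero_mem
  have h1 : ∀ c, sym z z c ∈ K := by
    intro c
    have h := hK c o _ hw
    rwa [fib_sym, if_neg hzo, if_neg hzo, if_pos rfl, zero_add, zero_add] at h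
  have h2 : ∀ b c, sym z b c ∈ K := by
    intro b c
    have h := hK b z _ (h1 c)
    rw [fib_sym, if_pos rfl, if_pos rfl, sym_swap z b] at h
    have h' := (add_mem_cancel_right (hite (c = z) _ (h1 b))).1 h
    rw [← two_smul ℂ] at h'
    exact (Submodule.smul_mem_iff K two_ne_zero).1 h'
  have h := hK a z _ (h2 b c)
  rw [fib_sym, if_pos rfl] at h
  exact (add_mem_cancel_right (hite (b = z) _ (h2 a c))).1
    ((add_mem_cancel_right (hite (c = z) _ (h2 b a))).1 h)

theorem skew {t : Tensor n diagram21.cells} (ht : t ∈ TensorField n diagram21) (a b c : Fin n) :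
    t (idx c b a) = -t (idx a b c) := by
  obtain ⟨u, rfl⟩ := ht
  simp only [youngSymmetrizer_apply]; ring

theorem jacobi {t : Tensor n diagram21.cells} (ht : t ∈ TensorField n diagram21) (a b c : Fin n) :
    t (idx a b c) + t (idx b c a) + t (idx c a b) = 0 := by
  obtain ⟨u, rfl⟩ := ht
  simp only [youngSymmetrizer_apply]; ring

theorem apply_diag {t : Tensor n diagram21.cells} (ht : t ∈ TensorField n diagram21)
    (a b : Fin n) : t (idx a b a) = 0 := by
  obtain ⟨u, rfl⟩ := ht
  simp only [youngSymmetrizer_apply]; ring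

theorem eq_zero_of_support {z o : Fin n} (s : Tensor n diagram21.cells)
    (hs : s ∈ TensorField n diagram21)
    (hsup : ∀ a b c, ¬ ((a = z ∨ a = o) ∧ (b = z) ∧ (c = z ∨ c = o)) → s (idx a b c) = 0)
    (h0 : s (idx z z o) = 0) : s = 0 := by
  refine tensor_ext fun a b c => ?_
  by_cases h : (a = z ∨ a = o) ∧ (b = z) ∧ (c = z ∨ c = o)
  · obtain ⟨rfl | rfl, rfl, rfl | rfl⟩ := h
    · exact apply_diag hs _ _
    · exact h0
    · rw [skew hs, h0, neg_zero]; rfl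
    · exact apply_diag hs _ _
  · exact hsup a b c h

theorem support_of_raised {z o : Fin n} (hzo : z < o) (hz : ∀ i, i ≠ z → z < i)
    (ho : ∀ i, i ≠ z → i ≠ o → o < i)
    {t : Tensor n diagram21.cells} (ht : t ∈ TensorField n diagram21)
    (hr : ∀ i j : Fin n, i < j → fib i j t = 0) (a b c : Fin n)
    (h : ¬ ((a = z ∨ a = o) ∧ (b = z) ∧ (c = z ∨ c = o))) : t (idx a b c) = 0 := by
  have E : ∀ i j, i < j → ∀ a b c, (if a = i then t (idx j b c) else 0)
      + (if b = i then t (idx a j c) else 0) + (if c = i then t (idx a b j) else 0) = 0 := by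
    intro i j hij a b c
    rw [← fib_idx, hr i j hij]; rfl
  have one : ∀ b c, b ≠ z → c ≠ z → t (idx z b c) = 0 := by
    intro b c hb hc
    have key : ∀ b c, b ≠ z → c ≠ z → t (idx b z c) + t (idx z b c) = 0 := by
      intro b c hb hc
      have := E z b (hz b hb) z z c
      simpa [hc] using this
    have rel : ∀ b c, b ≠ z → c ≠ z → t (idx z b c) = 2 * t (idx z c b) := by
      intro b c hb hc
      have k2 := key c b hc hb
      have j := jacobi ht z b c
      rw [skew ht z c b] at j
      linear_combination j - k2
    have h3 : (3 : Poly n) * t (idx z b c) = 0 := by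
      linear_combination -rel b c hb hc - 2 * rel c b hc hb
    exact eq_zero_of_three_mul h3
  have none : ∀ a b c, a ≠ z → b ≠ z → c ≠ z → t (idx a b c) = 0 := by
    intro a b c ha hb hc
    have := E z a (hz a ha) z b c
    simpa [hb, hc] using this
  have mid : ∀ a c, a ≠ z → c ≠ z → t (idx a z c) = 0 := by
    intro a c ha hc
    have := E z a (hz a ha) z z c
    simpa [hc, one a c ha hc] using this
  have two : ∀ c, c ≠ z → c ≠ o → t (idx z z c) = 0 := by
    intro c hc hco
    have := E o c (ho c hc hco) z z o
    simpa [hzo.ne] using this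
  by_cases ha : a = z
  · subst ha
    by_cases hc : c = a
    · subst hc; exact apply_diag ht _ _
    by_cases hb : b = a
    · subst hb
      exact two c hc (by tauto)
    · exact one b c hb hc
  · by_cases hc : c = z
    · subst hc
      rw [skew ht, neg_eq_zero]
      by_cases hb : b = c
      · subst hb
        exact two a ha (by tauto)
      · exact one b a hb ha
    · by_cases hb : b = z
      · subst hb; exact mid a c ha hc
      · exact none a b c ha hb hc

theorem irreducible (hn : 2 ≤ n) : LieModule.IsIrreducible ℂ (W n) (TensorField n diagram21) := by
  let z : Fin n := ⟨0, by omega⟩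
  let o : Fin n := ⟨1, by omega⟩
  have hzo : z < o := Nat.zero_lt_one
  have hne : z ≠ o := hzo.ne
  have hz : ∀ i, i ≠ z → z < i := fun i hi =>
    Nat.pos_of_ne_zero fun h => hi (Fin.ext h)
  have ho : ∀ i, i ≠ z → i ≠ o → o < i := by
    intro i hi hi'
    have h0 : (i : ℕ) ≠ 0 := fun h => hi (Fin.ext h)
    have h1 : (i : ℕ) ≠ 1 := fun h => hi' (Fin.ext h)
    change 1 < (i : ℕ)
    omega
  have hwF : sym z z o ∈ TensorField n diagram21 := ⟨_, rfl⟩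
  -- Both row permutations fix (z, z, o), and the column exchange contributes nothing.
  have hval : sym z z o (idx z z o) = 2 := by
    simp only [sym, youngSymmetrizer_apply, basisTensor_idx]
    simp [hne, hne.symm]; norm_num
  have hwsup : ∀ a b c, ¬ ((a = z ∨ a = o) ∧ (b = z) ∧ (c = z ∨ c = o)) →
      sym z z o (idx a b c) = 0 := by
    intro a b c h
    simp only [sym, youngSymmetrizer_apply, basisTensor_idx]
    rw [if_neg (by tauto), if_neg (by tauto), if_neg (by tauto), if_neg (by tauto)]
    simp
  refine irreducible_of_highest (TensorField n diagram21) (youngSymmetrizer n diagram21) rfl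
    (tmul_youngSymmetrizer _) (sym z z o) ?_ z hwF ?_ ?_ ?_
  · intro h
    rw [h] at hval
    simp at hval
  · rw [fib_sym, if_pos rfl, if_neg hne.symm, add_zero, two_smul]
  · intro t ht hc hr
    have hC := eq_C_of_pderiv_eq_zero (f := t (idx z z o)) fun a => by
      have := congrArg (fun s : Tensor n diagram21.cells => s (idx z z o)) (hc a)
      exact this
    refine ⟨(t (idx z z o)).coeff 0 / 2, sub_eq_zero.1 ?_⟩
    refine eq_zero_of_support (z := z) (o := o) _ (sub_mem ht (Submodule.smul_mem _ _ hwF))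
      (fun a b c h => ?_) ?_
    · rw [Tensor.sub_apply, Tensor.smul_apply, hwsup a b c h, smul_zero, sub_zero]
      exact support_of_raised hzo hz ho ht hr a b c h
    · rw [Tensor.sub_apply, Tensor.smul_apply, hval, sub_eq_zero]
      conv_lhs => rw [hC]
      rw [MvPolynomial.smul_eq_C_mul, ← map_ofNat (MvPolynomial.C : ℂ →+* Poly n) 2,
        ← MvPolynomial.C_mul, div_mul_cancel₀ _ two_ne_zero]
  · intro K hK hw m
    rw [eq_idx m]
    exact basis_mem z o hne K hK hw _ _ _

end TwoOne

/-! ### Tensor fields of type `(2, 2)` -/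

namespace TwoTwo

variable {n : ℕ}

def p00 : diagram22.cells := ⟨(0, 0), by decide⟩
def p01 : diagram22.cells := ⟨(0, 1), by decide⟩
def p10 : diagram22.cells := ⟨(1, 0), by decide⟩
def p11 : diagram22.cells := ⟨(1, 1), by decide⟩

theorem cells_cases : ∀ p : diagram22.cells, p = p00 ∨ p = p01 ∨ p = p10 ∨ p = p11 := by decide

theorem univ_eq : (Finset.univ : Finset diagram22.cells) = {p00, p01, p10, p11} := by decide

/-- The index function with the given values at the cells. -/
def idx (a b c d : Fin n) : diagram22.cells → Fin n := fun p =>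
  if p = p00 then a else if p = p01 then b else if p = p10 then c else d

@[simp] theorem idx_p00 (a b c d : Fin n) : idx a b c d p00 = a := rfl
@[simp] theorem idx_p01 (a b c d : Fin n) : idx a b c d p01 = b := rfl
@[simp] theorem idx_p10 (a b c d : Fin n) : idx a b c d p10 = c := rfl
@[simp] theorem idx_p11 (a b c d : Fin n) : idx a b c d p11 = d := rfl

theorem funext_cells {m m' : diagram22.cells → Fin n} (h0 : m p00 = m' p00) (h1 : m p01 = m' p01)
    (h2 : m p10 = m' p10) (h3 : m p11 = m' p11) : m = m' := by
  funext p
  rcases cells_cases p with rfl | rfl | rfl | rfl <;> assumption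

theorem eq_idx (m : diagram22.cells → Fin n) : m = idx (m p00) (m p01) (m p10) (m p11) :=
  funext_cells rfl rfl rfl rfl

theorem sum_cells {β : Type*} [AddCommMonoid β] (F : diagram22.cells → β) :
    ∑ p, F p = F p00 + F p01 + F p10 + F p11 := by
  rw [univ_eq, Finset.sum_insert (by decide), Finset.sum_insert (by decide),
    Finset.sum_insert (by decide), Finset.sum_singleton]
  simp only [add_assoc]

@[simp] theorem update_p00 (a b c d j : Fin n) :
    Function.update (idx a b c d) p00 j = idx j b c d := funext_cells rfl rfl rfl rfl
@[simp] theorem update_p01 (a b c d j : Fin n) :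
    Function.update (idx a b c d) p01 j = idx a j c d := funext_cells rfl rfl rfl rfl
@[simp] theorem update_p10 (a b c d j : Fin n) :
    Function.update (idx a b c d) p10 j = idx a b j d := funext_cells rfl rfl rfl rfl
@[simp] theorem update_p11 (a b c d j : Fin n) :
    Function.update (idx a b c d) p11 j = idx a b c j := funext_cells rfl rfl rfl rfl

theorem tensor_ext {s t : Tensor n diagram22.cells}
    (h : ∀ a b c d, s (idx a b c d) = t (idx a b c d)) : s = t :=
  Tensor.ext fun m => by rw [eq_idx m]; exact h _ _ _ _

theorem idx_swap_row0 (a b c d : Fin n) : idx a b c d ∘ Equiv.swap p00 p01 = idx b a c d :=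
  funext_cells rfl rfl rfl rfl

theorem idx_swap_row1 (a b c d : Fin n) : idx a b c d ∘ Equiv.swap p10 p11 = idx a b d c :=
  funext_cells rfl rfl rfl rfl

theorem idx_swap_rows (a b c d : Fin n) :
    idx a b c d ∘ (Equiv.swap p00 p01 * Equiv.swap p10 p11 : Equiv.Perm diagram22.cells) =
      idx b a d c :=
  funext_cells rfl rfl rfl rfl

theorem idx_swap_col0 (a b c d : Fin n) : idx a b c d ∘ Equiv.swap p00 p10 = idx c b a d :=
  funext_cells rfl rfl rfl rfl

theorem idx_swap_col1 (a b c d : Fin n) : idx a b c d ∘ Equiv.swap p01 p11 = idx a d c b :=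
  funext_cells rfl rfl rfl rfl

theorem idx_swap_cols (a b c d : Fin n) :
    idx a b c d ∘ (Equiv.swap p00 p10 * Equiv.swap p01 p11 : Equiv.Perm diagram22.cells) =
      idx c d a b :=
  funext_cells rfl rfl rfl rfl

set_option maxRecDepth 100000 in
theorem rows_eq : (Finset.univ.filter fun σ : Equiv.Perm diagram22.cells =>
    ∀ c, (σ c).1.1 = c.1.1) =
      {1, Equiv.swap p00 p01, Equiv.swap p10 p11, Equiv.swap p00 p01 * Equiv.swap p10 p11} := by
  decide

set_option maxRecDepth 100000 in
theorem cols_eq : (Finset.univ.filter fun σ : Equiv.Perm diagram22.cells =>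
    ∀ c, (σ c).1.2 = c.1.2) =
      {1, Equiv.swap p00 p10, Equiv.swap p01 p11, Equiv.swap p00 p10 * Equiv.swap p01 p11} := by
  decide

theorem youngSymmetrizer_apply (t : Tensor n diagram22.cells) (a b c d : Fin n) :
    youngSymmetrizer n diagram22 t (idx a b c d) =
      (t (idx a b c d) + t (idx b a c d) + t (idx a b d c) + t (idx b a d c))
      - (t (idx c b a d) + t (idx b c a d) + t (idx c b d a) + t (idx b c d a))
      - (t (idx a d c b) + t (idx d a c b) + t (idx a d b c) + t (idx d a b c))
      + (t (idx c d a b) + t (idx d c a b) + t (idx c d b a) + t (idx d c b a)) := by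
  have h0 : Equiv.Perm.sign (Equiv.swap p00 p10) = -1 := Equiv.Perm.sign_swap (by decide)
  have h1 : Equiv.Perm.sign (Equiv.swap p01 p11) = -1 := Equiv.Perm.sign_swap (by decide)
  have hneg : ∀ (s : Tensor n diagram22.cells) m, (-s) m = -s m := fun _ _ => rfl
  rw [youngSymmetrizer, rows_eq, cols_eq, Finset.sum_insert (by decide),
    Finset.sum_insert (by decide), Finset.sum_insert (by decide), Finset.sum_singleton,
    Finset.sum_insert (by decide), Finset.sum_insert (by decide), Finset.sum_insert (by decide),
    Finset.sum_singleton, Equiv.Perm.sign_mul, h0, h1]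
  simp only [LinearMap.comp_apply, LinearMap.add_apply, LinearMap.neg_apply, Equiv.Perm.sign_one,
    Units.val_one, Units.val_neg, neg_smul, one_smul, hneg, mul_neg, mul_one, neg_neg, Tensor.add_apply, permTensor_apply, idx_swap_row0, idx_swap_row1, idx_swap_rows,
    idx_swap_col0, idx_swap_col1, idx_swap_cols, Equiv.Perm.coe_one, Function.comp_id]
  ring

theorem fib_idx (k x : Fin n) (t : Tensor n diagram22.cells) (a b c d : Fin n) :
    fib k x t (idx a b c d) = (if a = k then t (idx x b c d) else 0)
      + (if b = k then t (idx a x c d) else 0) + (if c = k then t (idx a b x d) else 0)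
      + (if d = k then t (idx a b c x) else 0) := by
  rw [fib_apply, sum_cells]
  simp

/-- The Young symmetrizer applied to a basis tensor. -/
def sym (a b c d : Fin n) : Tensor n diagram22.cells :=
  youngSymmetrizer n diagram22 (basisTensor (idx a b c d))

theorem idx_inj (a b c d a' b' c' d' : Fin n) :
    idx a b c d = idx a' b' c' d' ↔ a = a' ∧ b = b' ∧ c = c' ∧ d = d' := by
  constructor
  · intro h
    exact ⟨congrFun h p00, congrFun h p01, congrFun h p10, congrFun h p11⟩
  · rintro ⟨rfl, rfl, rfl, rfl⟩; rfl

theorem basisTensor_idx (a b c d a' b' c' d' : Fin n) :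
    basisTensor (idx a b c d) (idx a' b' c' d') =
      if a' = a ∧ b' = b ∧ c' = c ∧ d' = d then 1 else 0 := by
  simp only [basisTensor, idx_inj]

theorem sym_swap_row0 (a b c d : Fin n) : sym b a c d = sym a b c d := by
  refine tensor_ext fun a' b' c' d' => ?_
  have h : ∀ p q r s, basisTensor (idx b a c d) (idx p q r s) =
      basisTensor (idx a b c d) (idx q p r s) := by
    intro p q r s
    simp only [basisTensor_idx, and_left_comm]
  simp only [sym, youngSymmetrizer_apply, h]
  ring

theorem sym_swap_row1 (a b c d : Fin n) : sym a b d c = sym a b c d := by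
  refine tensor_ext fun a' b' c' d' => ?_
  have h : ∀ p q r s, basisTensor (idx a b d c) (idx p q r s) =
      basisTensor (idx a b c d) (idx p q s r) := by
    intro p q r s
    simp only [basisTensor_idx, and_comm (a := r = d)]
  simp only [sym, youngSymmetrizer_apply, h]
  ring

theorem fib_sym (k x a b c d : Fin n) : fib k x (sym a b c d) =
      (if a = x then sym k b c d else 0) + (if b = x then sym a k c d else 0)
      + (if c = x then sym a b k d else 0) + (if d = x then sym a b c k else 0) := by
  rw [sym, fib_youngSymmetrizer, fib_basisTensor, sum_cells]
  simp only [map_add, idx_p00, idx_p01, idx_p10, idx_p11, update_p00, update_p01, update_p10,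
    update_p11, apply_ite (youngSymmetrizer n diagram22), map_zero]
  rfl

/-- As for (2, 1), but the second row also has equal entries, so replacing o costs a factor 2 as
well. -/
theorem basis_mem (z o : Fin n) (hzo : z ≠ o) (K : Submodule ℂ (Tensor n diagram22.cells))
    (hK : ∀ k a, ∀ t ∈ K, fib k a t ∈ K) (hw : sym z z o o ∈ K) (a b c d : Fin n) :
    sym a b c d ∈ K := by
  have hite : ∀ (P : Prop) [Decidable P] (s : Tensor n diagram22.cells), s ∈ K →
      (if P then s else 0) ∈ K := by
    intro P _ s hs; split_ifs
    · exact hs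
    · exact K.zero_mem
  have h0 : ∀ d, sym z z o d ∈ K := by
    intro d
    have h := hK d o _ hw
    rw [fib_sym, if_neg hzo, if_neg hzo, if_pos rfl, if_pos rfl, zero_add, zero_add,
      sym_swap_row1 z z o d, ← two_smul ℂ] at h
    exact (Submodule.smul_mem_iff K two_ne_zero).1 h
  have h1 : ∀ c d, sym z z c d ∈ K := by
    intro c d
    have h := hK c o _ (h0 d)
    rw [fib_sym, if_neg hzo, if_neg hzo, if_pos rfl, zero_add, zero_add] at h
    exact (add_mem_cancel_right (hite (d = o) _ (h0 c))).1 h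
  have h2 : ∀ b c d, sym z b c d ∈ K := by
    intro b c d
    have h := hK b z _ (h1 c d)
    rw [fib_sym, if_pos rfl, if_pos rfl, sym_swap_row0 z b] at h
    have h' := (add_mem_cancel_right (hite (c = z) _ (h1 b d))).1
      ((add_mem_cancel_right (hite (d = z) _ (h1 c b))).1 h)
    rw [← two_smul ℂ] at h'
    exact (Submodule.smul_mem_iff K two_ne_zero).1 h'
  have h := hK a z _ (h2 b c d)
  rw [fib_sym, if_pos rfl] at h
  exact (add_mem_cancel_right (hite (b = z) _ (h2 a c d))).1
    ((add_mem_cancel_right (hite (c = z) _ (h2 b a d))).1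
      ((add_mem_cancel_right (hite (d = z) _ (h2 b c a))).1 h))

/-- Tensors of type (2, 2) have the symmetries of a curvature tensor with index pairs (a, c) and (b,
d): skew in each column, symmetric under exchange of the columns, and subject to the first Bianchi
identity. -/
theorem skew_col0 {t : Tensor n diagram22.cells} (ht : t ∈ TensorField n diagram22)
    (a b c d : Fin n) : t (idx c b a d) = -t (idx a b c d) := by
  obtain ⟨u, rfl⟩ := ht
  simp only [youngSymmetrizer_apply]; ring

theorem skew_col1 {t : Tensor n diagram22.cells} (ht : t ∈ TensorField n diagram22)
    (a b c d : Fin n) : t (idx a d c b) = -t (idx a b c d) := by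
  obtain ⟨u, rfl⟩ := ht
  simp only [youngSymmetrizer_apply]; ring

theorem pair_symm {t : Tensor n diagram22.cells} (ht : t ∈ TensorField n diagram22)
    (a b c d : Fin n) : t (idx b a d c) = t (idx a b c d) := by
  obtain ⟨u, rfl⟩ := ht
  simp only [youngSymmetrizer_apply]; ring

theorem bianchi {t : Tensor n diagram22.cells} (ht : t ∈ TensorField n diagram22)
    (a b c d : Fin n) : t (idx a b c d) + t (idx b c a d) + t (idx c a b d) = 0 := by
  obtain ⟨u, rfl⟩ := ht
  simp only [youngSymmetrizer_apply]; ring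

theorem apply_diag_col0 {t : Tensor n diagram22.cells} (ht : t ∈ TensorField n diagram22)
    (a b d : Fin n) : t (idx a b a d) = 0 := by
  obtain ⟨u, rfl⟩ := ht
  simp only [youngSymmetrizer_apply]; ring

theorem apply_diag_col1 {t : Tensor n diagram22.cells} (ht : t ∈ TensorField n diagram22)
    (a b c : Fin n) : t (idx a b c b) = 0 := by
  obtain ⟨u, rfl⟩ := ht
  simp only [youngSymmetrizer_apply]; ring

theorem eq_zero_of_support {z o : Fin n} (s : Tensor n diagram22.cells)
    (hs : s ∈ TensorField n diagram22)
    (hsup : ∀ a b c d, ¬ ((a = z ∨ a = o) ∧ (b = z ∨ b = o) ∧ (c = z ∨ c = o) ∧ (d = z ∨ d = o)) →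
      s (idx a b c d) = 0)
    (h0 : s (idx z z o o) = 0) : s = 0 := by
  refine tensor_ext fun a b c d => ?_
  by_cases h : (a = z ∨ a = o) ∧ (b = z ∨ b = o) ∧ (c = z ∨ c = o) ∧ (d = z ∨ d = o)
  · by_cases hac : a = c
    · subst hac; exact apply_diag_col0 hs _ _ _
    by_cases hbd : b = d
    · subst hbd; exact apply_diag_col1 hs _ _ _
    obtain ⟨ha, hb, hc, hd⟩ := h
    have h1 : s (idx z o o z) = 0 := by rw [skew_col1 hs z z o o, h0, neg_zero]
    rcases ha with rfl | rfl
    · obtain rfl : c = o := hc.resolve_left (Ne.symm hac)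
      rcases hb with rfl | rfl
      · obtain rfl : d = c := hd.resolve_left (Ne.symm hbd)
        exact h0
      · obtain rfl : d = a := hd.resolve_right (Ne.symm hbd)
        exact h1
    · obtain rfl : c = z := hc.resolve_right (Ne.symm hac)
      refine (skew_col0 hs c b a d).trans (neg_eq_zero.2 ?_)
      rcases hb with rfl | rfl
      · obtain rfl : d = a := hd.resolve_left (Ne.symm hbd)
        exact h0
      · obtain rfl : d = c := hd.resolve_right (Ne.symm hbd)
        exact h1
  · exact hsup a b c d h

theorem support_of_raised {z o : Fin n} (hzo : z < o) (hz : ∀ i, i ≠ z → z < i)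
    (ho : ∀ i, i ≠ z → i ≠ o → o < i)
    {t : Tensor n diagram22.cells} (ht : t ∈ TensorField n diagram22)
    (hr : ∀ i j : Fin n, i < j → fib i j t = 0) (a b c d : Fin n)
    (h : ¬ ((a = z ∨ a = o) ∧ (b = z ∨ b = o) ∧ (c = z ∨ c = o) ∧ (d = z ∨ d = o))) :
    t (idx a b c d) = 0 := by
  have E : ∀ i j, i < j → ∀ a b c d, (if a = i then t (idx j b c d) else 0)
      + (if b = i then t (idx a j c d) else 0) + (if c = i then t (idx a b j d) else 0)
      + (if d = i then t (idx a b c j) else 0) = 0 := by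
    intro i j hij a b c d
    rw [← fib_idx, hr i j hij]; rfl
  have none : ∀ a b c d, a ≠ z → b ≠ z → c ≠ z → d ≠ z → t (idx a b c d) = 0 := by
    intro a b c d ha hb hc hd
    have := E z a (hz a ha) z b c d
    simpa [hb, hc, hd] using this
  -- The raising equation makes t at (z, b, c, d) skew in c, d; with column skew-symmetry it
  -- alternates in b, c, d, and Bianchi turns into 3 t = 0.
  have one : ∀ b c d, b ≠ z → c ≠ z → d ≠ z → t (idx z b c d) = 0 := by
    have alt : ∀ b c d, b ≠ z → c ≠ z → d ≠ z → t (idx z b d c) = -t (idx z b c d) := by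
      intro b c d hb hc hd
      have key : t (idx b z c d) + t (idx z b c d) = 0 := by
        have := E z b (hz b hb) z z c d
        simpa [hc, hd] using this
      rw [pair_symm ht z b d c] at key
      linear_combination key
    intro b c d hb hc hd
    have j := bianchi ht z b c d
    rw [skew_col0 ht z c b d, pair_symm ht z c d b] at j
    have e1 := skew_col1 ht z c b d
    have e2 := alt d c b hd hc hb
    have e3 := skew_col1 ht z b c d
    have e4 := alt c b d hc hb hd
    have h3 : (3 : Poly n) * t (idx z b c d) = 0 := by
      linear_combination j - e4 + 2 * e1 - 2 * e2 + 2 * e3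
    exact eq_zero_of_three_mul h3
  -- If d = o, the raising equation involves the components (z, z, c, o) and (z, z, o, c), equal by
  -- pair symmetry; hence the division by 2.
  have two' : ∀ c d, c ≠ z → d ≠ z → c ≠ o → t (idx z z c d) = 0 := by
    intro c d hc hd hco
    have := E o c (ho c hc hco) z z o d
    by_cases hdo : d = o
    · subst hdo
      have h2 : t (idx z z c d) + t (idx z z d c) = 0 := by simpa [hzo.ne] using this
      rw [pair_symm ht z z c d, ← two_mul] at h2
      exact eq_zero_of_two_mul h2
    · simpa [hzo.ne, hdo] using this
  have two : ∀ c d, c ≠ z → d ≠ z → ¬ (c = o ∧ d = o) → t (idx z z c d) = 0 := by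
    intro c d hc hd hcd
    by_cases hco : c = o
    · rw [← pair_symm ht]
      exact two' d c hd hc fun hdo => hcd ⟨hco, hdo⟩
    · exact two' c d hc hd hco
  have first : ∀ b c d, c ≠ z → b ≠ d →
      ¬ ((b = z ∨ b = o) ∧ (c = z ∨ c = o) ∧ (d = z ∨ d = o)) → t (idx z b c d) = 0 := by
    intro b c d hc hbd h
    by_cases hb : b = z
    · subst hb
      exact two c d hc (Ne.symm hbd) (by tauto)
    · by_cases hd : d = z
      · subst hd
        rw [skew_col1 ht, neg_eq_zero]
        exact two c b hc hb (by tauto)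
      · exact one b c d hb hc hd
  by_cases hac : a = c
  · subst hac; exact apply_diag_col0 ht _ _ _
  by_cases hbd : b = d
  · subst hbd; exact apply_diag_col1 ht _ _ _
  by_cases ha : a = z
  · subst ha
    exact first b c d (Ne.symm hac) hbd (by tauto)
  by_cases hc : c = z
  · subst hc
    rw [skew_col0 ht, neg_eq_zero]
    exact first b a d ha hbd (by tauto)
  by_cases hb : b = z
  · subst hb
    rw [← pair_symm ht]
    exact one a d c ha (Ne.symm hbd) hc
  by_cases hd : d = z
  · subst hd
    rw [skew_col1 ht, neg_eq_zero, ← pair_symm ht]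
    exact one a b c ha hb hc
  · exact none a b c d ha hb hc hd

theorem irreducible (hn : 2 ≤ n) : LieModule.IsIrreducible ℂ (W n) (TensorField n diagram22) := by
  let z : Fin n := ⟨0, by omega⟩
  let o : Fin n := ⟨1, by omega⟩
  have hzo : z < o := Nat.zero_lt_one
  have hne : z ≠ o := hzo.ne
  have hz : ∀ i, i ≠ z → z < i := fun i hi =>
    Nat.pos_of_ne_zero fun h => hi (Fin.ext h)
  have ho : ∀ i, i ≠ z → i ≠ o → o < i := by
    intro i hi hi'
    have h0 : (i : ℕ) ≠ 0 := fun h => hi (Fin.ext h)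
    have h1 : (i : ℕ) ≠ 1 := fun h => hi' (Fin.ext h)
    change 1 < (i : ℕ)
    omega
  have hwF : sym z z o o ∈ TensorField n diagram22 := ⟨_, rfl⟩
  -- All four row permutations fix (z, z, o, o), and no other term contributes.
  have hval : sym z z o o (idx z z o o) = 4 := by
    simp only [sym, youngSymmetrizer_apply, basisTensor_idx]
    simp [hne, hne.symm]; norm_num
  have hwsup : ∀ a b c d,
      ¬ ((a = z ∨ a = o) ∧ (b = z ∨ b = o) ∧ (c = z ∨ c = o) ∧ (d = z ∨ d = o)) →
      sym z z o o (idx a b c d) = 0 := by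
    intro a b c d h
    have hb : ∀ p q r s, ((p = z ∧ q = z ∧ r = o ∧ s = o) →
        ((a = z ∨ a = o) ∧ (b = z ∨ b = o) ∧ (c = z ∨ c = o) ∧ (d = z ∨ d = o))) →
        (basisTensor (idx z z o o) (idx p q r s) : Poly n) = 0 := by
      intro p q r s hp
      rw [basisTensor_idx, if_neg fun h' => h (hp h')]
    simp only [sym, youngSymmetrizer_apply]
    simp only [hb a b c d (by tauto), hb b a c d (by tauto), hb a b d c (by tauto),
      hb b a d c (by tauto), hb c b a d (by tauto), hb b c a d (by tauto), hb c b d a (by tauto),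
      hb b c d a (by tauto), hb a d c b (by tauto), hb d a c b (by tauto), hb a d b c (by tauto),
      hb d a b c (by tauto), hb c d a b (by tauto), hb d c a b (by tauto), hb c d b a (by tauto),
      hb d c b a (by tauto)]
    ring
  refine irreducible_of_highest (TensorField n diagram22) (youngSymmetrizer n diagram22) rfl
    (tmul_youngSymmetrizer _) (sym z z o o) ?_ z hwF ?_ ?_ ?_
  · intro h
    rw [h] at hval
    simp at hval
  · rw [fib_sym, if_pos rfl, if_neg hne.symm, if_neg hne.symm, add_zero, add_zero, two_smul]
  · intro t ht hc hr
    have hC := eq_C_of_pderiv_eq_zero (f := t (idx z z o o)) fun a => by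
      have := congrArg (fun s : Tensor n diagram22.cells => s (idx z z o o)) (hc a)
      exact this
    refine ⟨(t (idx z z o o)).coeff 0 / 4, sub_eq_zero.1 ?_⟩
    refine eq_zero_of_support (z := z) (o := o) _ (sub_mem ht (Submodule.smul_mem _ _ hwF))
      (fun a b c d h => ?_) ?_
    · rw [Tensor.sub_apply, Tensor.smul_apply, hwsup a b c d h, smul_zero, sub_zero]
      exact support_of_raised hzo hz ho ht hr a b c d h
    · rw [Tensor.sub_apply, Tensor.smul_apply, hval, sub_eq_zero]
      conv_lhs => rw [hC]
      rw [MvPolynomial.smul_eq_C_mul, ← map_ofNat (MvPolynomial.C : ℂ →+* Poly n) 4,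
        ← MvPolynomial.C_mul, div_mul_cancel₀ _ (by norm_num)]
  · intro K hK hw m
    rw [eq_idx m]
    exact basis_mem z o hne K hK hw _ _ _ _

end TwoTwo

/-! ### Contraction of tensor fields with elements of `M 3 / M 4` -/

section Contraction

variable {n : ℕ}

theorem gmul_one (v : Gr (FreeAlg n) 3) : gmul n 1 v = v := by
  rw [← map_one (abl n), ← mulGr_eq_gmul]
  refine emb_injective ?_
  rw [emb_mulGr, map_one, one_mul]

variable {ι : Type} [Fintype ι] [DecidableEq ι]

/-- The contraction `∑ m, t_m B_m` of a tensor field with a system of elements of `M 3 / M 4`. -/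
def contr (B : (ι → Fin n) → Gr (FreeAlg n) 3) : Tensor n ι →ₗ[ℂ] Gr (FreeAlg n) 3 where
  toFun t := ∑ m, gmul n (t m) (B m)
  map_add' s t := by
    simp only [Tensor.add_apply, map_add, LinearMap.add_apply, Finset.sum_add_distrib]
  map_smul' c t := by
    simp only [Tensor.smul_apply, map_smul, LinearMap.smul_apply, Finset.smul_sum, RingHom.id_apply]

theorem contr_apply (B : (ι → Fin n) → Gr (FreeAlg n) 3) (t : Tensor n ι) :
    contr B t = ∑ m, gmul n (t m) (B m) := rfl

theorem contr_tmul (B : (ι → Fin n) → Gr (FreeAlg n) 3) (f : Poly n) (t : Tensor n ι) :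
    contr B (tmul f t) = gmul n f (contr B t) := by
  simp only [contr_apply, tmul_apply, gmul_mul, map_sum]

theorem contr_basisTensor (B : (ι → Fin n) → Gr (FreeAlg n) 3) (m : ι → Fin n) :
    contr B (basisTensor m) = B m := by
  rw [contr_apply, Finset.sum_eq_single m]
  · simp [basisTensor, gmul_one]
  · intro m' _ hm; simp [basisTensor, hm]
  · simp

/-- Exchanging k with the p-th entry of m is an involution. It moves the index substitution in the
Lie derivative from the tensor field to the system it is contracted with. -/
theorem sum_update_comm {β : Type*} [AddCommMonoid β] (p : ι) (G : (ι → Fin n) → Fin n → β) :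
    ∑ m, ∑ k, G m k = ∑ m : ι → Fin n, ∑ k, G (Function.update m p k) (m p) := by
  rw [← Finset.sum_product', ← Finset.sum_product']
  have hinv : Function.Involutive
      fun x : (ι → Fin n) × Fin n => (Function.update x.1 p x.2, x.1 p) := by
    rintro ⟨m, k⟩
    simp
  exact (Equiv.sum_comp hinv.toPerm fun x : (ι → Fin n) × Fin n => G x.1 x.2).symm

/-- Contraction with a system `B` that transforms like `dx_{m p}` in each index is equivariant. -/
theorem lie_contr_sub_mem (N : Submodule ℂ (Gr (FreeAlg n) 3))
    (hN : ∀ f, ∀ v ∈ N, gmul n f v ∈ N) (X : W n) (B : (ι → Fin n) → Gr (FreeAlg n) 3)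
    (hB : ∀ m, ⁅X, B m⁆ - ∑ p, ∑ k, gmul n (MvPolynomial.pderiv k (X (MvPolynomial.X (m p))))
      (B (Function.update m p k)) ∈ N) (t : Tensor n ι) :
    contr B ⁅X, t⁆ - ⁅X, contr B t⁆ ∈ N := by
  have h1 : contr B ⁅X, t⁆ = ∑ m, gmul n (X (t m)) (B m)
      + ∑ p : ι, ∑ m : ι → Fin n, ∑ j, gmul n (t (Function.update m p j))
        (gmul n (MvPolynomial.pderiv (m p) (X (MvPolynomial.X j))) (B m)) := by
    rw [Finset.sum_comm (γ := ι)]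
    simp only [contr_apply, lie_tensor_def, lieTensor_apply, map_add, LinearMap.add_apply,
      Finset.sum_add_distrib, map_sum, LinearMap.sum_apply]
    congr 1
    refine Finset.sum_congr rfl fun m _ => Finset.sum_congr rfl fun p _ =>
      Finset.sum_congr rfl fun j _ => ?_
    rw [mul_comm, gmul_mul]
  have h2 : ⁅X, contr B t⁆ = ∑ m, gmul n (X (t m)) (B m) + ∑ m, gmul n (t m) ⁅X, B m⁆ := by
    rw [contr_apply, lie_sum, ← Finset.sum_add_distrib]
    simp only [lie_gmul]
  have h3 : ∀ p : ι, ∑ m : ι → Fin n, ∑ j, gmul n (t (Function.update m p j))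
        (gmul n (MvPolynomial.pderiv (m p) (X (MvPolynomial.X j))) (B m)) =
      ∑ m : ι → Fin n, ∑ k, gmul n (t m)
        (gmul n (MvPolynomial.pderiv k (X (MvPolynomial.X (m p)))) (B (Function.update m p k))) := by
    intro p
    rw [sum_update_comm p]
    simp
  have h4 : contr B ⁅X, t⁆ - ⁅X, contr B t⁆ = -∑ m, gmul n (t m) (⁅X, B m⁆ -
      ∑ p, ∑ k, gmul n (MvPolynomial.pderiv k (X (MvPolynomial.X (m p))))
        (B (Function.update m p k))) := by
    simp only [map_sub, Finset.sum_sub_distrib, map_sum]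
    rw [h1, h2, Finset.sum_congr rfl fun p _ => h3 p, Finset.sum_comm (γ := ι)]
    abel
  rw [h4]
  exact neg_mem (sum_mem fun m _ => hN _ _ (hB m))

end Contraction

/-! ### The submodule generated by `y i j * y k l + y i k * y j l` -/

namespace TwoTwo

variable {n : ℕ}

theorem sym_eq (a b c d : Fin n) : sym a b c d =
    (basisTensor (idx a b c d) - basisTensor (idx c b a d) - basisTensor (idx a d c b)
      + basisTensor (idx c d a b))
    + (basisTensor (idx b a c d) - basisTensor (idx c a b d) - basisTensor (idx b d c a)
      + basisTensor (idx c d b a))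
    + (basisTensor (idx a b d c) - basisTensor (idx d b a c) - basisTensor (idx a c d b)
      + basisTensor (idx d c a b))
    + (basisTensor (idx b a d c) - basisTensor (idx d a b c) - basisTensor (idx b c d a)
      + basisTensor (idx d c b a)) := by
  refine tensor_ext fun p q r s => ?_
  simp only [sym, youngSymmetrizer_apply, Tensor.add_apply, Tensor.sub_apply, basisTensor_idx]
  simp only [and_comm, and_left_comm, and_assoc]
  ring

/-- The elements of `M 3 / M 4` contracted with the tensor fields of type `(2, 2)`. -/
def coeffs (m : diagram22.cells → Fin n) : Gr (FreeAlg n) 3 :=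
  quadGen (m p10) (m p00) (m p01) (m p11)

theorem coeffs_idx (a b c d : Fin n) : coeffs (idx a b c d) = quadGen c a b d := rfl

/-- Up to sign and order only three products of two y's occur; y_ab y_cd cancels and each of the
other two appears twelve times. The number 12 is the product of the hook lengths of (2, 2). -/
theorem contr_sym (a b c d : Fin n) :
    contr coeffs (sym a b c d) = (12 : ℂ) • quadGen c a b d := by
  have orient : ∀ i j k l : Fin n,
      y4 j i * y4 k l = -(y4 i j * y4 k l) ∧ y4 i j * y4 l k = -(y4 i j * y4 k l) ∧
      y4 j i * y4 l k = y4 i j * y4 k l ∧ y4 k l * y4 i j = y4 i j * y4 k l ∧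
      y4 k l * y4 j i = -(y4 i j * y4 k l) ∧ y4 l k * y4 i j = -(y4 i j * y4 k l) ∧
      y4 l k * y4 j i = y4 i j * y4 k l := by
    intro i j k l
    have h1 : y4 j i = -y4 i j := y4_skew j i
    have h2 : y4 l k = -y4 k l := y4_skew l k
    have h3 := y4_comm k l i j
    simp only [h1, h2, h3, neg_mul, mul_neg, neg_neg, and_self]
  refine emb_injective ?_
  rw [sym_eq]
  simp only [map_add, map_sub, map_smul, contr_basisTensor, coeffs_idx, emb_quadGen]
  obtain ⟨a1, a2, a3, a4, a5, a6, a7⟩ := orient c a b d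
  obtain ⟨b1, b2, b3, b4, b5, b6, b7⟩ := orient c b a d
  obtain ⟨c1, c2, c3, c4, c5, c6, c7⟩ := orient a b c d
  simp only [a1, a2, a3, a4, a5, a6, a7, b1, b2, b3, b4, b5, b6, b7, c1, c2, c3, c4, c5, c6, c7]
  module

theorem contr_lie (X : W n) (t : Tensor n diagram22.cells) :
    contr coeffs ⁅X, t⁆ = ⁅X, contr coeffs t⁆ := by
  refine sub_eq_zero.1 ((Submodule.mem_bot ℂ).1 (lie_contr_sub_mem ⊥ ?_ X coeffs ?_ t))
  · intro f v hv
    rw [(Submodule.mem_bot ℂ).1 hv, map_zero]; exact zero_mem _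
  · intro m
    rw [eq_idx m, Submodule.mem_bot, sub_eq_zero, coeffs_idx, lie_quadGen, sum_cells]
    simp only [idx_p00, idx_p01, idx_p10, idx_p11, update_p00, update_p01, update_p10, update_p11,
      coeffs_idx]
    abel

/-- The equivariant map from the tensor fields of type `(2, 2)` to `M 3 / M 4`. -/
def toGrHom (n : ℕ) : TensorField n diagram22 →ₗ⁅ℂ, W n⁆ Gr (FreeAlg n) 3 where
  toLinearMap := contr coeffs ∘ₗ (TensorField n diagram22).toSubmodule.subtype
  map_lie' := fun {X t} => contr_lie X t

theorem toGrHom_apply (t : TensorField n diagram22) : toGrHom n t = contr coeffs (t : Tensor n _) :=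
  rfl

variable (n) in
/-- The submodule of `M 3 / M 4` generated by the elements `y i j * y k l + y i k * y j l`. -/
def quadSpan : LieSubmodule ℂ (W n) (Gr (FreeAlg n) 3) :=
  LieSubmodule.lieSpan ℂ (W n) {v | ∃ i j k l : Fin n, v = quadGen i j k l}

theorem quadGen_mem_range (i j k l : Fin n) : quadGen i j k l ∈ (toGrHom n).range := by
  refine ⟨(12 : ℂ)⁻¹ • ⟨sym j k i l, ⟨_, rfl⟩⟩, ?_⟩
  rw [map_smul, toGrHom_apply, contr_sym, smul_smul, inv_mul_cancel₀ (by norm_num), one_smul]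

theorem sym_ne_zero (hn : 2 ≤ n) : ∃ a b c d : Fin n, sym a b c d ≠ 0 := by
  refine ⟨⟨0, by omega⟩, ⟨0, by omega⟩, ⟨1, by omega⟩, ⟨1, by omega⟩, fun h => ?_⟩
  have := congrArg (fun s : Tensor n diagram22.cells =>
    s (idx ⟨0, by omega⟩ ⟨0, by omega⟩ ⟨1, by omega⟩ ⟨1, by omega⟩)) h
  simp [sym, youngSymmetrizer_apply, basisTensor_idx] at this
  norm_num at this

/-- The range is no larger, because the preimage of `quadSpan n` is a nonzero submodule of an
irreducible module. -/
theorem quadSpan_eq_range (hn : 2 ≤ n) : quadSpan n = (toGrHom n).range := by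
  refine le_antisymm (LieSubmodule.lieSpan_le.2 ?_) ?_
  · rintro _ ⟨i, j, k, l, rfl⟩
    exact quadGen_mem_range i j k l
  · have := irreducible hn
    have htop : (quadSpan n).comap (toGrHom n) = ⊤ := by
      refine (eq_bot_or_eq_top _).resolve_left fun h => ?_
      obtain ⟨a, b, c, d, hs⟩ := sym_ne_zero hn
      refine hs (congrArg Subtype.val ((LieSubmodule.eq_bot_iff _).1 h ⟨sym a b c d, ⟨_, rfl⟩⟩ ?_))
      rw [LieSubmodule.mem_comap, toGrHom_apply, contr_sym]
      exact (quadSpan n).smul_mem _ (LieSubmodule.subset_lieSpan ⟨_, _, _, _, rfl⟩)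
    rintro _ ⟨t, rfl⟩
    have : t ∈ (quadSpan n).comap (toGrHom n) := by rw [htop]; trivial
    exact this

/-- This is not visible from the definition, which closes only under vector fields. It holds because
the submodule is the image of the tensor fields under contraction, and contraction is linear over
functions. -/
theorem gmul_mem_quadSpan (hn : 2 ≤ n) (f : Poly n) {v : Gr (FreeAlg n) 3} (hv : v ∈ quadSpan n) :
    gmul n f v ∈ quadSpan n := by
  rw [quadSpan_eq_range hn] at hv ⊢
  obtain ⟨⟨_, ⟨u, rfl⟩⟩, rfl⟩ := hv
  refine ⟨⟨youngSymmetrizer n diagram22 (tmul f u), ⟨_, rfl⟩⟩, ?_⟩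
  exact (congrArg (contr coeffs) (tmul_youngSymmetrizer _ f u)).trans (contr_tmul _ _ _)

theorem quadGen_mem_quadSpan (i j k l : Fin n) : quadGen i j k l ∈ quadSpan n :=
  LieSubmodule.subset_lieSpan ⟨_, _, _, _, rfl⟩

end TwoTwo

/-! ### The quotient by the submodule generated by `y i j * y k l + y i k * y j l` -/

namespace TwoOne

open UnivLieNilp.TwoTwo (quadSpan gmul_mem_quadSpan quadGen_mem_quadSpan)

variable {n : ℕ}

theorem sym_eq (a b c : Fin n) : sym a b c =
    (basisTensor (idx a b c) - basisTensor (idx c b a))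
    + (basisTensor (idx b a c) - basisTensor (idx c a b)) := by
  refine tensor_ext fun p q r => ?_
  simp only [sym, youngSymmetrizer_apply, Tensor.add_apply, Tensor.sub_apply, basisTensor_idx]
  simp only [and_comm, and_left_comm, and_assoc]
  ring

/-- The elements of `M 3 / M 4` contracted with the tensor fields of type `(2, 1)`. -/
def coeffs (m : diagram21.cells → Fin n) : Gr (FreeAlg n) 3 :=
  tripleGen (m p01) (m p00) (m p10)

theorem coeffs_idx (a b c : Fin n) : coeffs (idx a b c) = tripleGen b a c := rfl

theorem tripleGen_skew (i j k : Fin n) : tripleGen i k j = -tripleGen i j k := by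
  refine emb_injective ?_
  rw [map_neg, emb_tripleGen, emb_tripleGen, y4_skew k j, Ring.lie_def, Ring.lie_def]
  noncomm_ring

theorem tripleGen_jacobi (i j k : Fin n) :
    tripleGen i j k + tripleGen j k i + tripleGen k i j = 0 := by
  refine emb_injective ?_
  simp only [map_add, emb_tripleGen, map_zero, y4, y, map_sub, map_mul, Ring.lie_def]
  noncomm_ring

theorem contr_sym (a b c : Fin n) :
    contr coeffs (sym a b c) = (2 : ℂ) • (tripleGen b a c + tripleGen a b c) := by
  rw [sym_eq]
  simp only [map_add, map_sub, contr_basisTensor, coeffs_idx]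
  rw [tripleGen_skew b a c, tripleGen_skew a b c]
  module

/-- A single `sym` contracts to a sum of two triple commutators. Skew-symmetrizing in a, c and
applying Jacobi isolates one of them, with coefficient 2 · 3. -/
theorem contr_sym_sub (a b c : Fin n) :
    contr coeffs (sym a b c - sym c b a) = (6 : ℂ) • tripleGen b a c := by
  rw [map_sub, contr_sym, contr_sym]
  have h := tripleGen_jacobi a b c
  rw [tripleGen_skew b a c, tripleGen_skew c b a] at *
  rw [add_assoc, add_eq_zero_iff_eq_neg] at h
  rw [h]
  module

theorem contr_lie_sub_mem (hn : 2 ≤ n) (X : W n) (t : Tensor n diagram21.cells) :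
    contr coeffs ⁅X, t⁆ - ⁅X, contr coeffs t⁆ ∈ quadSpan n := by
  refine lie_contr_sub_mem (quadSpan n).toSubmodule (fun f v hv => gmul_mem_quadSpan hn f hv)
    X coeffs (fun m => ?_) t
  rw [eq_idx m, sum_cells]
  simp only [idx_p00, idx_p01, idx_p10, update_p00, update_p01, update_p10, coeffs_idx]
  have h := lie_tripleGen_sub_mem X (m p01) (m p00) (m p10) (quadSpan n).toSubmodule
    fun f i j k l => gmul_mem_quadSpan hn f (quadGen_mem_quadSpan i j k l)
  convert h using 2
  abel

/-- The equivariant map from the tensor fields of type `(2, 1)` to the quotient of `M 3 / M 4` by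
the submodule generated by the elements `y i j * y k l + y i k * y j l`. -/
def toQuotHom (hn : 2 ≤ n) :
    TensorField n diagram21 →ₗ⁅ℂ, W n⁆ Gr (FreeAlg n) 3 ⧸ quadSpan n where
  toLinearMap := (quadSpan n).toSubmodule.mkQ ∘ₗ contr coeffs ∘ₗ
    (TensorField n diagram21).toSubmodule.subtype
  map_lie' := fun {X t} => (Submodule.Quotient.eq _).2 (contr_lie_sub_mem hn X t)

/-- The preimage of the range in `M 3 / M 4` is stable under functions and contains the quadratic
generators, which map to zero, and the triple commutators; so it is everything. -/
theorem toQuotHom_surjective (hn : 2 ≤ n) : Function.Surjective (toQuotHom hn) := by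
  let N : Submodule ℂ (Gr (FreeAlg n) 3) :=
    ((toQuotHom hn).range.toSubmodule).comap (quadSpan n).toSubmodule.mkQ
  have hN : N = ⊤ := by
    refine eq_top_of_generators_mem N ?_ ?_ ?_
    · rintro f v ⟨⟨_, ⟨u, rfl⟩⟩, ht⟩
      refine ⟨⟨youngSymmetrizer n diagram21 (tmul f u), ⟨_, rfl⟩⟩, ?_⟩
      refine (Submodule.Quotient.eq _).2 ?_
      have h := gmul_mem_quadSpan hn f ((Submodule.Quotient.eq _).1 ht)
      rw [map_sub] at h
      change contr coeffs (youngSymmetrizer n diagram21 (tmul f u)) - gmul n f v ∈ quadSpan n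
      rw [tmul_youngSymmetrizer, contr_tmul]
      exact h
    · intro i j k l
      refine ⟨0, ?_⟩
      rw [map_zero]
      exact ((Submodule.Quotient.mk_eq_zero _).2 (quadGen_mem_quadSpan i j k l)).symm
    · intro i j k
      refine ⟨(6 : ℂ)⁻¹ • ⟨sym j i k - sym k i j, sub_mem ⟨_, rfl⟩ ⟨_, rfl⟩⟩, ?_⟩
      rw [map_smul]
      change (6 : ℂ)⁻¹ • (quadSpan n).toSubmodule.mkQ (contr coeffs (sym j i k - sym k i j)) = _
      rw [contr_sym_sub, ← map_smul, smul_smul, inv_mul_cancel₀ (by norm_num), one_smul]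
  intro v
  obtain ⟨v, rfl⟩ := Submodule.mkQ_surjective _ v
  have : v ∈ N := by rw [hN]; trivial
  exact this

end TwoOne

/-! ### A graded representation by `2 × 2` matrices -/

namespace MatRep

/-- The `2 × 2` matrices over `ℂ[X]`. -/
abbrev Mat : Type := Matrix (Fin 2) (Fin 2) (Polynomial ℂ)

/-- The matrices divisible by `X ^ k`. -/
def V (k : ℕ) : Submodule ℂ Mat where
  carrier := {P | ∃ Q : Mat, P = (Polynomial.X : Polynomial ℂ) ^ k • Q}
  add_mem' := by
    rintro _ _ ⟨P, rfl⟩ ⟨Q, rfl⟩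
    exact ⟨P + Q, (smul_add _ _ _).symm⟩
  zero_mem' := ⟨0, (smul_zero _).symm⟩
  smul_mem' := by
    rintro c _ ⟨P, rfl⟩
    exact ⟨c • P, smul_comm _ _ _⟩

theorem mul_mem_V {j k : ℕ} {P Q : Mat} (hP : P ∈ V j) (hQ : Q ∈ V k) : P * Q ∈ V (j + k) := by
  obtain ⟨P, rfl⟩ := hP
  obtain ⟨Q, rfl⟩ := hQ
  exact ⟨P * Q, by rw [smul_mul_smul_comm, pow_add]⟩

theorem mul_mem_V_left (P : Mat) {k : ℕ} {Q : Mat} (hQ : Q ∈ V k) : P * Q ∈ V k := by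
  obtain ⟨Q, rfl⟩ := hQ
  exact ⟨P * Q, mul_smul_comm _ _ _⟩

theorem mul_mem_V_right (P : Mat) {k : ℕ} {Q : Mat} (hQ : Q ∈ V k) : Q * P ∈ V k := by
  obtain ⟨Q, rfl⟩ := hQ
  exact ⟨Q * P, smul_mul_assoc _ _ _⟩

theorem coeff_eq_zero {j k : ℕ} (hjk : j < k) {P : Mat} (hP : P ∈ V k) (a b : Fin 2) :
    (P a b).coeff j = 0 := by
  obtain ⟨P, rfl⟩ := hP
  rw [Matrix.smul_apply, smul_eq_mul, mul_comm, Polynomial.coeff_mul_X_pow', if_neg hjk.not_ge]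

variable (n : ℕ)

/-- The images of the generators. -/
def gen (i : Fin n) : Mat :=
  if (i : ℕ) = 0 then (Polynomial.X : Polynomial ℂ) • !![0, 1; 0, 0]
  else if (i : ℕ) = 1 then (Polynomial.X : Polynomial ℂ) • !![0, 0; 1, 0] else 0

/-- The representation `x_0 ↦ X E₀₁`, `x_1 ↦ X E₁₀`, and `x_i ↦ 0` for the other generators. -/
def rep : FreeAlg n →ₐ[ℂ] Mat := FreeAlgebra.lift ℂ (gen n)

variable {n}

theorem gen_mem_V (i : Fin n) : gen n i ∈ V 1 := by
  unfold gen
  split_ifs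
  · exact ⟨_, by rw [pow_one]⟩
  · exact ⟨_, by rw [pow_one]⟩
  · exact zero_mem _

/-- Modulo X every image is a scalar matrix. Hence a bracket with an image raises the order in X by
at least one. -/
theorem exists_scalar (a : FreeAlg n) : ∃ c : ℂ, rep n a - algebraMap ℂ Mat c ∈ V 1 := by
  induction a using FreeAlgebra.induction with
  | grade0 r => exact ⟨r, by rw [AlgHom.commutes, sub_self]; exact zero_mem _⟩
  | grade1 i => exact ⟨0, by rw [map_zero, sub_zero, rep, FreeAlgebra.lift_ι_apply]; exact gen_mem_V i⟩
  | mul a b ha hb =>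
    obtain ⟨c, hc⟩ := ha
    obtain ⟨d, hd⟩ := hb
    refine ⟨c * d, ?_⟩
    have e : rep n (a * b) - algebraMap ℂ Mat (c * d) =
        (rep n a - algebraMap ℂ Mat c) * rep n b
          + algebraMap ℂ Mat c * (rep n b - algebraMap ℂ Mat d) := by
      rw [map_mul, map_mul]; noncomm_ring
    rw [e]
    exact add_mem (mul_mem_V_right _ hc) (mul_mem_V_left _ hd)
  | add a b ha hb =>
    obtain ⟨c, hc⟩ := ha
    obtain ⟨d, hd⟩ := hb
    refine ⟨c + d, ?_⟩
    rw [map_add, map_add, add_sub_add_comm]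
    exact add_mem hc hd

theorem comm_mem_V (a : FreeAlg n) {k : ℕ} {P : Mat} (hP : P ∈ V k) :
    rep n a * P - P * rep n a ∈ V (k + 1) := by
  obtain ⟨c, hc⟩ := exists_scalar a
  have e : rep n a * P - P * rep n a = (rep n a - algebraMap ℂ Mat c) * P
      - P * (rep n a - algebraMap ℂ Mat c) := by
    rw [sub_mul, mul_sub, Algebra.commutes]; abel
  rw [e]
  refine sub_mem ?_ (mul_mem_V hP hc)
  rw [add_comm]
  exact mul_mem_V hc hP

theorem rep_L_mem_V : ∀ (k : ℕ) (a : FreeAlg n), a ∈ L (FreeAlg n) (k + 2) → rep n a ∈ V (k + 2)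
  | k, x, hx => by
    change x ∈ Submodule.span ℂ _ at hx
    induction hx using Submodule.span_induction with
    | mem x h =>
      obtain ⟨a, b, hb, rfl⟩ := h
      rw [map_sub, map_mul, map_mul]
      cases k with
      -- In the first bracket `b` also contributes a factor X once its scalar part is removed, so
      -- that `L 2` lands in `V 2` and not only in `V 1`.
      | zero =>
        obtain ⟨c, hc⟩ := exists_scalar b
        have e : rep n a * rep n b - rep n b * rep n a = rep n a * (rep n b - algebraMap ℂ Mat c)
            - (rep n b - algebraMap ℂ Mat c) * rep n a := by
          rw [sub_mul, mul_sub, Algebra.commutes]; abel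
        rw [e]
        exact comm_mem_V a hc
      | succ k => exact comm_mem_V a (rep_L_mem_V k b hb)
    | zero => rw [map_zero]; exact zero_mem _
    | add x y _ _ h1 h2 => rw [map_add]; exact add_mem h1 h2
    | smul c x _ h => rw [map_smul]; exact Submodule.smul_mem _ c h

theorem trace_L_eq_zero (k : ℕ) {a : FreeAlg n} (ha : a ∈ L (FreeAlg n) (k + 2)) :
    (rep n a).trace = 0 := by
  change a ∈ Submodule.span ℂ _ at ha
  induction ha using Submodule.span_induction with
  | mem x h =>
    obtain ⟨a, b, hb, rfl⟩ := h
    rw [map_sub, map_mul, map_mul, Matrix.trace_sub, Matrix.trace_mul_comm, sub_self]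
  | zero => rw [map_zero, Matrix.trace_zero]
  | add x y _ _ h1 h2 => rw [map_add, Matrix.trace_add, h1, h2, add_zero]
  | smul c x _ h => rw [map_smul, Matrix.trace_smul, h, smul_zero]

theorem rep_M_four_mem_V {a : FreeAlg n} (ha : a ∈ M (FreeAlg n) 4) : rep n a ∈ V 4 := by
  refine M_induction (p := fun a => rep n a ∈ V 4) (fun a b hb c => ?_) (fun x y hx hy => ?_) ha
  · rw [map_mul, map_mul]
    exact mul_mem_V_right _ (mul_mem_V_left _ (rep_L_mem_V 2 b hb))
  · rw [map_add]; exact add_mem hx hy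

theorem trace_coeff_eq_zero {j k : ℕ} (hjk : j < k) {P : Mat} (hP : P ∈ V k) :
    P.trace.coeff j = 0 := by
  rw [Matrix.trace_fin_two, Polynomial.coeff_add, coeff_eq_zero hjk hP, coeff_eq_zero hjk hP,
    add_zero]

/-- In a * b * c with b in `L 4`, the outer factors act as scalars in the lowest degree 4, and what
is left is the trace of a combination of commutators. -/
theorem trace_M_four {a : FreeAlg n} (ha : a ∈ M (FreeAlg n) 4) : (rep n a).trace.coeff 4 = 0 := by
  refine M_induction (p := fun a => (rep n a).trace.coeff 4 = 0) (fun a b hb c => ?_) (fun x y hx hy => ?_) ha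
  · have h4 : rep n b ∈ V 4 := rep_L_mem_V 2 b hb
    obtain ⟨r, hr⟩ := exists_scalar a
    obtain ⟨s, hs⟩ := exists_scalar c
    have h5 : (rep n a - algebraMap ℂ Mat r) * rep n b * rep n c ∈ V (1 + 4) :=
      mul_mem_V_right _ (mul_mem_V hr h4)
    have h5' : rep n b * (rep n c - algebraMap ℂ Mat s) ∈ V (4 + 1) := mul_mem_V h4 hs
    have e : rep n (a * b * c) = (rep n a - algebraMap ℂ Mat r) * rep n b * rep n c
        + r • (rep n b * (rep n c - algebraMap ℂ Mat s)) + r • s • rep n b := by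
      rw [map_mul, map_mul, sub_mul, mul_sub, sub_mul, ← Algebra.smul_def, smul_mul_assoc,
        ← Algebra.commutes, ← Algebra.smul_def, smul_sub]
      abel
    rw [e, Matrix.trace_add, Matrix.trace_add, Matrix.trace_smul, Matrix.trace_smul,
      Matrix.trace_smul, trace_L_eq_zero 2 hb, smul_zero, smul_zero, add_zero, Polynomial.coeff_add,
      Polynomial.coeff_smul, trace_coeff_eq_zero (by norm_num) h5,
      trace_coeff_eq_zero (by norm_num) h5', smul_zero, add_zero]
  · rw [map_add, Matrix.trace_add, Polynomial.coeff_add, hx, hy, add_zero]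

variable (n) in
/-- The functional on `M 3 / M 4` given by the degree three part of the upper right entry. -/
def entryFunctional : Gr (FreeAlg n) 3 →ₗ[ℂ] ℂ :=
  Submodule.liftQ _ (Polynomial.lcoeff ℂ 3 ∘ₗ Matrix.entryLinearMap ℂ (Polynomial ℂ) 0 1 ∘ₗ
    (rep n).toLinearMap ∘ₗ (M (FreeAlg n) 3).subtype) fun x hx =>
      coeff_eq_zero (by norm_num) (rep_M_four_mem_V (a := (x : FreeAlg n)) hx) 0 1

theorem entryFunctional_toGr (x : M (FreeAlg n) 3) :
    entryFunctional n (toGr 3 x) = (rep n x 0 1).coeff 3 := rfl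

variable (n) in
/-- The functional on `M 3 / M 4` given by the degree four part of the trace. -/
def traceFunctional : Gr (FreeAlg n) 3 →ₗ[ℂ] ℂ :=
  Submodule.liftQ _ (Polynomial.lcoeff ℂ 4 ∘ₗ Matrix.traceLinearMap (Fin 2) ℂ (Polynomial ℂ) ∘ₗ
    (rep n).toLinearMap ∘ₗ (M (FreeAlg n) 3).subtype) fun x hx =>
      trace_M_four (a := (x : FreeAlg n)) hx

theorem traceFunctional_toGr (x : M (FreeAlg n) 3) :
    traceFunctional n (toGr 3 x) = (rep n x).trace.coeff 4 := rfl

/-- Products of two y's have order at least 4 in X. The functional therefore kills `quadSpan n` and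
can detect a triple commutator outside it. -/
theorem entryFunctional_gmul_quadGen (f : Poly n) (i j k l : Fin n) :
    entryFunctional n (gmul n f (quadGen i j k l)) = 0 := by
  have hy : ∀ i j : Fin n, rep n (y i j) ∈ V 2 := fun i j =>
    rep_L_mem_V 0 _ (comm_mem_L 0 _ Submodule.mem_top)
  have hq : rep n (y i j * y k l + y i k * y j l) ∈ V (2 + 2) := by
    rw [map_add, map_mul, map_mul]
    exact add_mem (mul_mem_V (hy i j) (hy k l)) (mul_mem_V (hy i k) (hy j l))
  have hm := mul_mem_V_left (rep n (liftFn n f)) hq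
  rw [← map_mul] at hm
  exact coeff_eq_zero (by norm_num) hm 0 1

section Values

variable (hn : 2 ≤ n)

theorem rep_ι_zero : rep n (FreeAlgebra.ι ℂ ⟨0, by omega⟩) =
    (Polynomial.X : Polynomial ℂ) • !![0, 1; 0, 0] := by
  simp [rep, gen]

theorem rep_ι_one : rep n (FreeAlgebra.ι ℂ ⟨1, by omega⟩) =
    (Polynomial.X : Polynomial ℂ) • !![0, 0; 1, 0] := by
  simp [rep, gen]

theorem rep_y : rep n (y ⟨0, by omega⟩ ⟨1, by omega⟩) =
    !![(Polynomial.X : Polynomial ℂ) ^ 2, 0; 0, -Polynomial.X ^ 2] := by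
  rw [y, map_sub, map_mul, map_mul, rep_ι_zero hn, rep_ι_one hn]
  refine Matrix.ext fun a b => ?_
  fin_cases a <;> fin_cases b <;> simp [pow_two]

theorem entryFunctional_tripleGen :
    entryFunctional n (tripleGen ⟨0, by omega⟩ ⟨0, by omega⟩ ⟨1, by omega⟩) = -2 := by
  rw [tripleGen, entryFunctional_toGr, map_lie_ring, rep_y hn, rep_ι_zero hn, Ring.lie_def]
  have e : ((Polynomial.X : Polynomial ℂ) • (!![0, 1; 0, 0] : Mat) *
      !![(Polynomial.X : Polynomial ℂ) ^ 2, 0; 0, -Polynomial.X ^ 2] -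
      !![(Polynomial.X : Polynomial ℂ) ^ 2, 0; 0, -Polynomial.X ^ 2] *
        (Polynomial.X : Polynomial ℂ) • (!![0, 1; 0, 0] : Mat)) 0 1 =
      Polynomial.C (-2) * Polynomial.X ^ 3 := by
    simp only [map_neg, map_ofNat]
    simp
    ring
  rw [e, Polynomial.coeff_C_mul_X_pow, if_pos rfl]

theorem traceFunctional_quadGen :
    traceFunctional n (quadGen ⟨0, by omega⟩ ⟨1, by omega⟩ ⟨0, by omega⟩ ⟨1, by omega⟩) = 2 := by
  have h0 : ∀ i : Fin n, y i i = 0 := fun i => sub_self _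
  rw [quadGen, traceFunctional_toGr]
  simp only [h0, zero_mul, add_zero, map_mul, rep_y hn]
  have e : (!![(Polynomial.X : Polynomial ℂ) ^ 2, 0; 0, -Polynomial.X ^ 2] *
      !![(Polynomial.X : Polynomial ℂ) ^ 2, 0; 0, -Polynomial.X ^ 2]).trace =
      Polynomial.C 2 * Polynomial.X ^ 4 := by
    simp only [map_ofNat]
    simp [Matrix.trace_fin_two]
    ring
  rw [e, Polynomial.coeff_C_mul_X_pow, if_pos rfl]

end Values

/-- Traces of commutators vanish, so this functional kills the image of `L 3` and can detect a
quadratic element outside it. -/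
theorem traceFunctional_L_three {a : FreeAlg n} (ha : a ∈ L (FreeAlg n) 3) :
    traceFunctional n (toGr 3 ⟨a, L_le_M 3 ha⟩) = 0 := by
  rw [traceFunctional_toGr, trace_L_eq_zero 1 ha, Polynomial.coeff_zero]

end MatRep

/-! ### The decomposition of `M 3 / M 4` -/

section Decomposition

variable {n : ℕ}

/-- A bijective homomorphism of Lie modules is an equivalence. -/
def lieModuleEquivOfBijective {R L₀ M₁ M₂ : Type*} [CommRing R] [LieRing L₀] [AddCommGroup M₁]
    [AddCommGroup M₂] [Module R M₁] [Module R M₂] [LieRingModule L₀ M₁] [LieRingModule L₀ M₂]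
    (f : M₁ →ₗ⁅R, L₀⁆ M₂) (hf : Function.Bijective f) : M₁ ≃ₗ⁅R, L₀⁆ M₂ :=
  { f with
    invFun := (Equiv.ofBijective f hf).symm
    left_inv := (Equiv.ofBijective f hf).left_inv
    right_inv := (Equiv.ofBijective f hf).right_inv }

variable (n) in
/-- The image of `L 3` in `M 3 / M 4`. -/
def lieSpanThree : LieSubmodule ℂ (W n) (Gr (FreeAlg n) 3) where
  carrier := {v | ∃ (a : FreeAlg n) (ha : a ∈ L (FreeAlg n) 3), v = toGr 3 ⟨a, L_le_M 3 ha⟩}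
  add_mem' := by
    rintro _ _ ⟨a, ha, rfl⟩ ⟨b, hb, rfl⟩
    exact ⟨a + b, add_mem ha hb, rfl⟩
  zero_mem' := ⟨0, zero_mem _, rfl⟩
  smul_mem' := by
    rintro c _ ⟨a, ha, rfl⟩
    exact ⟨c • a, Submodule.smul_mem _ c ha, rfl⟩
  lie_mem := by
    rintro X _ ⟨a, ha, rfl⟩
    exact ⟨liftD X a, (isDerivation_liftD X).map_L 3 a ha, rfl⟩

theorem tripleGen_mem_lieSpanThree (i j k : Fin n) : tripleGen i j k ∈ lieSpanThree n :=
  ⟨_, lie_mem_L_three _ _ _, rfl⟩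

open UnivLieNilp.TwoTwo (quadSpan quadSpan_eq_range toGrHom toGrHom_apply quadGen_mem_range)

theorem exists_tripleGen_notMem (hn : 2 ≤ n) : ∃ i j k : Fin n, tripleGen i j k ∉ quadSpan n := by
  refine ⟨⟨0, by omega⟩, ⟨0, by omega⟩, ⟨1, by omega⟩, fun h => ?_⟩
  rw [quadSpan_eq_range hn] at h
  obtain ⟨t, ht⟩ := h
  have h2 := MatRep.entryFunctional_tripleGen hn
  have h0 : MatRep.entryFunctional n (toGrHom n t) = 0 := by
    rw [toGrHom_apply, contr_apply, map_sum]
    exact Finset.sum_eq_zero fun m _ => MatRep.entryFunctional_gmul_quadGen _ _ _ _ _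
  rw [← ht] at h2
  exact absurd (h0.symm.trans h2) (by norm_num)

theorem exists_quadGen_notMem (hn : 2 ≤ n) :
    ∃ i j k l : Fin n, quadGen i j k l ∉ lieSpanThree n := by
  refine ⟨⟨0, by omega⟩, ⟨1, by omega⟩, ⟨0, by omega⟩, ⟨1, by omega⟩, fun h => ?_⟩
  obtain ⟨a, ha, h⟩ := h
  have h2 := MatRep.traceFunctional_quadGen hn
  rw [h, MatRep.traceFunctional_L_three ha] at h2
  exact two_ne_zero h2.symm

/-- By irreducibility the preimage is zero or everything, and the trace functional excludes the
latter. The result gives both the injectivity of `toGrHom` and the disjointness of the two summands.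
-/
theorem comap_lieSpanThree (hn : 2 ≤ n) : (lieSpanThree n).comap (toGrHom n) = ⊥ := by
  have := TwoTwo.irreducible hn
  refine (eq_bot_or_eq_top _).resolve_right fun h => ?_
  obtain ⟨i, j, k, l, hq⟩ := exists_quadGen_notMem hn
  obtain ⟨t, ht⟩ := quadGen_mem_range i j k l
  have hm : t ∈ (lieSpanThree n).comap (toGrHom n) := by rw [h]; trivial
  rw [LieSubmodule.mem_comap] at hm
  exact hq (ht ▸ hm)

theorem toGrHom_injective (hn : 2 ≤ n) : Function.Injective (toGrHom n) := by
  rw [injective_iff_map_eq_zero]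
  intro t ht
  refine (LieSubmodule.eq_bot_iff _).1 (comap_lieSpanThree hn) t ?_
  rw [LieSubmodule.mem_comap, ht]
  exact zero_mem _

theorem toQuotHom_injective (hn : 2 ≤ n) : Function.Injective (TwoOne.toQuotHom hn) := by
  have := TwoOne.irreducible hn
  have hker : (TwoOne.toQuotHom hn).ker = ⊥ := by
    refine (eq_bot_or_eq_top _).resolve_right fun h => ?_
    obtain ⟨i, j, k, hijk⟩ := exists_tripleGen_notMem hn
    obtain ⟨t, ht⟩ := TwoOne.toQuotHom_surjective hn
      (LieSubmodule.Quotient.mk' (quadSpan n) (tripleGen i j k))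
    have hm : t ∈ (TwoOne.toQuotHom hn).ker := by rw [h]; trivial
    rw [LieModuleHom.mem_ker, ht] at hm
    exact hijk ((LieSubmodule.Quotient.mk_eq_zero _).1 hm)
  exact (LieModuleHom.ker_eq_bot _).1 hker

theorem isCompl_lieSpanThree_quadSpan (hn : 2 ≤ n) : IsCompl (lieSpanThree n) (quadSpan n) := by
  constructor
  · rw [disjoint_iff, LieSubmodule.eq_bot_iff]
    rintro v ⟨hY, hZ⟩
    have hZ' : v ∈ quadSpan n := hZ
    rw [quadSpan_eq_range hn] at hZ'
    obtain ⟨t, rfl⟩ := hZ'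
    rw [(LieSubmodule.eq_bot_iff _).1 (comap_lieSpanThree hn) t hY, map_zero]
  · have := TwoOne.irreducible hn
    let π := LieSubmodule.Quotient.mk' (quadSpan n)
    -- The image of Y in the quotient by Z pulls back to a nonzero submodule of an irreducible
    -- module. It is therefore the whole quotient, and Y + Z is everything.
    have htop : ((lieSpanThree n).map π).comap (TwoOne.toQuotHom hn) = ⊤ := by
      refine (eq_bot_or_eq_top _).resolve_left fun h => ?_
      obtain ⟨i, j, k, hijk⟩ := exists_tripleGen_notMem hn
      obtain ⟨t, ht⟩ := TwoOne.toQuotHom_surjective hn (π (tripleGen i j k))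
      have h0 := (LieSubmodule.eq_bot_iff _).1 h t (by
        rw [LieSubmodule.mem_comap, ht]
        exact LieSubmodule.mem_map_of_mem (tripleGen_mem_lieSpanThree i j k))
      rw [h0, map_zero] at ht
      exact hijk ((LieSubmodule.Quotient.mk_eq_zero _).1 ht.symm)
    rw [codisjoint_iff, eq_top_iff]
    intro v _
    obtain ⟨t, ht⟩ := TwoOne.toQuotHom_surjective hn (π v)
    have hm : t ∈ ((lieSpanThree n).map π).comap (TwoOne.toQuotHom hn) := by rw [htop]; trivial
    rw [LieSubmodule.mem_comap, ht] at hm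
    obtain ⟨w, hw, hwv⟩ := (LieSubmodule.mem_map _).1 hm
    have hz : v - w ∈ quadSpan n := by
      rw [← LieSubmodule.Quotient.mk_eq_zero, map_sub, sub_eq_zero]
      exact hwv.symm
    rw [← add_sub_cancel w v]
    exact (LieSubmodule.mem_sup _ _ _).2 ⟨w, hw, v - w, hz, rfl⟩

theorem nonempty_quadSpan_equiv (hn : 2 ≤ n) :
    Nonempty (quadSpan n ≃ₗ⁅ℂ, W n⁆ TensorField n diagram22) := by
  let f : TensorField n diagram22 →ₗ⁅ℂ, W n⁆ quadSpan n :=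
    { toFun := fun t => ⟨toGrHom n t, by rw [quadSpan_eq_range hn]; exact ⟨t, rfl⟩⟩
      map_add' := fun s t => Subtype.ext (map_add (toGrHom n) s t)
      map_smul' := fun c t => Subtype.ext (map_smul (toGrHom n) c t)
      map_lie' := fun {X t} => Subtype.ext (LieModuleHom.map_lie (toGrHom n) X t) }
  refine ⟨(lieModuleEquivOfBijective f ⟨fun s t h => ?_, ?_⟩).symm⟩
  · exact toGrHom_injective hn (congrArg Subtype.val h)
  · rintro ⟨v, hv⟩
    have hv' := hv
    rw [quadSpan_eq_range hn] at hv'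
    obtain ⟨t, rfl⟩ := hv'
    exact ⟨t, rfl⟩

/-- The isomorphism goes through the quotient by Z, which its complement Y represents: contraction
with triple commutators has been shown equivariant only modulo Z. -/
theorem nonempty_lieSpanThree_equiv (hn : 2 ≤ n) :
    Nonempty (lieSpanThree n ≃ₗ⁅ℂ, W n⁆ TensorField n diagram21) := by
  let f : lieSpanThree n →ₗ⁅ℂ, W n⁆ Gr (FreeAlg n) 3 ⧸ quadSpan n :=
    (LieSubmodule.Quotient.mk' (quadSpan n)).comp (lieSpanThree n).incl
  have hc := isCompl_lieSpanThree_quadSpan hn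
  have hf : Function.Bijective f := by
    constructor
    · rw [injective_iff_map_eq_zero]
      rintro ⟨v, hv⟩ h
      have hz : v ∈ quadSpan n := (LieSubmodule.Quotient.mk_eq_zero _).1 h
      exact Subtype.ext ((LieSubmodule.eq_bot_iff _).1 hc.inf_eq_bot v ⟨hv, hz⟩)
    · intro q
      obtain ⟨v, rfl⟩ := LieSubmodule.Quotient.surjective_mk' _ q
      have hv : v ∈ lieSpanThree n ⊔ quadSpan n := by rw [hc.sup_eq_top]; trivial
      obtain ⟨w, hw, z, hz, rfl⟩ := (LieSubmodule.mem_sup _ _ _).1 hv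
      refine ⟨⟨w, hw⟩, ?_⟩
      rw [map_add, (LieSubmodule.Quotient.mk_eq_zero _).2 hz, add_zero]
      rfl
  exact ⟨(lieModuleEquivOfBijective f hf).trans
    (lieModuleEquivOfBijective (TwoOne.toQuotHom hn)
      ⟨toQuotHom_injective hn, TwoOne.toQuotHom_surjective hn⟩).symm⟩

end Decomposition

end UnivLieNilp

end

theorem proposition5p3 (n : ℕ) (hn : 2 ≤ n) :
    (∀ X : W n, ∃ D : FreeAlg n →ₗ[ℂ] FreeAlg n, IsDerivation D ∧ Lifts D X) ∧
    ∃ (_ : LieRingModule (W n) (Gr (FreeAlg n) 3)) (_ : LieModule ℂ (W n) (Gr (FreeAlg n) 3)),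
      (∀ (X : W n) (D : FreeAlg n →ₗ[ℂ] FreeAlg n) (hD : IsDerivation D), Lifts D X →
        ∀ v : Gr (FreeAlg n) 3, ⁅X, v⁆ = hD.onGr 3 v) ∧
      LieModule.IsIrreducible ℂ (W n) (TensorField n diagram21) ∧
      LieModule.IsIrreducible ℂ (W n) (TensorField n diagram22) ∧
      ∃ Y Z : LieSubmodule ℂ (W n) (Gr (FreeAlg n) 3),
        (Y : Set (Gr (FreeAlg n) 3)) =
          {v | ∃ (a : FreeAlg n) (ha : a ∈ L (FreeAlg n) 3), v = toGr 3 ⟨a, L_le_M 3 ha⟩} ∧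
        Z = LieSubmodule.lieSpan ℂ (W n)
          {v | ∃ i j k l : Fin n, v = toGr 3 ⟨y i j * y k l + y i k * y j l, yy_mem_M i j k l⟩} ∧
        IsCompl Y Z ∧
        Nonempty (Y ≃ₗ⁅ℂ, W n⁆ TensorField n diagram21) ∧
        Nonempty (Z ≃ₗ⁅ℂ, W n⁆ TensorField n diagram22) :=
  ⟨exists_lift, inferInstance, inferInstance, fun _ _ hD hX v => lie_gr_eq hD hX v,
    TwoOne.irreducible hn, TwoTwo.irreducible hn, lieSpanThree n, TwoTwo.quadSpan n, rfl, rfl,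
    isCompl_lieSpanThree_quadSpan hn, nonempty_lieSpanThree_equiv hn, nonempty_quadSpan_equiv hn⟩
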